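/- Let $\sigma\subset\mathbb H^3$ be a bi-infinite geodesic, and let $\hat{\mathbb H}^3$ be the metric completion of the universal cover of $\mathbb H^3\setminus\sigma$ (with its lifted path metric); the set $\hat\sigma$ of points added in the completion is a singular geodesic of infinite cone angle. The additive group $\mathbb C$ acts on $\hat{\mathbb H}^3$ by isometries, $z$ translating along $\hat\sigma$ by $\operatorname{Re} z$ and rotating about $\hat\sigma$ by the real angle $\operatorname{Im} z$. For $\alpha>0$, $\lambda>0$ and $\tau\in\mathbb R$, the *model solid torus* $N=N_{\alpha,\lambda,\tau}$ is the quotient of $\hat{\mathbb H}^3$ by the subgroup of $\mathbb C$ generated by $i\alpha$ and $\lambda+i\tau$. Its core $\Sigma$, the image of $\hat\sigma$, is a closed geodesic of length $\lambda$ with cone angle $\alpha$. The injectivity radius $\operatorname{injrad}(x)$ of $x\in N$ is the supremum of the radii $\rho$ for which the open $\rho$-ball about $x$ is isometric, in the Riemannian sense and preserving centres, to a ball of radius $\rho$ in $\mathbb H^3$; if $\alpha\ne2\pi$ and $x\in\Sigma$, set $\operatorname{injrad}(x)=0$. For $\epsilon>0$ let $N^{\le\epsilon}=\{x\in N:\operatorname{injrad}(x)\le\epsilon/2\}$.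 **Proposition.** Let $N=N_{\alpha,\lambda,\tau}$ be a model solid torus with cone angle $0<\alpha\le2\pi$ and core length $0<\lambda\le2.97$, with $\tau\in\mathbb R$ arbitrary, and let $\epsilon>0$ be such that $N^{\le\epsilon}\ne\emptyset$. Then there is exactly one real number $r(\epsilon)=r_{\alpha,\lambda,\tau}(\epsilon)$, the tube radius, such that the boundary $\partial N^{\le\epsilon}$ is the set of all points of $N$ at distance $r(\epsilon)$ from $\Sigma$, and it satisfies $$\cosh r_{\alpha,\lambda,\tau}(\epsilon)\;\ge\;\frac{\epsilon}{\sqrt{(4\pi/\sqrt3)\,\lambda}}\;\ge\;\frac{\epsilon}{\sqrt{7.256\,\lambda}}.$$ -/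

import Mathlib

open Set Metric
open UniformSpace (Completion)
open scoped ENNReal unitInterval

noncomputable section

namespace TubeModel

/-! ### Hyperbolic 3-space -/

/-- Hyperbolic 3-space, as the upper half-space `ℂ × (0, ∞)`. -/
@[ext] structure H3 where
  z : ℂ
  t : ℝ
  t_pos : 0 < t

namespace H3

/-- The hyperbolic distance `arcosh (1 + (|z - w|² + (t - s)²) / (2 t s))`. -/
instance : Dist H3 :=
  ⟨fun p q => Real.arcosh (1 + (‖p.z - q.z‖ ^ 2 + (p.t - q.t) ^ 2) / (2 * p.t * q.t))⟩

theorem dist_def (p q : H3) :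
    dist p q = Real.arcosh (1 + (‖p.z - q.z‖ ^ 2 + (p.t - q.t) ^ 2) / (2 * p.t * q.t)) := rfl

theorem cosh_dist (p q : H3) :
    Real.cosh (dist p q) = 1 + (‖p.z - q.z‖ ^ 2 + (p.t - q.t) ^ 2) / (2 * p.t * q.t) := by
  have := p.t_pos
  have := q.t_pos
  rw [dist_def, Real.cosh_arcosh]
  have : 0 ≤ (‖p.z - q.z‖ ^ 2 + (p.t - q.t) ^ 2) / (2 * p.t * q.t) := by positivity
  linarith

theorem dist_nonneg' (p q : H3) : 0 ≤ dist p q := by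
  have := p.t_pos
  have := q.t_pos
  refine Real.arcosh_nonneg ?_
  have : 0 ≤ (‖p.z - q.z‖ ^ 2 + (p.t - q.t) ^ 2) / (2 * p.t * q.t) := by positivity
  linarith

/-- The Euclidean position of a point of the upper half-space. -/
def toE (p : H3) : WithLp 2 (ℂ × ℝ) := WithLp.toLp 2 (p.z, p.t)

/-- The Euclidean mirror image of a point of the upper half-space. -/
def toE' (p : H3) : WithLp 2 (ℂ × ℝ) := WithLp.toLp 2 (p.z, -p.t)

theorem dist_toE_sq (p q : H3) :
    dist p.toE q.toE ^ 2 = ‖p.z - q.z‖ ^ 2 + (p.t - q.t) ^ 2 := by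
  rw [WithLp.prod_dist_eq_of_L2, Real.sq_sqrt (by positivity)]
  simp [toE, dist_eq_norm]

theorem dist_toE'_sq (p q : H3) :
    dist p.toE q.toE' ^ 2 = ‖p.z - q.z‖ ^ 2 + (p.t + q.t) ^ 2 := by
  rw [WithLp.prod_dist_eq_of_L2, Real.sq_sqrt (by positivity)]
  simp [toE, toE', dist_eq_norm]

theorem dist_toE'_comm (p q : H3) : dist p.toE q.toE' = dist q.toE p.toE' := by
  rw [← sq_eq_sq₀ dist_nonneg dist_nonneg, dist_toE'_sq, dist_toE'_sq, norm_sub_rev, add_comm p.t]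

theorem dist_toE_self' (p : H3) : dist p.toE p.toE' = 2 * p.t := by
  have := p.t_pos
  rw [← sq_eq_sq₀ dist_nonneg (by positivity), dist_toE'_sq]
  simp
  ring

theorem sinh_half_dist (p q : H3) :
    Real.sinh (dist p q / 2) = dist p.toE q.toE / (2 * (√p.t * √q.t)) := by
  have h1 := p.t_pos
  have h2 := q.t_pos
  have h0 := dist_nonneg' p q
  rw [← sq_eq_sq₀ (Real.sinh_nonneg_iff.2 (by linarith)) (by positivity), div_pow, dist_toE_sq,
    mul_pow, mul_pow, Real.sq_sqrt h1.le, Real.sq_sqrt h2.le]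
  have h := cosh_dist p q
  have h3 : dist p q = 2 * (dist p q / 2) := by ring
  rw [h3, Real.cosh_two_mul, Real.cosh_sq] at h
  field_simp at h ⊢
  linarith

theorem cosh_half_dist (p q : H3) :
    Real.cosh (dist p q / 2) = dist p.toE q.toE' / (2 * (√p.t * √q.t)) := by
  have h1 := p.t_pos
  have h2 := q.t_pos
  rw [← sq_eq_sq₀ (Real.cosh_pos _).le (by positivity), Real.cosh_sq, sinh_half_dist, div_pow,
    div_pow, dist_toE_sq, dist_toE'_sq, mul_pow, mul_pow, Real.sq_sqrt h1.le, Real.sq_sqrt h2.le]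
  field_simp
  ring

protected theorem dist_triangle (a b c : H3) : dist a c ≤ dist a b + dist b c := by
  have ha := a.t_pos
  have hb := b.t_pos
  have hc := c.t_pos
  suffices h : Real.sinh (dist a c / 2) ≤ Real.sinh (dist a b / 2 + dist b c / 2) by
    have := Real.sinh_le_sinh.1 h
    linarith
  rw [Real.sinh_add, sinh_half_dist, sinh_half_dist, sinh_half_dist, cosh_half_dist,
    cosh_half_dist]
  have key := EuclideanGeometry.mul_dist_le_mul_dist_add_mul_dist a.toE b.toE c.toE b.toE'
  rw [dist_toE_self', dist_toE'_comm c b] at key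
  have hsb : √b.t * √b.t = b.t := Real.mul_self_sqrt hb.le
  have h1 : dist a.toE b.toE / (2 * (√a.t * √b.t)) * (dist b.toE c.toE' / (2 * (√b.t * √c.t))) +
      dist a.toE b.toE' / (2 * (√a.t * √b.t)) * (dist b.toE c.toE / (2 * (√b.t * √c.t))) =
      (dist a.toE b.toE * dist b.toE c.toE' + dist b.toE c.toE * dist a.toE b.toE') /
        (4 * (√a.t * √c.t) * b.t) := by
    rw [div_mul_div_comm, div_mul_div_comm, ← add_div]
    congr 1
    · ring
    · linear_combination 4 * (√a.t * √c.t) * hsb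
  rw [h1, div_le_div_iff₀ (by positivity) (by positivity)]
  have h2 : 0 ≤ 2 * (√a.t * √c.t) := by positivity
  nlinarith [mul_le_mul_of_nonneg_left key h2]

instance : MetricSpace H3 where
  dist_self p := by simp [dist_def]
  dist_comm p q := by
    rw [dist_def, dist_def, norm_sub_rev]
    ring_nf
  dist_triangle := H3.dist_triangle
  eq_of_dist_eq_zero {p q} h := by
    have h1 := p.t_pos
    have h2 := q.t_pos
    have h3 := cosh_dist p q
    rw [h, Real.cosh_zero] at h3
    have h4 : (‖p.z - q.z‖ ^ 2 + (p.t - q.t) ^ 2) / (2 * p.t * q.t) = 0 := by linarith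
    rw [div_eq_zero_iff] at h4
    have h5 : ‖p.z - q.z‖ ^ 2 + (p.t - q.t) ^ 2 = 0 := by
      rcases h4 with h4 | h4
      · exact h4
      · exact absurd h4 (by positivity)
    have h6 : ‖p.z - q.z‖ = 0 := by nlinarith [sq_nonneg ‖p.z - q.z‖, sq_nonneg (p.t - q.t)]
    have h7 : p.t - q.t = 0 := by nlinarith [sq_nonneg ‖p.z - q.z‖, sq_nonneg (p.t - q.t)]
    exact H3.ext (sub_eq_zero.1 (norm_eq_zero.1 h6)) (by linarith)

/-- The basepoint of hyperbolic space. -/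
def base : H3 := ⟨0, 1, one_pos⟩

theorem dist_le (p q : H3) : dist p q ≤ dist p.toE q.toE / (√p.t * √q.t) := by
  have h1 := p.t_pos
  have h2 := q.t_pos
  have h0 : 0 ≤ dist p q / 2 := by have := dist_nonneg' p q; linarith
  have h : dist p q / 2 ≤ _ := (Real.self_le_sinh_iff.2 h0).trans_eq (sinh_half_dist p q)
  have h3 : dist p.toE q.toE / (√p.t * √q.t) = 2 * (dist p.toE q.toE / (2 * (√p.t * √q.t))) := by
    field_simp
  linarith

/-- The point of hyperbolic space with cylindrical coordinates `(r, ζ, θ)` about the geodesic `σ`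
that runs along the vertical half-line over `0`: it is at distance `r` from `σ`, its foot on `σ`
is at signed distance `ζ` from the basepoint, and its angle about `σ` is `θ`. In these coordinates
the metric is `dr² + cosh² r dζ² + sinh² r dθ²`. -/
def cyl (r ζ θ : ℝ) : H3 where
  z := (Real.exp ζ * Real.tanh r : ℝ) * Complex.exp (θ * Complex.I)
  t := Real.exp ζ / Real.cosh r
  t_pos := div_pos (Real.exp_pos _) (Real.cosh_pos _)

end H3

/-! ### The universal cover of the complement of a geodesic, with its length metric -/

/-- Cylindrical coordinates `(r, ζ, θ)` with `r > 0` and real-valued angle `θ`. With the map `dev`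
below, this is the universal cover of `H3 \ σ`. It carries the topology of `ℝ × ℝ × ℝ`. -/
abbrev CylCoords := {p : ℝ × ℝ × ℝ // 0 < p.1}

/-- The covering map from cylindrical coordinates onto `H3 \ σ`. -/
def dev (p : CylCoords) : H3 := H3.cyl p.1.1 p.1.2.1 p.1.2.2

/-- The length of a path in the universal cover, measured by projecting it to `H3`. -/
def pathLength {p q : CylCoords} (γ : Path p q) : ℝ≥0∞ :=
  eVariationOn (fun s => dev (γ s)) univ

/-- The path distance in the universal cover. -/
def lengthEDist (p q : CylCoords) : ℝ≥0∞ := ⨅ γ : Path p q, pathLength γ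

theorem lengthEDist_self (p : CylCoords) : lengthEDist p p = 0 := by
  refine le_antisymm ((iInf_le _ (Path.refl p)).trans ?_) zero_le
  refine (eVariationOn.constant_on ?_).le
  rintro _ ⟨s, -, rfl⟩ _ ⟨s', -, rfl⟩
  rfl

theorem lengthEDist_comm_le (p q : CylCoords) : lengthEDist p q ≤ lengthEDist q p := by
  refine le_iInf fun γ => (iInf_le _ γ.symm).trans ?_
  refine eVariationOn.comp_le_of_antitoneOn (fun s => dev (γ s)) (s := univ) unitInterval.symm ?_
    (mapsTo_univ _ _)
  intro a _ b _ hab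
  exact unitInterval.symm_le_symm.2 hab

theorem pathLength_trans_le {p q u : CylCoords} (γ : Path p q) (γ' : Path q u) :
    pathLength (γ.trans γ') ≤ pathLength γ + pathLength γ' := by
  have hm : (1 / 2 : ℝ) ∈ I := ⟨by norm_num, by norm_num⟩
  set m : I := ⟨1 / 2, hm⟩
  have hu : (univ : Set I) = Iic m ∪ Ici m := Iic_union_Ici.symm
  unfold pathLength
  rw [hu, eVariationOn.union _ (x := m) ⟨self_mem_Iic, fun _ h => h⟩ ⟨self_mem_Ici, fun _ h => h⟩,
    ← hu]
  refine add_le_add ?_ ?_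
  · have h1 : EqOn (fun s => dev ((γ.trans γ') s))
        ((fun s => dev (γ s)) ∘ fun s : I => projIcc (0 : ℝ) 1 zero_le_one (2 * s)) (Iic m) := by
      intro s hs
      have hs' : (s : ℝ) ≤ 1 / 2 := hs
      have h0 : 2 * (s : ℝ) ∈ Icc (0 : ℝ) 1 := ⟨by linarith [s.2.1], by linarith⟩
      simp only [Path.trans_apply, hs', dif_pos, Function.comp, projIcc_of_mem zero_le_one h0]
    rw [eVariationOn.congr h1]
    refine eVariationOn.comp_le_of_monotoneOn _ _ ?_ (mapsTo_univ _ _)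
    intro a _ b _ hab
    refine monotone_projIcc _ ?_
    have : (a : ℝ) ≤ b := hab
    linarith
  · have h1 : EqOn (fun s => dev ((γ.trans γ') s))
        ((fun s => dev (γ' s)) ∘ fun s : I => projIcc (0 : ℝ) 1 zero_le_one (2 * s - 1))
        (Ici m) := by
      intro s hs
      have hs' : 1 / 2 ≤ (s : ℝ) := hs
      have h0 : 2 * (s : ℝ) - 1 ∈ Icc (0 : ℝ) 1 := ⟨by linarith, by linarith [s.2.2]⟩
      simp only [Path.trans_apply, Function.comp, projIcc_of_mem zero_le_one h0]
      split_ifs with h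
      · have hs2 : (s : ℝ) = 1 / 2 := le_antisymm h hs'
        congr 1
        have e1 : (⟨2 * (s : ℝ), (unitInterval.mul_pos_mem_iff zero_lt_two).2 ⟨s.2.1, h⟩⟩ : I) = 1 :=
          Subtype.ext (by simp [hs2])
        have e2 : (⟨2 * (s : ℝ) - 1, h0⟩ : I) = 0 := Subtype.ext (by simp [hs2])
        rw [e1, e2, γ.target, γ'.source]
      · rfl
    rw [eVariationOn.congr h1]
    refine eVariationOn.comp_le_of_monotoneOn _ _ ?_ (mapsTo_univ _ _)
    intro a _ b _ hab
    refine monotone_projIcc _ ?_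
    have : (a : ℝ) ≤ b := hab
    linarith

theorem lengthEDist_triangle (p q u : CylCoords) :
    lengthEDist p u ≤ lengthEDist p q + lengthEDist q u :=
  ENNReal.le_iInf_add_iInf fun γ γ' =>
    (iInf_le _ (γ.trans γ')).trans (pathLength_trans_le γ γ')

/-- The straight path between two points in cylindrical coordinates. -/
def straightPath (p q : CylCoords) : Path p q where
  toFun s := ⟨(p : ℝ × ℝ × ℝ) + (s : ℝ) • ((q : ℝ × ℝ × ℝ) - p), by
    have h0 := s.2.1
    have h1 := s.2.2
    have hp := p.2
    have hq := q.2
    simp only [Prod.fst_add, Prod.smul_fst, Prod.fst_sub, smul_eq_mul]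
    by_cases h : (s : ℝ) = 0
    · rw [h]; linarith
    · have : 0 < (s : ℝ) := lt_of_le_of_ne h0 (Ne.symm h)
      nlinarith⟩
  continuous_toFun := by fun_prop
  source' := by simp
  target' := by simp

theorem lengthEDist_ne_top (p q : CylCoords) : lengthEDist p q ≠ ⊤ := by
  refine ne_top_of_le_ne_top ?_ (iInf_le _ (straightPath p q))
  set L : ℝ → ℝ × ℝ × ℝ := fun s => (p : ℝ × ℝ × ℝ) + s • ((q : ℝ × ℝ × ℝ) - p) with hL
  set F : ℝ → H3 := fun s => H3.cyl (L s).1 (L s).2.1 (L s).2.2 with hF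
  have hLc : ContDiff ℝ 1 L := by fun_prop
  have h1 : ContDiff ℝ 1 fun s => (L s).1 := by fun_prop
  have h2 : ContDiff ℝ 1 fun s => (L s).2.1 := by fun_prop
  have h3 : ContDiff ℝ 1 fun s => (L s).2.2 := by fun_prop
  have ht : ContDiff ℝ 1 fun s => (F s).t :=
    (Real.contDiff_exp.comp h2).div (Real.contDiff_cosh.comp h1) fun s => (Real.cosh_pos _).ne'
  have hz : ContDiff ℝ 1 fun s => (F s).z := by
    have e : (fun s => (F s).z) = fun s =>
        ((Real.exp (L s).2.1 * (Real.sinh (L s).1 / Real.cosh (L s).1) : ℝ) : ℂ) *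
          Complex.exp (((L s).2.2 : ℝ) * Complex.I) := by
      funext s
      simp only [hF, H3.cyl, Real.tanh_eq_sinh_div_cosh]
    rw [e]
    refine ContDiff.mul (Complex.ofRealCLM.contDiff.comp ((Real.contDiff_exp.comp h2).mul
      ((Real.contDiff_sinh.comp h1).div (Real.contDiff_cosh.comp h1)
        fun s => (Real.cosh_pos _).ne'))) ?_
    exact Complex.contDiff_exp.comp ((Complex.ofRealCLM.contDiff.comp h3).mul contDiff_const)
  have hE : ContDiff ℝ 1 fun s => (F s).toE := by
    have : (fun s => (F s).toE) = fun s => WithLp.toLp 2 ((F s).z, (F s).t) := rfl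
    rw [this]
    exact (WithLp.prodContinuousLinearEquiv 2 ℝ ℂ ℝ).symm.contDiff.comp (hz.prodMk ht)
  obtain ⟨K, hK⟩ := hE.contDiffOn.exists_lipschitzOnWith one_ne_zero (convex_Icc (0 : ℝ) 1)
    isCompact_Icc
  obtain ⟨s₀, hs₀, hmin⟩ := isCompact_Icc.exists_isMinOn (nonempty_Icc.2 (zero_le_one' ℝ))
    ht.continuous.continuousOn
  have hlip : LipschitzOnWith (K * (1 / (F s₀).t).toNNReal) F (Icc 0 1) := by
    refine LipschitzOnWith.of_dist_le_mul fun a ha b hb => ?_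
    have h0 := (F s₀).t_pos
    have hta : (F s₀).t ≤ (F a).t := hmin ha
    have htb : (F s₀).t ≤ (F b).t := hmin hb
    have hsq : (F s₀).t ≤ √(F a).t * √(F b).t := by
      rw [← Real.sqrt_mul (F a).t_pos.le]
      refine Real.le_sqrt_of_sq_le ?_
      nlinarith
    calc dist (F a) (F b) ≤ dist (F a).toE (F b).toE / (√(F a).t * √(F b).t) := H3.dist_le _ _
      _ ≤ (K * dist a b) / (F s₀).t := by
          gcongr
          exact hK.dist_le_mul a ha b hb
      _ = _ := by
          rw [NNReal.coe_mul, Real.coe_toNNReal _ (by positivity)]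
          ring
  have hb := hlip.locallyBoundedVariationOn 0 1 (by simp) (by simp)
  rw [inter_self] at hb
  refine ne_top_of_le_ne_top hb ?_
  exact eVariationOn.comp_le_of_monotoneOn F (Subtype.val : I → ℝ)
    (fun a _ b _ hab => hab) fun s _ => s.2

/-- The universal cover of `H3 \ σ`, as a metric space with the path distance. -/
@[ext] structure Cover where
  coords : CylCoords

instance : PseudoMetricSpace Cover where
  dist p q := (lengthEDist p.coords q.coords).toReal
  dist_self p := by simp [lengthEDist_self]
  dist_comm p q := by
    rw [le_antisymm (lengthEDist_comm_le p.coords q.coords) (lengthEDist_comm_le _ _)]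
  dist_triangle p q u := by
    rw [← ENNReal.toReal_add (lengthEDist_ne_top _ _) (lengthEDist_ne_top _ _)]
    exact ENNReal.toReal_mono
      (ENNReal.add_ne_top.2 ⟨lengthEDist_ne_top _ _, lengthEDist_ne_top _ _⟩)
      (lengthEDist_triangle _ _ _)

theorem Cover.dist_def (p q : Cover) : dist p q = (lengthEDist p.coords q.coords).toReal := rfl

/-! ### The action of `ℂ` by translations along, and rotations about, the geodesic -/

/-- `z` translates by `Re z` along `σ` and rotates by the real angle `Im z` about `σ`. -/
def shift (z : ℂ) (p : CylCoords) : CylCoords :=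
  ⟨(p.1.1, z.re + p.1.2.1, z.im + p.1.2.2), p.2⟩

theorem continuous_shift (z : ℂ) : Continuous (shift z) := by
  unfold shift
  fun_prop

theorem dist_dev_shift (z : ℂ) (p q : CylCoords) :
    dist (dev (shift z p)) (dev (shift z q)) = dist (dev p) (dev q) := by
  have hz (u : CylCoords) : (dev (shift z u)).z = Complex.exp z * (dev u).z := by
    simp only [dev, shift, H3.cyl]
    conv_rhs => rw [← Complex.re_add_im z, Complex.exp_add]
    push_cast
    rw [Complex.exp_add, add_mul, Complex.exp_add]
    ring
  have ht (u : CylCoords) : (dev (shift z u)).t = Real.exp z.re * (dev u).t := by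
    simp only [dev, shift, H3.cyl, Real.exp_add]
    ring
  rw [H3.dist_def, H3.dist_def, hz, hz, ht, ht, ← mul_sub, ← mul_sub, norm_mul, Complex.norm_exp,
    mul_pow, mul_pow, ← mul_add]
  congr 2
  have := Real.exp_pos z.re
  have := (dev p).t_pos
  have := (dev q).t_pos
  field_simp

theorem shift_zero (p : CylCoords) : shift 0 p = p := by
  simp [shift]

theorem shift_add (z w : ℂ) (p : CylCoords) : shift (z + w) p = shift z (shift w p) := by
  simp [shift, add_assoc]

instance : AddAction ℂ Cover where
  vadd z p := ⟨shift z p.coords⟩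
  zero_vadd p := Cover.ext (shift_zero p.coords)
  add_vadd z w p := Cover.ext (shift_add z w p.coords)

theorem lengthEDist_shift_le (z : ℂ) (p q : CylCoords) :
    lengthEDist (shift z p) (shift z q) ≤ lengthEDist p q := by
  refine le_iInf fun γ => (iInf_le _ (γ.map (continuous_shift z))).trans ?_
  refine iSup_mono fun u => Finset.sum_le_sum fun i _ => ?_
  simp only [Path.map_coe, Function.comp, edist_dist, dist_dev_shift, le_refl]

instance : IsIsometricVAdd ℂ Cover where
  isometry_vadd z := by
    refine Isometry.of_dist_eq fun p q => congrArg ENNReal.toReal ?_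
    refine le_antisymm (lengthEDist_shift_le z p.coords q.coords) ?_
    have h := lengthEDist_shift_le (-z) (shift z p.coords) (shift z q.coords)
    rwa [← shift_add, ← shift_add, neg_add_cancel, shift_zero, shift_zero] at h

instance : UniformContinuousConstVAdd ℂ Cover where
  uniformContinuous_const_vadd z := (isometry_vadd Cover z).uniformContinuous

/-! ### The infinite cyclic branched cover and the model solid tori -/

/-- The metric completion of the universal cover of `H3 \ σ`: the infinite cyclic cover of `H3`
branched over `σ`. -/
abbrev BranchedCover : Type := Completion Cover

/-- The singular geodesic: the set of points added in the completion. -/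
def axis : Set BranchedCover := (range ((↑) : Cover → BranchedCover))ᶜ

instance : IsIsometricVAdd ℂ BranchedCover where
  isometry_vadd z := (isometry_vadd Cover z).completion_map

/-- The deck group, generated by the elliptic `iα` and the loxodromic `lam + iτ`. -/
def deck (α lam τ : ℝ) : AddSubgroup ℂ :=
  AddSubgroup.closure {α * Complex.I, lam + τ * Complex.I}

/-- The model solid torus: the quotient of the branched cover by the deck group. -/
def SolidTorus (α lam τ : ℝ) : Type := AddAction.orbitRel.Quotient (deck α lam τ) BranchedCover

namespace SolidTorus

variable {α lam τ : ℝ}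

/-- The quotient map. -/
def mk (α lam τ : ℝ) (x : BranchedCover) : SolidTorus α lam τ :=
  Quotient.mk (AddAction.orbitRel (deck α lam τ) BranchedCover) x

theorem mk_surjective : Function.Surjective (mk α lam τ) := Quotient.mk_surjective

theorem mk_eq_mk {x y : BranchedCover} :
    mk α lam τ x = mk α lam τ y ↔ ∃ g : deck α lam τ, g +ᵥ y = x :=
  Quotient.eq.trans (AddAction.orbitRel_apply.trans Iff.rfl)

theorem dist_deck_vadd (g : deck α lam τ) (x y : BranchedCover) :
    dist (g +ᵥ x) (g +ᵥ y) = dist x y :=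
  (isometry_vadd BranchedCover (g : ℂ)).dist_eq x y

theorem bddBelow_dist (x y : BranchedCover) :
    BddBelow (range fun g : deck α lam τ => dist x (g +ᵥ y)) :=
  ⟨0, by rintro _ ⟨g, rfl⟩; exact dist_nonneg⟩

/-- The quotient distance: the infimum of the distances between lifts of two points. -/
instance : PseudoMetricSpace (SolidTorus α lam τ) where
  dist := Quotient.lift₂ (fun x y => ⨅ g : deck α lam τ, dist x (g +ᵥ y)) (by
    rintro a b a' b' ⟨g, rfl⟩ ⟨h, rfl⟩
    change ⨅ k : deck α lam τ, dist (g +ᵥ a') (k +ᵥ h +ᵥ b') =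
      ⨅ k : deck α lam τ, dist a' (k +ᵥ b')
    rw [← Equiv.iInf_comp (Equiv.addLeft g)]
    rw [← Equiv.iInf_comp (Equiv.addRight (-h))]
    refine iInf_congr fun k => ?_
    simp only [Equiv.coe_addLeft, Equiv.coe_addRight, add_vadd, neg_vadd_vadd,
      dist_deck_vadd])
  dist_self a := by
    obtain ⟨x, rfl⟩ := mk_surjective a
    change ⨅ g : deck α lam τ, dist x (g +ᵥ x) = 0
    refine le_antisymm ?_ (le_ciInf fun g => dist_nonneg)
    simpa using ciInf_le (bddBelow_dist (α := α) (lam := lam) (τ := τ) x x) 0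
  dist_comm a b := by
    obtain ⟨x, rfl⟩ := mk_surjective a
    obtain ⟨y, rfl⟩ := mk_surjective b
    change ⨅ g : deck α lam τ, dist x (g +ᵥ y) = ⨅ g : deck α lam τ, dist y (g +ᵥ x)
    rw [← Equiv.iInf_comp (Equiv.neg _)]
    refine iInf_congr fun g => ?_
    rw [Equiv.neg_apply, ← dist_deck_vadd g, vadd_neg_vadd, dist_comm]
  dist_triangle a b c := by
    obtain ⟨x, rfl⟩ := mk_surjective a
    obtain ⟨y, rfl⟩ := mk_surjective b
    obtain ⟨z, rfl⟩ := mk_surjective c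
    change ⨅ g : deck α lam τ, dist x (g +ᵥ z) ≤
      (⨅ g : deck α lam τ, dist x (g +ᵥ y)) + ⨅ g : deck α lam τ, dist y (g +ᵥ z)
    refine le_ciInf_add_ciInf fun g h => ?_
    refine (ciInf_le (bddBelow_dist x z) (g + h)).trans ?_
    refine (dist_triangle x (g +ᵥ y) _).trans ?_
    rw [add_vadd, dist_deck_vadd]

theorem dist_mk (x y : BranchedCover) :
    dist (mk α lam τ x) (mk α lam τ y) = ⨅ g : deck α lam τ, dist x (g +ᵥ y) := rfl

/-- The core curve: the image of the singular geodesic. -/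
def core (α lam τ : ℝ) : Set (SolidTorus α lam τ) := mk α lam τ '' axis

/-- The open `ρ`-ball about `x` is isometric to a hyperbolic ball, in the Riemannian sense: there is
a bijection from the `ρ`-ball about the basepoint of `H3` onto the `ρ`-ball about `x` that takes
the centre to the centre and takes every sufficiently small ball isometrically onto a ball. -/
def IsHyperbolicBall (x : SolidTorus α lam τ) (ρ : ℝ) : Prop :=
  ∃ f : H3 → SolidTorus α lam τ,
    f H3.base = x ∧ BijOn f (ball H3.base ρ) (ball x ρ) ∧
      ∀ p ∈ ball H3.base ρ, ∃ δ > 0,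
        (∀ u ∈ ball p δ, ∀ v ∈ ball p δ, dist (f u) (f v) = dist u v) ∧
          f '' ball p δ = ball (f p) δ

open Classical in
/-- The injectivity radius: the supremal radius of a ball about `x` that is isometric to a
hyperbolic ball, with value `0` on a singular core. -/
def injrad (x : SolidTorus α lam τ) : ℝ≥0∞ :=
  if α ≠ 2 * Real.pi ∧ x ∈ core α lam τ then 0
  else ⨆ (ρ : ℝ) (_ : 0 < ρ ∧ IsHyperbolicBall x ρ), ENNReal.ofReal ρ

/-- The closed `ε`-thin part: the points of injectivity radius at most `ε / 2`. -/
def thin (α lam τ ε : ℝ) : Set (SolidTorus α lam τ) := {x | injrad x ≤ ENNReal.ofReal (ε / 2)}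

/-- The equidistant torus of points at distance `r` from the core. -/
def equidistantTorus (α lam τ r : ℝ) : Set (SolidTorus α lam τ) :=
  {x | infDist x (core α lam τ) = r}

/-- `r` is the radius of the `ε`-tube: the boundary of the `ε`-thin part is the equidistant torus of
radius `r`. -/
def IsTubeRadius (α lam τ ε r : ℝ) : Prop :=
  frontier (thin α lam τ ε) = equidistantTorus α lam τ r

end SolidTorus

end TubeModel

end

noncomputable section

namespace TubeModel

open Real (cosh sinh)

/-! ### Hyperbolic distance in cylindrical coordinates, and geodesics in the hyperboloid model. -/

namespace H3

/-! In cylindrical coordinates `(r, ζ, θ)` the injectivity radius depends only on `r`, because `ℂ`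
is commutative and acts transitively on each set of constant radius. If `r > 0` and the cone angle
is below `2π`, a `ρ`-ball is hyperbolic exactly when `ρ ≤ r` and every nonzero deck element moves a
lift of the centre by at least `2ρ` (`isHyperbolicBall_iff_of_lt`). At cone angle `2π` the solid
torus is the quotient of `H3` by a loxodromic cyclic group, and only the second condition remains
(`isHyperbolicBall_iff_two_pi`). Displacements grow with `r`, since contraction towards the axis is
1-Lipschitz, and exceed any bound for large `r`. So a nonempty thin part is a tube about the core,
and its boundary is an equidistant torus.

For the estimate, the metric `cosh² r dζ² + sinh² r dθ²` of an equidistant surface is at most `cosh²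
r |dz|²`, so `g` moves points at radius `r` by at most `cosh r * ‖g‖`. The deck lattice has covolume
`αλ ≤ 2πλ`, hence contains a nonzero `g` with `‖g‖² ≤ (2/√3)αλ ≤ (4π/√3)λ` (`exists_short_vector`).
Outside the tube this gives `ε < 2ρ ≤ cosh r * √((4π/√3)λ)`, and `r` may decrease to the tube
radius. At cone angle `2π` the vector `g` must not be a pure rotation, which the bound on `λ`
guarantees.

The delicate point is that a hyperbolic ball comes with a map that is only locally isometric, so
that displacements below `2ρ` are not excluded at once. If `g` realises a least displacement `D <
2ρ`, both halves of the geodesic loop from `x` to `g +ᵥ x` pull back to shortest curves of `H3` with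
the same ends, hence coincide. The loop runs back on itself and `g` fixes its midpoint
(`vadd_midpoint_eq`), which is impossible off the axis or for a loxodromic. That a hyperbolic ball
avoids the cone points is a local matter: a cone of angle below `2π` has no antipodal points about
its apex (`IsHyperbolicBall.le_radius`). -/

theorem cosh_dist_mul (p q : H3) :
    cosh (dist p q) * (2 * p.t * q.t) =
      (p.z.re - q.z.re) ^ 2 + (p.z.im - q.z.im) ^ 2 + p.t ^ 2 + q.t ^ 2 := by
  have hp := p.t_pos
  have hq := q.t_pos
  rw [cosh_dist, Complex.sq_norm, Complex.normSq_apply]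
  simp only [Complex.sub_re, Complex.sub_im]
  field_simp
  ring

theorem cosh_dist_cyl (r ζ θ r' ζ' θ' : ℝ) :
    cosh (dist (cyl r ζ θ) (cyl r' ζ' θ')) =
      cosh r * cosh r' * cosh (ζ - ζ') - sinh r * sinh r' * Real.cos (θ - θ') := by
  have h := cosh_dist_mul (cyl r ζ θ) (cyl r' ζ' θ')
  have e1 := Real.cosh_sq r
  have e2 := Real.cosh_sq r'
  have e3 := Real.sin_sq_add_cos_sq θ
  have e4 := Real.sin_sq_add_cos_sq θ'
  have p1 := Real.cosh_pos r
  have p2 := Real.cosh_pos r'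
  have p3 := Real.exp_pos ζ
  have p4 := Real.exp_pos ζ'
  generalize cosh (dist (cyl r ζ θ) (cyl r' ζ' θ')) = K at *
  simp only [cyl, Real.tanh_eq_sinh_div_cosh, Complex.re_ofReal_mul, Complex.im_ofReal_mul,
    Complex.exp_ofReal_mul_I_re, Complex.exp_ofReal_mul_I_im] at h
  have hne : 2 * (Real.exp ζ / cosh r) * (Real.exp ζ' / cosh r') ≠ 0 := by positivity
  refine mul_right_cancel₀ hne (h.trans ?_)
  rw [Real.cosh_eq (ζ - ζ'), neg_sub, Real.exp_sub, Real.exp_sub, Real.cos_sub]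
  field_simp
  generalize Real.exp ζ = a at *
  generalize Real.exp ζ' = b at *
  generalize cosh r = c at *
  generalize cosh r' = c' at *
  generalize sinh r = s at *
  generalize sinh r' = s' at *
  generalize Real.sin θ = x at *
  generalize Real.sin θ' = x' at *
  generalize Real.cos θ = y at *
  generalize Real.cos θ' = y' at *
  linear_combination a ^ 2 * c' ^ 2 * s ^ 2 * e3 + b ^ 2 * c ^ 2 * s' ^ 2 * e4
    - a ^ 2 * c' ^ 2 * e1 - b ^ 2 * c ^ 2 * e2

/-- Separates radial, axial and angular contributions. For nonnegative radii the last two are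
nonnegative and grow with the radii, so that many comparisons of distances can be made term by term.
-/
theorem cosh_dist_cyl' (r ζ θ r' ζ' θ' : ℝ) :
    cosh (dist (cyl r ζ θ) (cyl r' ζ' θ')) =
      cosh (r - r') + cosh r * cosh r' * (cosh (ζ - ζ') - 1)
        + sinh r * sinh r' * (1 - Real.cos (θ - θ')) := by
  rw [cosh_dist_cyl, Real.cosh_sub r]
  ring

theorem le_of_cosh_le {x y : ℝ} (hy : 0 ≤ y) (h : cosh x ≤ cosh y) : x ≤ y := by
  rw [Real.cosh_le_cosh, abs_of_nonneg hy] at h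
  exact (le_abs_self x).trans h

theorem cosh_le_of_le {x y : ℝ} (hx : 0 ≤ x) (h : x ≤ y) : cosh x ≤ cosh y := by
  rwa [Real.cosh_le_cosh, abs_of_nonneg hx, abs_of_nonneg (hx.trans h)]

/-- Equality of hyperbolic cosines identifies a nonnegative real. -/
theorem eq_of_cosh_eq {x y : ℝ} (hx : 0 ≤ x) (hy : 0 ≤ y) (h : cosh x = cosh y) : x = y :=
  le_antisymm (le_of_cosh_le hy h.le) (le_of_cosh_le hx h.ge)

/-- The point at parameter `s` of the geodesic from `a` to `b` is, in the hyperboloid model, a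
linear combination of the end points. -/
theorem cosh_dist_interp {a b c : H3} {D s : ℝ} (hD : dist a b = D) (hD0 : 0 < D)
    (hs : 0 ≤ s) (hsD : s ≤ D)
    (hct : c.t = sinh D / (sinh (D - s) / a.t + sinh s / b.t))
    (hcz : c.z = ((sinh (D - s) / a.t : ℝ) * a.z + (sinh s / b.t : ℝ) * b.z) /
      ((sinh (D - s) / a.t + sinh s / b.t : ℝ) : ℂ)) (m : H3) :
    sinh D * cosh (dist c m) = sinh (D - s) * cosh (dist a m) + sinh s * cosh (dist b m) := by
  have hab := cosh_dist_mul a b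
  have ham := cosh_dist_mul a m
  have hbm := cosh_dist_mul b m
  have hcm := cosh_dist_mul c m
  have hat := a.t_pos
  have hbt := b.t_pos
  have hmt := m.t_pos
  have hct' := c.t_pos
  have hA : 0 ≤ sinh (D - s) := Real.sinh_nonneg_iff.2 (by linarith)
  have hB : 0 ≤ sinh s := Real.sinh_nonneg_iff.2 hs
  have hS : 0 < sinh D := Real.sinh_pos_iff.2 hD0
  -- In the hyperboloid model this says that the combination of `a` and `b` with weights `sinh (D -
  -- s) / sinh D` and `sinh s / sinh D` has Lorentz norm `-1`.
  have hid : sinh D ^ 2 = sinh (D - s) ^ 2 + sinh s ^ 2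
      + 2 * sinh (D - s) * sinh s * cosh D := by
    have e : D = (D - s) + s := by ring
    rw [show sinh D = sinh ((D - s) + s) by rw [← e], show cosh D = cosh ((D - s) + s) by rw [← e],
      Real.sinh_add, Real.cosh_add]
    have e1 := Real.cosh_sq (D - s)
    have e2 := Real.cosh_sq s
    linear_combination sinh s ^ 2 * e1 + sinh (D - s) ^ 2 * e2
  have hq : 0 < sinh (D - s) / a.t + sinh s / b.t := by
    by_contra hq
    have : c.t ≤ 0 := hct ▸ div_nonpos_of_nonneg_of_nonpos hS.le (not_lt.1 hq)
    linarith
  rw [hD] at hab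
  have hzre : c.z.re = (sinh (D - s) / a.t * a.z.re + sinh s / b.t * b.z.re) /
      (sinh (D - s) / a.t + sinh s / b.t) := by
    rw [hcz, Complex.div_ofReal_re, Complex.add_re, Complex.re_ofReal_mul, Complex.re_ofReal_mul]
  have hzim : c.z.im = (sinh (D - s) / a.t * a.z.im + sinh s / b.t * b.z.im) /
      (sinh (D - s) / a.t + sinh s / b.t) := by
    rw [hcz, Complex.div_ofReal_im, Complex.add_im, Complex.im_ofReal_mul, Complex.im_ofReal_mul]
  rw [hzre, hzim, hct] at hcm
  generalize cosh (dist a m) = Xa at *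
  generalize cosh (dist b m) = Xb at *
  generalize cosh (dist c m) = Xc at *
  generalize sinh D = S at *
  generalize cosh D = C at *
  generalize sinh (D - s) = A at *
  generalize sinh s = B at *
  generalize hQ : A / a.t + B / b.t = q at *
  have hq' : q * (a.t * b.t) = A * b.t + B * a.t := by
    rw [← hQ]; field_simp
  generalize a.t = at' at *
  generalize b.t = bt at *
  generalize m.t = mt at *
  generalize a.z.re = ax at *
  generalize a.z.im = ay at *
  generalize b.z.re = bx at *
  generalize b.z.im = b_y at *
  generalize m.z.re = mx at *
  generalize m.z.im = my at *
  obtain rfl : Xa = ((ax - mx) ^ 2 + (ay - my) ^ 2 + at' ^ 2 + mt ^ 2) / (2 * at' * mt) := by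
    rw [eq_div_iff (by positivity)]; exact ham
  obtain rfl : Xb = ((bx - mx) ^ 2 + (b_y - my) ^ 2 + bt ^ 2 + mt ^ 2) / (2 * bt * mt) := by
    rw [eq_div_iff (by positivity)]; exact hbm
  obtain rfl : C = ((ax - bx) ^ 2 + (ay - b_y) ^ 2 + at' ^ 2 + bt ^ 2) / (2 * at' * bt) := by
    rw [eq_div_iff (by positivity)]; exact hab
  subst hQ
  have hq2 : 0 < A * bt + at' * B := by
    have : 0 < at' * bt := by positivity
    nlinarith
  have key : Xc * (2 * S * mt) * (A / at' + B / bt) =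
    ((A / at' * ax + B / bt * bx) - (A / at' + B / bt) * mx) ^ 2 +
    ((A / at' * ay + B / bt * b_y) - (A / at' + B / bt) * my) ^ 2 + S ^ 2
     + mt ^ 2 * (A / at' + B / bt) ^ 2 := by
    have := congrArg (· * (A / at' + B / bt) ^ 2) hcm
    beta_reduce at this
    field_simp at this ⊢
    linear_combination this
  have hne : (2 * mt) * (A / at' + B / bt) ≠ 0 := by positivity
  refine mul_right_cancel₀ hne ?_
  have : S * Xc * (2 * mt * (A / at' + B / bt)) = Xc * (2 * S * mt) * (A / at' + B / bt) := by ring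
  rw [this, key, hid]
  field_simp
  ring

end H3

namespace H3

theorem interp_pos (a b : H3) {D s : ℝ} (hD0 : 0 < D) (hs : 0 ≤ s) (hsD : s ≤ D) :
    0 < sinh (D - s) / a.t + sinh s / b.t := by
  have hat := a.t_pos
  have hbt := b.t_pos
  have hA : 0 ≤ sinh (D - s) := Real.sinh_nonneg_iff.2 (by linarith)
  rcases hs.eq_or_lt with rfl | hs
  · have : 0 < sinh (D - 0) := Real.sinh_pos_iff.2 (by linarith)
    rw [Real.sinh_zero, zero_div, add_zero]
    positivity
  · have : 0 < sinh s := Real.sinh_pos_iff.2 hs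
    positivity

/-- In the hyperboloid model, `c` traces out the geodesic from `a` to `b`, of length `D`. -/
def IsSegment (a b : H3) (D : ℝ) (c : ℝ → H3) : Prop :=
  ∀ s ∈ Icc 0 D, ∀ m, sinh D * cosh (dist (c s) m) =
    sinh (D - s) * cosh (dist a m) + sinh s * cosh (dist b m)

/-- The functions `1 / t` and `z / t` are linear on the hyperboloid; combining those of `a` and `b`
and solving for `z` and `t` gives the witness. Outside the interval the value is arbitrary. -/
theorem exists_isSegment (a b : H3) (h : 0 < dist a b) : ∃ c, IsSegment a b (dist a b) c := by
  have : ∀ s, ∃ c : H3, s ∈ Icc 0 (dist a b) → ∀ m, sinh (dist a b) * cosh (dist c m) =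
      sinh (dist a b - s) * cosh (dist a m) + sinh s * cosh (dist b m) := by
    intro s
    by_cases hs : s ∈ Icc 0 (dist a b)
    · exact ⟨⟨((sinh (dist a b - s) / a.t : ℝ) * a.z + (sinh s / b.t : ℝ) * b.z) /
          ((sinh (dist a b - s) / a.t + sinh s / b.t : ℝ) : ℂ), _,
        div_pos (Real.sinh_pos_iff.2 h) (interp_pos a b h hs.1 hs.2)⟩,
        fun _ => cosh_dist_interp rfl h hs.1 hs.2 rfl rfl⟩
    · exact ⟨a, fun h => absurd h hs⟩
  choose c hc using this
  exact ⟨c, hc⟩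

theorem sinh_cosh_identity (D s t : ℝ) :
    sinh (D - s) * cosh t + sinh s * cosh (D - t) = sinh D * cosh (s - t) := by
  rw [Real.sinh_sub, Real.cosh_sub, Real.cosh_sub]
  ring

namespace IsSegment

variable {a b : H3} {D : ℝ} {c : ℝ → H3}

theorem dist_left (hc : IsSegment a b D c) (hD : dist a b = D) (hD0 : 0 < D) {s : ℝ}
    (hs : s ∈ Icc 0 D) : dist (c s) a = s := by
  have h := hc s hs a
  rw [dist_self, dist_comm b a, hD, Real.cosh_zero] at h
  have h2 := sinh_cosh_identity D s 0
  rw [Real.cosh_zero, sub_zero, sub_zero] at h2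
  exact eq_of_cosh_eq dist_nonneg hs.1
    (mul_left_cancel₀ (Real.sinh_pos_iff.2 hD0).ne' (h.trans h2))

theorem dist_right (hc : IsSegment a b D c) (hD : dist a b = D) (hD0 : 0 < D) {s : ℝ}
    (hs : s ∈ Icc 0 D) : dist (c s) b = D - s := by
  have h := hc s hs b
  rw [dist_self, hD, Real.cosh_zero] at h
  have h2 := sinh_cosh_identity D s D
  rw [sub_self, Real.cosh_zero, ← Real.cosh_neg (s - D), neg_sub] at h2
  exact eq_of_cosh_eq dist_nonneg (by linarith [hs.2])
    (mul_left_cancel₀ (Real.sinh_pos_iff.2 hD0).ne' (h.trans h2))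

theorem dist_eq (hc : IsSegment a b D c) (hD : dist a b = D) (hD0 : 0 < D) {s t : ℝ}
    (hs : s ∈ Icc 0 D) (ht : t ∈ Icc 0 D) : dist (c s) (c t) = |s - t| := by
  have h := hc s hs (c t)
  rw [dist_comm a, dist_comm b, hc.dist_left hD hD0 ht, hc.dist_right hD hD0 ht,
    sinh_cosh_identity] at h
  refine eq_of_cosh_eq dist_nonneg (abs_nonneg _) ?_
  rw [Real.cosh_abs]
  exact mul_left_cancel₀ (Real.sinh_pos_iff.2 hD0).ne' h

theorem apply_zero (hc : IsSegment a b D c) (hD : dist a b = D) (hD0 : 0 < D) : c 0 = a :=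
  dist_eq_zero.1 (hc.dist_left hD hD0 ⟨le_rfl, hD0.le⟩)

theorem apply_right (hc : IsSegment a b D c) (hD : dist a b = D) (hD0 : 0 < D) : c D = b :=
  dist_eq_zero.1 ((hc.dist_right hD hD0 ⟨hD0.le, le_rfl⟩).trans (sub_self D))

/-- Inserting both bounds into the linear formula for `cosh (dist (c s) m)` gives at most `1`. -/
theorem eq_of_dist_le (hc : IsSegment a b D c) (hD0 : 0 < D) {s : ℝ}
    (hs : s ∈ Icc 0 D) {m : H3} (h1 : dist a m ≤ s) (h2 : dist m b ≤ D - s) : c s = m := by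
  have h := hc s hs m
  have e1 := cosh_le_of_le dist_nonneg h1
  have e2 := cosh_le_of_le dist_nonneg h2
  rw [dist_comm m b] at e2
  have hS := Real.sinh_pos_iff.2 hD0
  have hA : 0 ≤ sinh (D - s) := Real.sinh_nonneg_iff.2 (by linarith [hs.2])
  have hB : 0 ≤ sinh s := Real.sinh_nonneg_iff.2 hs.1
  have h3 := sinh_cosh_identity D s s
  rw [sub_self, Real.cosh_zero] at h3
  have h4 : sinh D * cosh (dist (c s) m) ≤ sinh D * 1 := by
    rw [h, ← h3]
    gcongr
  have h5 := le_of_mul_le_mul_left h4 hS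
  rw [← Real.cosh_zero] at h5
  exact dist_eq_zero.1 (le_antisymm (le_of_cosh_le le_rfl h5) dist_nonneg)

end IsSegment

/-- Between two points at distance at least `D` there is at most one point at distance at most `s`
from the first and at most `D - s` from the second. -/
theorem eq_of_dist_le_of_dist_le {a b m m' : H3} {D s : ℝ} (hD : D ≤ dist a b)
    (h1 : dist a m ≤ s) (h2 : dist m b ≤ D - s) (h1' : dist a m' ≤ s) (h2' : dist m' b ≤ D - s) :
    m = m' := by
  have hD' : dist a b = D := le_antisymm (by linarith [dist_triangle a m b]) hD
  have hs : s ∈ Icc 0 D := ⟨dist_nonneg.trans h1, by linarith [dist_nonneg.trans h2]⟩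
  rcases (hs.1.trans hs.2).eq_or_lt with h0 | h0
  · have hs0 : s = 0 := le_antisymm (by linarith [hs.2]) hs.1
    rw [hs0] at h1 h1'
    rw [← dist_le_zero.1 h1, ← dist_le_zero.1 h1']
  · subst hD'
    obtain ⟨c, hc⟩ := exists_isSegment a b h0
    rw [← hc.eq_of_dist_le h0 hs h1 h2, ← hc.eq_of_dist_le h0 hs h1' h2']

/-- Existence of unit speed geodesics. -/
theorem exists_geodesic (a b : H3) : ∃ c : ℝ → H3, c 0 = a ∧ c (dist a b) = b ∧
    ∀ s ∈ Icc 0 (dist a b), ∀ t ∈ Icc 0 (dist a b), dist (c s) (c t) = |s - t| := by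
  rcases (dist_nonneg (x := a) (y := b)).eq_or_lt with h0 | h0
  · refine ⟨fun _ => a, rfl, dist_eq_zero.1 h0.symm, ?_⟩
    rw [← h0]
    intro s hs t ht
    rw [le_antisymm hs.2 hs.1, le_antisymm ht.2 ht.1]
    simp
  · obtain ⟨c, hc⟩ := exists_isSegment a b h0
    exact ⟨c, hc.apply_zero rfl h0, hc.apply_right rfl h0, fun s hs t ht => hc.dist_eq rfl h0 hs ht⟩

/-! ### Symmetries of hyperbolic space and the cylindrical parametrisation. -/

/-- The similarity of the upper half-space that takes the basepoint to `p`. -/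
def fromBase (p : H3) : H3 ≃ᵢ H3 where
  toFun q := ⟨p.t * q.z + p.z, p.t * q.t, mul_pos p.t_pos q.t_pos⟩
  invFun q := ⟨(q.z - p.z) / p.t, q.t / p.t, div_pos q.t_pos p.t_pos⟩
  left_inv q := by
    have h := p.t_pos.ne'
    ext
    · simp [h]
    · simp [h]
  right_inv q := by
    have h := p.t_pos.ne'
    have h' : (p.t : ℂ) ≠ 0 := by exact_mod_cast h
    ext
    · simp only
      field_simp
      ring
    · simp only
      field_simp
  isometry_toFun := by
    refine Isometry.of_dist_eq fun q q' => ?_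
    have hp := p.t_pos
    have hq := q.t_pos
    have hq' := q'.t_pos
    refine eq_of_cosh_eq dist_nonneg dist_nonneg ?_
    have e : (p.t : ℂ) * q.z + p.z - (p.t * q'.z + p.z) = p.t * (q.z - q'.z) := by ring
    rw [cosh_dist, cosh_dist, e, norm_mul, Complex.norm_real, Real.norm_of_nonneg hp.le]
    field_simp

theorem fromBase_base (p : H3) : fromBase p base = p := by
  change H3.mk _ _ _ = p
  ext <;> simp [base]

theorem exists_antipode_base (u : H3) :
    ∃ v, dist base v = dist base u ∧ dist u v = 2 * dist base u := by
  have ht := u.t_pos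
  set n : ℝ := u.z.re ^ 2 + u.z.im ^ 2 + u.t ^ 2 with hn
  have hn0 : 0 < n := by positivity
  -- Inversion in the unit sphere followed by the half turn about the vertical axis is the point
  -- reflection at the basepoint.
  refine ⟨⟨-u.z / (n : ℝ), u.t / n, by positivity⟩, ?_, ?_⟩
  · refine eq_of_cosh_eq dist_nonneg dist_nonneg ?_
    have h1 := cosh_dist_mul base u
    have h2 := cosh_dist_mul base ⟨-u.z / (n : ℝ), u.t / n, by positivity⟩
    generalize cosh (dist base u) = C at *
    generalize cosh (dist base _) = C' at *
    simp only [base, Complex.div_ofReal_re, Complex.div_ofReal_im, Complex.neg_re,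
      Complex.neg_im, Complex.zero_re, Complex.zero_im] at h1 h2
    have h1' : C * (2 * u.t) = n + 1 := by rw [hn]; linarith
    have h2' : C' * (2 * u.t) = n + 1 := by
      have e : (u.z.re / n) ^ 2 + (u.z.im / n) ^ 2 + (u.t / n) ^ 2 = 1 / n := by
        field_simp
        linarith
      have h2'' : C' * (2 * u.t) / n = 1 / n + 1 := by
        rw [← e]
        linear_combination h2
      field_simp at h2''
      linarith
    exact mul_right_cancel₀ (by positivity : 2 * u.t ≠ 0) (h2'.trans h1'.symm)
  · refine eq_of_cosh_eq dist_nonneg (by positivity) ?_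
    have h1 := cosh_dist_mul base u
    have h2 := cosh_dist_mul u ⟨-u.z / (n : ℝ), u.t / n, by positivity⟩
    rw [Real.cosh_two_mul, Real.sinh_sq]
    generalize cosh (dist base u) = C at *
    generalize cosh (dist u _) = C' at *
    simp only [base, Complex.div_ofReal_re, Complex.div_ofReal_im, Complex.neg_re,
      Complex.neg_im, Complex.zero_re, Complex.zero_im] at h1 h2
    have h1' : C = (n + 1) / (2 * u.t) := by
      rw [eq_div_iff (by positivity), hn]; linarith
    have hm : u.z.re ^ 2 + u.z.im ^ 2 = n - u.t ^ 2 := by rw [hn]; ring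
    have h2' : C' * (2 * u.t ^ 2 / n) = (n - u.t ^ 2) * (1 + 1 / n) ^ 2 + u.t ^ 2 + u.t ^ 2 / n ^ 2 := by
      rw [← hm]
      rw [← div_pow]
      linear_combination h2
    have h3 : C' = ((n - u.t ^ 2) * (1 + 1 / n) ^ 2 + u.t ^ 2 + u.t ^ 2 / n ^ 2) /
        (2 * u.t ^ 2 / n) := by
      rw [eq_div_iff (by positivity)]; exact h2'
    rw [h3, h1']
    clear_value n
    field_simp
    ring

/-- The image of `u` under the point reflection at `p`. -/
theorem exists_antipode (p u : H3) :
    ∃ v, dist p v = dist p u ∧ dist u v = 2 * dist p u := by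
  obtain ⟨v, h1, h2⟩ := exists_antipode_base ((fromBase p).symm u)
  have e (w : H3) : dist base ((fromBase p).symm w) = dist p w := by
    rw [← (fromBase p).dist_eq, fromBase_base, IsometryEquiv.apply_symm_apply]
  refine ⟨fromBase p v, ?_, ?_⟩
  · rw [← e, ← e, IsometryEquiv.symm_apply_apply, h1]
  · rw [← e, ← h2, ← (fromBase p).dist_eq ((fromBase p).symm u), IsometryEquiv.apply_symm_apply]

/-- The loxodromic action of `ℂ` on hyperbolic space that fixes the ends of `σ`. -/
instance : AddAction ℂ H3 where
  vadd z p := ⟨Complex.exp z * p.z, Real.exp z.re * p.t, mul_pos (Real.exp_pos _) p.t_pos⟩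
  zero_vadd p := by
    change H3.mk _ _ _ = _
    ext <;> simp
  add_vadd z w p := by
    change H3.mk _ _ _ = H3.mk (_ * (_ * _)) (_ * (_ * _)) _
    ext
    · simp only [Complex.exp_add]; ring
    · simp only [Complex.add_re, Real.exp_add]; ring

theorem vadd_def (z : ℂ) (p : H3) :
    z +ᵥ p = ⟨Complex.exp z * p.z, Real.exp z.re * p.t, mul_pos (Real.exp_pos _) p.t_pos⟩ := rfl

instance : IsIsometricVAdd ℂ H3 where
  isometry_vadd z := by
    refine Isometry.of_dist_eq fun p q => eq_of_cosh_eq dist_nonneg dist_nonneg ?_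
    have := Real.exp_pos z.re
    have := p.t_pos
    have := q.t_pos
    rw [cosh_dist, cosh_dist, vadd_def, vadd_def]
    simp only
    rw [← mul_sub, norm_mul, Complex.norm_exp]
    field_simp

theorem vadd_cyl (z : ℂ) (r ζ θ : ℝ) : z +ᵥ cyl r ζ θ = cyl r (z.re + ζ) (z.im + θ) := by
  rw [vadd_def]
  ext
  · simp only [cyl]
    conv_lhs => rw [← Complex.re_add_im z, Complex.exp_add]
    push_cast
    rw [Complex.exp_add, add_mul, Complex.exp_add]
    ring
  · simp only [cyl, Real.exp_add]
    ring

theorem exists_eq_cyl (p : H3) : ∃ r ζ, 0 ≤ r ∧ p = cyl r ζ p.z.arg := by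
  have ht := p.t_pos
  have hc := Real.cosh_pos (Real.arsinh (‖p.z‖ / p.t))
  -- In the definition of `cyl`, `‖z‖ / t = sinh r` and `t * cosh r = exp ζ`.
  refine ⟨Real.arsinh (‖p.z‖ / p.t), Real.log (p.t * cosh (Real.arsinh (‖p.z‖ / p.t))),
    Real.arsinh_nonneg_iff.2 (by positivity), ?_⟩
  ext
  · simp only [cyl]
    rw [Real.exp_log (by positivity), Real.tanh_eq_sinh_div_cosh, mul_assoc,
      mul_div_cancel₀ _ hc.ne', Real.sinh_arsinh, mul_div_cancel₀ _ ht.ne',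
      Complex.norm_mul_exp_arg_mul_I]
  · simp only [cyl]
    rw [Real.exp_log (by positivity), mul_div_cancel_right₀ _ hc.ne']

theorem cosh_eq_one_iff' {x : ℝ} : cosh x = 1 ↔ x = 0 := by
  refine ⟨fun h => ?_, fun h => by rw [h, Real.cosh_zero]⟩
  by_contra hx
  exact (Real.one_lt_cosh.2 hx).ne' h

theorem cyl_inj {r ζ θ r' ζ' θ' : ℝ} (hr : 0 ≤ r) (hr' : 0 ≤ r')
    (h : cyl r ζ θ = cyl r' ζ' θ') : r = r' ∧ ζ = ζ' ∧ (r = 0 ∨ Real.cos (θ - θ') = 1) := by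
  have h1 := cosh_dist_cyl' r ζ θ r' ζ' θ'
  rw [h, dist_self, Real.cosh_zero] at h1
  have e1 := Real.one_le_cosh (r - r')
  have e2 := Real.one_le_cosh (ζ - ζ')
  have e3 := Real.cos_le_one (θ - θ')
  have s1 := Real.sinh_nonneg_iff.2 hr
  have s2 := Real.sinh_nonneg_iff.2 hr'
  have c1 := Real.cosh_pos r
  have c2 := Real.cosh_pos r'
  have f1 : 0 ≤ cosh r * cosh r' * (cosh (ζ - ζ') - 1) :=
    mul_nonneg (by positivity) (by linarith)
  have f2 : 0 ≤ sinh r * sinh r' * (1 - Real.cos (θ - θ')) :=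
    mul_nonneg (by positivity) (by linarith)
  have g1 : r = r' := by
    have : cosh (r - r') = 1 := by linarith
    rw [cosh_eq_one_iff'] at this
    linarith
  have g2 : ζ = ζ' := by
    have : cosh r * cosh r' * (cosh (ζ - ζ') - 1) = 0 := by linarith
    have : cosh (ζ - ζ') - 1 = 0 := by
      rcases mul_eq_zero.1 this with h | h
      · exact absurd h (by positivity)
      · exact h
    have : cosh (ζ - ζ') = 1 := by linarith
    rw [cosh_eq_one_iff'] at this
    linarith
  refine ⟨g1, g2, ?_⟩
  subst g1
  have : sinh r * sinh r * (1 - Real.cos (θ - θ')) = 0 := by linarith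
  rcases mul_eq_zero.1 this with h | h
  · left
    exact Real.sinh_eq_zero.1 (mul_self_eq_zero.1 h)
  · right
    linarith

theorem cyl_add_two_pi (r ζ θ : ℝ) (k : ℤ) : cyl r ζ (θ + k * (2 * Real.pi)) = cyl r ζ θ := by
  rw [← dist_eq_zero]
  refine eq_of_cosh_eq dist_nonneg le_rfl ?_
  rw [cosh_dist_cyl', add_sub_cancel_left, Real.cos_int_mul_two_pi]
  simp

theorem continuous_cyl : Continuous fun x : ℝ × ℝ × ℝ => cyl x.1 x.2.1 x.2.2 := by
  rw [continuous_iff_continuousAt]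
  intro x
  rw [ContinuousAt, tendsto_iff_dist_tendsto_zero]
  have h0 (y : ℝ × ℝ × ℝ) : cosh (dist (cyl y.1 y.2.1 y.2.2) (cyl x.1 x.2.1 x.2.2)) =
      cosh y.1 * cosh x.1 * cosh (y.2.1 - x.2.1) -
        sinh y.1 * sinh x.1 * Real.cos (y.2.2 - x.2.2) := cosh_dist_cyl ..
  have h (y : ℝ × ℝ × ℝ) : dist (cyl y.1 y.2.1 y.2.2) (cyl x.1 x.2.1 x.2.2) =
      Real.arcosh (cosh y.1 * cosh x.1 * cosh (y.2.1 - x.2.1) -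
        sinh y.1 * sinh x.1 * Real.cos (y.2.2 - x.2.2)) := by
    rw [← cosh_dist_cyl, Real.arcosh_cosh dist_nonneg]
  simp only [h]
  rw [← Real.arcosh_zero]
  refine (Real.continuousOn_arcosh 1 self_mem_Ici).tendsto.comp (tendsto_nhdsWithin_iff.2 ⟨?_, ?_⟩)
  · have hc : Continuous fun y : ℝ × ℝ × ℝ => cosh y.1 * cosh x.1 * cosh (y.2.1 - x.2.1) -
        sinh y.1 * sinh x.1 * Real.cos (y.2.2 - x.2.2) := by fun_prop
    refine (hc.tendsto x).trans_eq ?_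
    rw [← h0, dist_self, Real.cosh_zero]
  · refine Filter.Eventually.of_forall fun y => ?_
    rw [mem_Ici, ← h0]
    exact Real.one_le_cosh _

end H3

/-! ### Paths, distances and geodesics in the universal cover. -/

theorem edist_dev_add_le_pathLength {p q : CylCoords} (γ : Path p q) (m : I) :
    edist (dev p) (dev (γ m)) + edist (dev (γ m)) (dev q) ≤ pathLength γ := by
  unfold pathLength
  rw [show (univ : Set I) = Iic m ∪ Ici m from Iic_union_Ici.symm,
    eVariationOn.union _ (x := m) ⟨self_mem_Iic, fun _ h => h⟩ ⟨self_mem_Ici, fun _ h => h⟩]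
  refine add_le_add ?_ ?_
  · have := eVariationOn.edist_le (fun s => dev (γ s)) (s := Iic m) (x := 0) (y := m)
      unitInterval.nonneg' self_mem_Iic
    simpa using this
  · have := eVariationOn.edist_le (fun s => dev (γ s)) (s := Ici m) (x := m) (y := 1)
      self_mem_Ici unitInterval.le_one'
    simpa using this

/-- A path in the universal cover crosses every intermediate angle. -/
theorem le_dist_of_forall_angle {u v : Cover} {β K : ℝ}
    (hβ : β ∈ uIcc u.coords.1.2.2 v.coords.1.2.2)
    (h : ∀ w : CylCoords, w.1.2.2 = β →
      K ≤ dist (dev u.coords) (dev w) + dist (dev w) (dev v.coords)) : K ≤ dist u v := by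
  rw [Cover.dist_def, ← ENNReal.ofReal_le_iff_le_toReal (lengthEDist_ne_top _ _)]
  refine le_iInf fun γ => ?_
  have hc : Continuous fun s => (γ s).1.2.2 := by fun_prop
  obtain ⟨m, hm⟩ : β ∈ range fun s => (γ s).1.2.2 := by
    rcases mem_uIcc.1 hβ with hβ | hβ
    · exact mem_range_of_exists_le_of_exists_ge hc ⟨0, by simpa using hβ.1⟩ ⟨1, by simpa using hβ.2⟩
    · exact mem_range_of_exists_le_of_exists_ge hc ⟨1, by simpa using hβ.1⟩ ⟨0, by simpa using hβ.2⟩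
  refine le_trans ?_ (edist_dev_add_le_pathLength γ m)
  rw [edist_dist, edist_dist, ← ENNReal.ofReal_add dist_nonneg dist_nonneg]
  exact ENNReal.ofReal_le_ofReal (h _ hm)

theorem dist_dev_le (u v : Cover) : dist (dev u.coords) (dev v.coords) ≤ dist u v :=
  le_dist_of_forall_angle left_mem_uIcc fun _ _ => dist_triangle _ _ _

theorem coords_eq_of_dev_eq {u v : CylCoords} (h : dev u = dev v)
    (hθ : |u.1.2.2 - v.1.2.2| < 2 * Real.pi) : u = v := by
  obtain ⟨h1, h2, h3⟩ := H3.cyl_inj u.2.le v.2.le h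
  rcases h3 with h3 | h3
  · exact absurd h3 u.2.ne'
  · rw [abs_lt] at hθ
    rw [Real.cos_eq_one_iff_of_lt_of_lt (by linarith) (by linarith)] at h3
    exact Subtype.ext (Prod.ext h1 (Prod.ext h2 (by linarith)))

/-- Seen from above with the initial angle rotated to `0`, a geodesic with angle gap `Δ` passes
through points of this form. Staying in the slit plane means that it misses `σ` and that
`Complex.arg` is a continuous choice of angle along it. -/
theorem convex_combination_mem_slitPlane {x y Δ : ℝ} (_hx : 0 ≤ x) (_hy : 0 ≤ y) (hxy : 0 < x + y)
    (hΔ : |Δ| < Real.pi) :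
    (x : ℂ) + (y : ℝ) * Complex.exp (Δ * Complex.I) ∈ Complex.slitPlane := by
  rw [Complex.mem_slitPlane_iff, Complex.add_re, Complex.add_im, Complex.re_ofReal_mul,
    Complex.im_ofReal_mul, Complex.exp_ofReal_mul_I_re, Complex.exp_ofReal_mul_I_im,
    Complex.ofReal_re, Complex.ofReal_im, zero_add]
  by_contra! h
  obtain ⟨h1, h2⟩ := h
  rcases mul_eq_zero.1 h2 with h3 | h3
  · rw [h3] at h1 hxy
    linarith
  · rw [abs_lt] at hΔ
    rw [Real.sin_eq_zero_iff_of_lt_of_lt hΔ.1 hΔ.2] at h3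
    rw [h3, Real.cos_zero] at h1
    linarith

/-- Both arguments lie on the same side of `0` as `Δ` and have absolute value below `π`. This keeps
any two points of a lifted geodesic in the range of angles where the cover has the hyperbolic
distance. -/
theorem abs_arg_sub_arg_lt_pi {x y x' y' Δ : ℝ} (hx : 0 ≤ x) (hy : 0 ≤ y) (hxy : 0 < x + y)
    (hx' : 0 ≤ x') (hy' : 0 ≤ y') (hxy' : 0 < x' + y') (hΔ : |Δ| < Real.pi) :
    |Complex.arg ((x : ℂ) + (y : ℝ) * Complex.exp (Δ * Complex.I)) -
      Complex.arg ((x' : ℂ) + (y' : ℝ) * Complex.exp (Δ * Complex.I))| < Real.pi := by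
  have h1 := convex_combination_mem_slitPlane hx hy hxy hΔ
  have h2 := convex_combination_mem_slitPlane hx' hy' hxy' hΔ
  have hp1 := Complex.arg_le_pi ((x : ℂ) + (y : ℝ) * Complex.exp (Δ * Complex.I))
  have hp2 := Complex.arg_le_pi ((x' : ℂ) + (y' : ℝ) * Complex.exp (Δ * Complex.I))
  have hn1 := Complex.neg_pi_lt_arg ((x : ℂ) + (y : ℝ) * Complex.exp (Δ * Complex.I))
  have hn2 := Complex.neg_pi_lt_arg ((x' : ℂ) + (y' : ℝ) * Complex.exp (Δ * Complex.I))
  have hlt1 := lt_of_le_of_ne hp1 (Complex.mem_slitPlane_iff_arg.1 h1).1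
  have hlt2 := lt_of_le_of_ne hp2 (Complex.mem_slitPlane_iff_arg.1 h2).1
  have him (x y : ℝ) : ((x : ℂ) + (y : ℝ) * Complex.exp (Δ * Complex.I)).im = y * Real.sin Δ := by
    rw [Complex.add_im, Complex.im_ofReal_mul, Complex.exp_ofReal_mul_I_im, Complex.ofReal_im,
      zero_add]
  rw [abs_lt] at hΔ ⊢
  rcases le_or_gt 0 Δ with h0 | h0
  · have hs := Real.sin_nonneg_of_nonneg_of_le_pi h0 hΔ.2.le
    have a1 : 0 ≤ Complex.arg ((x : ℂ) + (y : ℝ) * Complex.exp (Δ * Complex.I)) :=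
      Complex.arg_nonneg_iff.2 (by rw [him]; positivity)
    have a2 : 0 ≤ Complex.arg ((x' : ℂ) + (y' : ℝ) * Complex.exp (Δ * Complex.I)) :=
      Complex.arg_nonneg_iff.2 (by rw [him]; positivity)
    constructor <;> linarith
  · have hs := Real.sin_neg_of_neg_of_neg_pi_lt h0 hΔ.1
    have a (x y : ℝ) (hy : 0 ≤ y)
        (h : (x : ℂ) + (y : ℝ) * Complex.exp (Δ * Complex.I) ∈ Complex.slitPlane) :
        Complex.arg ((x : ℂ) + (y : ℝ) * Complex.exp (Δ * Complex.I)) ≤ 0 := by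
      rcases hy.eq_or_lt with rfl | hy
      · rw [Complex.ofReal_zero, zero_mul, add_zero] at h ⊢
        rw [Complex.ofReal_mem_slitPlane] at h
        rw [Complex.arg_ofReal_of_nonneg h.le]
      · refine (Complex.arg_neg_iff.2 ?_).le
        rw [him]
        exact mul_neg_of_pos_of_neg hy hs
    have a1 := a x y hy h1
    have a2 := a x' y' hy' h2
    constructor <;> linarith

/-- The geodesic of `H3` between the images of two points of the cover whose angles differ by less
than `π` lifts to the cover. -/
theorem exists_lift_isSegment (u v : CylCoords) (hθ : |u.1.2.2 - v.1.2.2| < Real.pi)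
    {D : ℝ} (hD : dist (dev u) (dev v) = D) (hD0 : 0 < D) :
    ∃ c : ℝ → CylCoords, Continuous c ∧ H3.IsSegment (dev u) (dev v) D (fun s => dev (c s)) ∧
      c 0 = u ∧ c D = v ∧ ∀ s t, |(c s).1.2.2 - (c t).1.2.2| < Real.pi := by
  have hS := Real.sinh_pos_iff.2 hD0
  have hru := Real.sinh_pos_iff.2 u.2
  have hrv := Real.sinh_pos_iff.2 v.2
  have hut := (dev u).t_pos
  have hvt := (dev v).t_pos
  set Δ := v.1.2.2 - u.1.2.2 with hΔ
  have hΔπ : |Δ| < Real.pi := by rwa [hΔ, abs_sub_comm]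
  -- `sinh r * exp (iθ) = z / t` is also linear on the hyperboloid. Its value along the geodesic,
  -- rotated back by the angle of `u`, is `ω = x + y * exp (iΔ)`, so the lift has radius `arsinh
  -- ‖ω‖` and angle that of `u` plus `arg ω`. The height comes from `exp ζ = t * cosh r`, where `t =
  -- sinh D / q`.
  set x : Icc 0 D → ℝ := fun s => sinh (D - s) * sinh u.1.1 / sinh D with hx
  set y : Icc 0 D → ℝ := fun s => sinh s * sinh v.1.1 / sinh D with hy
  set q : Icc 0 D → ℝ := fun s => sinh (D - s) / (dev u).t + sinh s / (dev v).t with hq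
  have hA (s : Icc 0 D) : 0 ≤ sinh (D - s) := Real.sinh_nonneg_iff.2 (by linarith [s.2.2])
  have hB (s : Icc 0 D) : 0 ≤ sinh (s : ℝ) := Real.sinh_nonneg_iff.2 s.2.1
  have hx0 s : 0 ≤ x s := by have := hA s; simp only [hx]; positivity
  have hy0 s : 0 ≤ y s := by have := hB s; simp only [hy]; positivity
  have hq0 s : 0 < q s := H3.interp_pos _ _ hD0 s.2.1 s.2.2
  have hxy s : 0 < x s + y s := by
    rcases s.2.1.eq_or_lt with h | h
    · have : 0 < x s := by
        simp only [hx, ← h, sub_zero]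
        positivity
      linarith [hy0 s]
    · have : 0 < y s := by
        have := Real.sinh_pos_iff.2 h
        simp only [hy]
        positivity
      linarith [hx0 s]
  set ω : Icc 0 D → ℂ := fun s => (x s : ℂ) + (y s : ℝ) * Complex.exp (Δ * Complex.I) with hω
  have hωs s : ω s ∈ Complex.slitPlane :=
    convex_combination_mem_slitPlane (hx0 s) (hy0 s) (hxy s) hΔπ
  have hω0 s : 0 < ‖ω s‖ := norm_pos_iff.2 (Complex.slitPlane_ne_zero (hωs s))
  have hxc : Continuous x := by fun_prop
  have hyc : Continuous y := by fun_prop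
  have hqc : Continuous q := by fun_prop
  have hωc : Continuous ω := by fun_prop
  have hrc : Continuous fun s => Real.arsinh ‖ω s‖ := Real.continuous_arsinh.comp hωc.norm
  set c : Icc 0 D → CylCoords := fun s => ⟨(Real.arsinh ‖ω s‖,
    Real.log (sinh D * cosh (Real.arsinh ‖ω s‖) / q s), u.1.2.2 + Complex.arg (ω s)),
    Real.arsinh_pos_iff.2 (hω0 s)⟩ with hc
  have hcosh s := Real.cosh_pos (Real.arsinh ‖ω s‖)
  have hcc : Continuous c := by
    refine Continuous.subtype_mk (hrc.prodMk (Continuous.prodMk ?_ ?_)) _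
    · refine Continuous.log ?_ fun s => ?_
      · exact (continuous_const.mul (Real.continuous_cosh.comp hrc)).div hqc fun s => (hq0 s).ne'
      · have := hcosh s
        have := hq0 s
        positivity
    · refine continuous_const.add ?_
      rw [continuous_iff_continuousAt]
      exact fun s => (Complex.continuousAt_arg (hωs s)).comp hωc.continuousAt
  have hexp s : Real.exp (c s).1.2.1 = sinh D * cosh (Real.arsinh ‖ω s‖) / q s := by
    have := hcosh s
    have := hq0 s
    exact Real.exp_log (by positivity)
  have hz (w : CylCoords) :
      (dev w).z = (dev w).t * ((sinh w.1.1 : ℝ) * Complex.exp (w.1.2.2 * Complex.I)) := by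
    have : (cosh w.1.1 : ℂ) ≠ 0 := by exact_mod_cast (Real.cosh_pos w.1.1).ne'
    simp only [dev, H3.cyl, Real.tanh_eq_sinh_div_cosh]
    push_cast
    field_simp
  have ht s : (dev (c s)).t = sinh D / q s := by
    have := (hcosh s).ne'
    change Real.exp (c s).1.2.1 / cosh (Real.arsinh ‖ω s‖) = _
    rw [hexp]
    field_simp
  have hseg (s : Icc 0 D) (m) : sinh D * cosh (dist (dev (c s)) m) =
        sinh (D - s) * cosh (dist (dev u) m) + sinh s * cosh (dist (dev v) m) := by
    refine H3.cosh_dist_interp hD hD0 s.2.1 s.2.2 (ht s) ?_ m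
    have e1 : ((sinh (c s).1.1 : ℝ) : ℂ) * Complex.exp ((c s).1.2.2 * Complex.I) =
        ω s * Complex.exp (u.1.2.2 * Complex.I) := by
      change ((sinh (Real.arsinh ‖ω s‖) : ℝ) : ℂ) *
        Complex.exp (((u.1.2.2 + Complex.arg (ω s) : ℝ) : ℂ) * Complex.I) = _
      rw [Real.sinh_arsinh, Complex.ofReal_add, add_mul, Complex.exp_add]
      conv_rhs => rw [← Complex.norm_mul_exp_arg_mul_I (ω s)]
      ring
    have e2 : Complex.exp (v.1.2.2 * Complex.I) =
        Complex.exp (Δ * Complex.I) * Complex.exp (u.1.2.2 * Complex.I) := by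
      rw [← Complex.exp_add, hΔ]
      push_cast
      ring_nf
    have hS' : Complex.sinh D ≠ 0 := by
      rw [← Complex.ofReal_sinh]
      exact_mod_cast hS.ne'
    have hut' : ((dev u).t : ℂ) ≠ 0 := by exact_mod_cast hut.ne'
    have hvt' : ((dev v).t : ℂ) ≠ 0 := by exact_mod_cast hvt.ne'
    have hq' : (q s : ℂ) ≠ 0 := by exact_mod_cast (hq0 s).ne'
    rw [hz (c s), hz u, hz v, e1, e2, ht s]
    change _ = _ / ((q s : ℝ) : ℂ)
    simp only [hω, hx, hy]
    push_cast
    field_simp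
  have hseg' : H3.IsSegment (dev u) (dev v) D fun s => dev (c (projIcc 0 D hD0.le s)) := by
    intro s hs m
    beta_reduce
    rw [projIcc_of_mem hD0.le hs]
    exact hseg ⟨s, hs⟩ m
  have hpi s : |Complex.arg (ω s)| ≤ Real.pi := Complex.abs_arg_le_pi _
  refine ⟨fun s => c (projIcc 0 D hD0.le s), hcc.comp (continuous_projIcc (h := hD0.le)), hseg', ?_, ?_, ?_⟩
  · beta_reduce
    rw [projIcc_left]
    refine coords_eq_of_dev_eq ?_ ?_
    · have := hseg'.apply_zero hD hD0
      rwa [projIcc_left] at this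
    · change |u.1.2.2 + Complex.arg (ω ⟨0, le_rfl, hD0.le⟩) - u.1.2.2| < _
      rw [add_sub_cancel_left]
      linarith [hpi ⟨0, le_rfl, hD0.le⟩, Real.pi_pos]
  · beta_reduce
    rw [projIcc_right]
    refine coords_eq_of_dev_eq ?_ ?_
    · have := hseg'.apply_right hD hD0
      rwa [projIcc_right] at this
    · change |u.1.2.2 + Complex.arg (ω ⟨D, hD0.le, le_rfl⟩) - v.1.2.2| < _
      have e : u.1.2.2 + Complex.arg (ω ⟨D, hD0.le, le_rfl⟩) - v.1.2.2 =
        Complex.arg (ω ⟨D, hD0.le, le_rfl⟩) - Δ := by rw [hΔ]; ring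
      rw [e]
      linarith [abs_sub (Complex.arg (ω ⟨D, hD0.le, le_rfl⟩)) Δ, hpi ⟨D, hD0.le, le_rfl⟩]
  · intro s t
    beta_reduce
    generalize projIcc 0 D hD0.le s = s
    generalize projIcc 0 D hD0.le t = t
    change |u.1.2.2 + Complex.arg (ω s) - (u.1.2.2 + Complex.arg (ω t))| < _
    rw [add_sub_add_left_eq_sub]
    exact abs_arg_sub_arg_lt_pi (hx0 s) (hy0 s) (hxy s) (hx0 t) (hy0 t) (hxy t) hΔπ

/-- The projection never increases distances; conversely the hyperbolic geodesic lifts to a path of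
the same length. -/
theorem dist_eq_dist_dev {u v : Cover} (hθ : |u.coords.1.2.2 - v.coords.1.2.2| < Real.pi) :
    dist u v = dist (dev u.coords) (dev v.coords) := by
  refine le_antisymm ?_ (dist_dev_le u v)
  rcases (dist_nonneg (x := dev u.coords) (y := dev v.coords)).eq_or_lt with h0 | h0
  · have : u = v := Cover.ext (coords_eq_of_dev_eq (dist_eq_zero.1 h0.symm)
      (by linarith [Real.pi_pos]))
    rw [this, dist_self, dist_self]
  obtain ⟨D, hD⟩ : ∃ D, D = dist (dev u.coords) (dev v.coords) := ⟨_, rfl⟩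
  rw [← hD] at h0
  obtain ⟨c, hc, hseg, hc0, hcD, -⟩ := exists_lift_isSegment u.coords v.coords hθ hD.symm h0
  rw [Cover.dist_def, ← hD]
  refine ENNReal.toReal_le_of_le_ofReal h0.le ?_
  have hm (t : I) : (t : ℝ) * D ∈ Icc 0 D :=
    ⟨mul_nonneg t.2.1 h0.le, mul_le_of_le_one_left h0.le t.2.2⟩
  let γ : Path u.coords v.coords :=
    { toFun := fun t => c (t * D)
      continuous_toFun := by fun_prop
      source' := by simp [hc0]
      target' := by simp [hcD] }
  refine (iInf_le _ γ).trans ?_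
  have h1 : pathLength γ ≤ eVariationOn (fun s => dev (c s)) (Icc 0 D) := by
    refine eVariationOn.comp_le_of_monotoneOn (fun s => dev (c s)) (fun t : I => (t : ℝ) * D) ?_
      fun t _ => hm t
    intro a _ b _ hab
    exact mul_le_mul_of_nonneg_right hab h0.le
  refine h1.trans ?_
  have hl : LipschitzOnWith 1 (fun s => dev (c s)) (Icc 0 D) :=
    LipschitzOnWith.of_dist_le_mul fun s hs t ht => by
      rw [hseg.dist_eq hD.symm h0 hs ht, NNReal.coe_one, one_mul, Real.dist_eq]
  have h2 := hl.comp_eVariationOn_le (g := (id : ℝ → ℝ)) (mapsTo_id _)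
  have h3 := (monotone_id.monotoneOn (Icc 0 D)).eVariationOn_eq (a := (0 : ℝ)) (b := D)
    (left_mem_Icc.2 h0.le) (right_mem_Icc.2 h0.le)
  rw [inter_self] at h3
  rw [ENNReal.coe_one, one_mul, Function.comp_id, h3] at h2
  simpa using h2

/-- Geodesics in the universal cover. -/
theorem exists_cover_geodesic {u v : Cover} (hθ : |u.coords.1.2.2 - v.coords.1.2.2| < Real.pi) :
    ∃ c : ℝ → Cover, c 0 = u ∧ c (dist u v) = v ∧
      ∀ s ∈ Icc 0 (dist u v), ∀ t ∈ Icc 0 (dist u v), dist (c s) (c t) = |s - t| := by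
  have hD := dist_eq_dist_dev hθ
  generalize dist u v = D at *
  rcases (hD ▸ dist_nonneg : 0 ≤ D).eq_or_lt with rfl | h0
  · have : u = v := Cover.ext (coords_eq_of_dev_eq (dist_eq_zero.1 hD.symm)
      (by linarith [Real.pi_pos]))
    subst this
    refine ⟨fun _ => u, rfl, rfl, ?_⟩
    intro s hs t ht
    rw [le_antisymm hs.2 hs.1, le_antisymm ht.2 ht.1]
    simp
  obtain ⟨c, hc, hseg, hc0, hcD, hcθ⟩ := exists_lift_isSegment u.coords v.coords hθ hD.symm h0
  refine ⟨fun s => ⟨c s⟩, Cover.ext hc0, Cover.ext hcD, fun s hs t ht => ?_⟩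
  exact (dist_eq_dist_dev (u := ⟨c s⟩) (v := ⟨c t⟩) (hcθ s t)).trans
    (hseg.dist_eq hD.symm h0 hs ht)

/-- Scaling the distance to the geodesic `σ`. -/
def scale (k : ℝ) (hk : 0 < k) (p : CylCoords) : CylCoords :=
  ⟨(k * p.1.1, p.1.2.1, p.1.2.2), mul_pos hk p.2⟩

/-- Each of the three terms of `cosh_dist_cyl'` shrinks when both radii are multiplied by `k ≤ 1`.
This is the source of the monotonicity of displacements in `r`. -/
theorem dist_dev_scale_le {k : ℝ} (hk : 0 < k) (hk1 : k ≤ 1) (p q : CylCoords) :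
    dist (dev (scale k hk p)) (dev (scale k hk q)) ≤ dist (dev p) (dev q) := by
  refine H3.le_of_cosh_le dist_nonneg ?_
  change cosh (dist (H3.cyl _ _ _) (H3.cyl _ _ _)) ≤ cosh (dist (H3.cyl _ _ _) (H3.cyl _ _ _))
  rw [H3.cosh_dist_cyl', H3.cosh_dist_cyl']
  have hp : k * p.1.1 ≤ p.1.1 := mul_le_of_le_one_left p.2.le hk1
  have hq : k * q.1.1 ≤ q.1.1 := mul_le_of_le_one_left q.2.le hk1
  have hp0 : 0 < k * p.1.1 := mul_pos hk p.2
  have hq0 : 0 < k * q.1.1 := mul_pos hk q.2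
  have h1 : 0 ≤ cosh (p.1.2.1 - q.1.2.1) - 1 := sub_nonneg.2 (Real.one_le_cosh _)
  have h2 : 0 ≤ 1 - Real.cos (p.1.2.2 - q.1.2.2) := sub_nonneg.2 (Real.cos_le_one _)
  have h3 := Real.sinh_pos_iff.2 hp0
  have h4 := Real.sinh_pos_iff.2 hq0
  have h5 := Real.cosh_pos (k * p.1.1)
  have h6 := Real.cosh_pos (k * q.1.1)
  have g1 := H3.cosh_le_of_le hp0.le hp
  have g2 := H3.cosh_le_of_le hq0.le hq
  have g3 := Real.sinh_le_sinh.2 hp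
  have g4 := Real.sinh_le_sinh.2 hq
  have g5 : cosh (k * p.1.1 - k * q.1.1) ≤ cosh (p.1.1 - q.1.1) := by
    rw [Real.cosh_le_cosh, ← mul_sub, abs_mul, abs_of_pos hk]
    exact mul_le_of_le_one_left (abs_nonneg _) hk1
  simp only [scale]
  have h7 := h3.le.trans g3
  gcongr

theorem dist_scale_le {k : ℝ} (hk : 0 < k) (hk1 : k ≤ 1) (u v : Cover) :
    dist (⟨scale k hk u.coords⟩ : Cover) ⟨scale k hk v.coords⟩ ≤ dist u v := by
  refine ENNReal.toReal_mono (lengthEDist_ne_top _ _) (le_iInf fun γ => ?_)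
  have hc : Continuous (scale k hk) := by unfold scale; fun_prop
  refine (iInf_le _ (γ.map hc)).trans (iSup_mono fun u => Finset.sum_le_sum fun i _ => ?_)
  simp only [Path.map_coe, Function.comp, edist_dist]
  exact ENNReal.ofReal_le_ofReal (dist_dev_scale_le hk hk1 _ _)

/-! ### Lower bounds for the distance by radius, height and angle. -/

open Filter Topology

namespace H3

theorem abs_sub_radius_le {r ζ θ r' ζ' θ' : ℝ} (hr : 0 ≤ r) (hr' : 0 ≤ r') :
    |r - r'| ≤ dist (cyl r ζ θ) (cyl r' ζ' θ') := by
  refine le_of_cosh_le dist_nonneg ?_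
  rw [cosh_dist_cyl', Real.cosh_abs]
  have h1 : 0 ≤ cosh (ζ - ζ') - 1 := sub_nonneg.2 (Real.one_le_cosh _)
  have h2 : 0 ≤ 1 - Real.cos (θ - θ') := sub_nonneg.2 (Real.cos_le_one _)
  have s1 := Real.sinh_nonneg_iff.2 hr
  have s2 := Real.sinh_nonneg_iff.2 hr'
  have c1 := Real.cosh_pos r
  have c2 := Real.cosh_pos r'
  have : 0 ≤ cosh r * cosh r' * (cosh (ζ - ζ') - 1) := by positivity
  have : 0 ≤ sinh r * sinh r' * (1 - Real.cos (θ - θ')) := by positivity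
  linarith

theorem abs_sub_height_le {r ζ θ r' ζ' θ' : ℝ} (hr : 0 ≤ r) (hr' : 0 ≤ r') :
    |ζ - ζ'| ≤ dist (cyl r ζ θ) (cyl r' ζ' θ') := by
  refine le_of_cosh_le dist_nonneg ?_
  rw [cosh_dist_cyl', Real.cosh_abs]
  have h1 : 0 ≤ cosh (ζ - ζ') - 1 := sub_nonneg.2 (Real.one_le_cosh _)
  have h2 : 0 ≤ 1 - Real.cos (θ - θ') := sub_nonneg.2 (Real.cos_le_one _)
  have s1 := Real.sinh_nonneg_iff.2 hr
  have s2 := Real.sinh_nonneg_iff.2 hr'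
  have c0 := Real.one_le_cosh (r - r')
  have c1 := Real.one_le_cosh r
  have c2 := Real.one_le_cosh r'
  have c3 : 1 ≤ cosh r * cosh r' := one_le_mul_of_one_le_of_one_le c1 c2
  have : 0 ≤ sinh r * sinh r' * (1 - Real.cos (θ - θ')) := by positivity
  nlinarith

theorem dist_cyl_radial (r ζ θ r' : ℝ) : dist (cyl r ζ θ) (cyl r' ζ θ) = |r - r'| := by
  refine eq_of_cosh_eq dist_nonneg (abs_nonneg _) ?_
  rw [cosh_dist_cyl', Real.cosh_abs, sub_self, sub_self, Real.cosh_zero, Real.cos_zero]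
  ring

/-- Follows from `sinh ≤ cosh`. The bound must not involve `r'`, because a path of the cover may
cross the half-plane of an intermediate angle at any radius. -/
theorem cosh_mul_one_sub_cos_le {r ζ θ r' ζ' θ' : ℝ} (hr : 0 ≤ r) (hr' : 0 ≤ r')
    (hcos : 0 ≤ Real.cos (θ - θ')) :
    cosh r * (1 - Real.cos (θ - θ')) ≤ cosh (dist (cyl r ζ θ) (cyl r' ζ' θ')) := by
  rw [cosh_dist_cyl]
  have h1 := Real.one_le_cosh (ζ - ζ')
  have h2 := Real.cos_le_one (θ - θ')
  have s1 := Real.sinh_nonneg_iff.2 hr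
  have s2 := Real.sinh_nonneg_iff.2 hr'
  have c1 := Real.cosh_pos r
  have c2 := Real.one_le_cosh r'
  have l1 : cosh r * cosh r' ≤ cosh r * cosh r' * cosh (ζ - ζ') :=
    le_mul_of_one_le_right (by positivity) h1
  have l2 : sinh r * sinh r' * Real.cos (θ - θ') ≤ cosh r * cosh r' * Real.cos (θ - θ') := by
    have := (Real.sinh_lt_cosh r).le
    have := (Real.sinh_lt_cosh r').le
    gcongr
  have l3 : cosh r * (1 - Real.cos (θ - θ')) ≤ cosh r * cosh r' * (1 - Real.cos (θ - θ')) := by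
    have : 0 ≤ 1 - Real.cos (θ - θ') := by linarith
    nlinarith [mul_nonneg c1.le this]
  linarith

end H3

theorem lipschitzWith_radius : LipschitzWith 1 fun u : Cover => u.coords.1.1 :=
  LipschitzWith.of_dist_le_mul fun u v => by
    rw [NNReal.coe_one, one_mul, Real.dist_eq]
    exact (H3.abs_sub_radius_le u.coords.2.le v.coords.2.le).trans (dist_dev_le u v)

theorem lipschitzWith_height : LipschitzWith 1 fun u : Cover => u.coords.1.2.1 :=
  LipschitzWith.of_dist_le_mul fun u v => by
    rw [NNReal.coe_one, one_mul, Real.dist_eq]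
    exact (H3.abs_sub_height_le u.coords.2.le v.coords.2.le).trans (dist_dev_le u v)

/-- Points whose angles differ by at least `β ≤ π / 2` are far apart far from `σ`. -/
theorem cosh_radius_mul_le_cosh_dist {u v : Cover} {β : ℝ} (hβ0 : 0 ≤ β) (hβ : β ≤ Real.pi / 2)
    (hθ : β ≤ |u.coords.1.2.2 - v.coords.1.2.2|) :
    cosh u.coords.1.1 * (1 - Real.cos β) ≤ cosh (dist u v) := by
  have hcos := Real.cos_nonneg_of_neg_pi_div_two_le_of_le (by linarith [Real.pi_pos]) hβ
  have key (β' : ℝ) (hβ' : β' ∈ uIcc u.coords.1.2.2 v.coords.1.2.2)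
      (h : Real.cos (u.coords.1.2.2 - β') = Real.cos β) :
      cosh u.coords.1.1 * (1 - Real.cos β) ≤ cosh (dist u v) := by
    -- The negated goal also says that `cosh u.coords.1.1 * (1 - cos β)` exceeds `1`, so that
    -- `arcosh` inverts `cosh` there.
    by_contra! hlt
    refine absurd (le_dist_of_forall_angle (u := u) (v := v)
      (K := Real.arcosh (cosh u.coords.1.1 * (1 - Real.cos β))) hβ' ?_) ?_
    · intro w hw
      have h1 := H3.cosh_mul_one_sub_cos_le (r := u.coords.1.1) (ζ := u.coords.1.2.1)
        (θ := u.coords.1.2.2) (r' := w.1.1) (ζ' := w.1.2.1) (θ' := w.1.2.2) u.coords.2.le w.2.le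
        (by rw [hw, h]; exact hcos)
      rw [hw, h, ← hw] at h1
      have h2 : Real.arcosh (cosh u.coords.1.1 * (1 - Real.cos β)) ≤
          dist (dev u.coords) (dev w) := by
        refine H3.le_of_cosh_le dist_nonneg ?_
        rw [Real.cosh_arcosh ((Real.one_le_cosh _).trans hlt.le)]
        exact h1
      exact h2.trans (le_add_of_nonneg_right dist_nonneg)
    · rw [not_le]
      refine (abs_of_nonneg dist_nonneg : |dist u v| = _) ▸ ?_
      have h3 := hlt
      rw [← Real.cosh_arcosh ((Real.one_le_cosh _).trans hlt.le), Real.cosh_lt_cosh] at h3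
      rwa [abs_of_nonneg (Real.arcosh_nonneg ((Real.one_le_cosh _).trans hlt.le))] at h3
  rcases le_abs.1 hθ with h | h
  · refine key (u.coords.1.2.2 - β) (mem_uIcc.2 (Or.inr ⟨by linarith, by linarith⟩)) ?_
    rw [sub_sub_cancel]
  · refine key (u.coords.1.2.2 + β) (mem_uIcc.2 (Or.inl ⟨by linarith, by linarith⟩)) ?_
    rw [sub_add_cancel_left, Real.cos_neg]

theorem abs_angle_sub_lt_of_dist_lt {u v : Cover} (h : dist u v < u.coords.1.1) :
    |u.coords.1.2.2 - v.coords.1.2.2| < Real.pi / 2 := by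
  by_contra! h'
  have := cosh_radius_mul_le_cosh_dist (by positivity) le_rfl h'
  rw [Real.cos_pi_div_two, sub_zero, mul_one] at this
  linarith [H3.le_of_cosh_le dist_nonneg this]

/-- Points whose angles differ by at least `π` are as far apart as the path through `σ` is long. -/
theorem radius_add_radius_le_dist {u v : Cover}
    (hθ : Real.pi ≤ |u.coords.1.2.2 - v.coords.1.2.2|) :
    u.coords.1.1 + v.coords.1.1 ≤ dist u v := by
  have key (β' : ℝ) (hβ' : β' ∈ uIcc u.coords.1.2.2 v.coords.1.2.2)
      (h : Real.cos (u.coords.1.2.2 - β') = -1) : u.coords.1.1 + v.coords.1.1 ≤ dist u v := by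
    refine le_dist_of_forall_angle hβ' fun w hw => ?_
    have h1 : u.coords.1.1 + w.1.1 ≤ dist (dev u.coords) (dev w) := by
      refine H3.le_of_cosh_le dist_nonneg ?_
      change _ ≤ cosh (dist (H3.cyl _ _ _) (H3.cyl _ _ _))
      rw [H3.cosh_dist_cyl, hw, h, Real.cosh_add]
      have c1 := Real.cosh_pos u.coords.1.1
      have c2 := Real.cosh_pos w.1.1
      have := Real.one_le_cosh (u.coords.1.2.1 - w.1.2.1)
      have := le_mul_of_one_le_right (mul_pos c1 c2).le this
      linarith
    have h2 := H3.abs_sub_radius_le (ζ := w.1.2.1) (θ := w.1.2.2) (ζ' := v.coords.1.2.1)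
      (θ' := v.coords.1.2.2) w.2.le v.coords.2.le
    have h3 : |w.1.1 - v.coords.1.1| ≤ dist (dev w) (dev v.coords) := h2
    linarith [neg_le_abs (w.1.1 - v.coords.1.1)]
  rcases le_abs.1 hθ with h | h
  · refine key (u.coords.1.2.2 - Real.pi)
      (mem_uIcc.2 (Or.inr ⟨by linarith, by linarith [Real.pi_pos]⟩)) ?_
    rw [sub_sub_cancel, Real.cos_pi]
  · refine key (u.coords.1.2.2 + Real.pi)
      (mem_uIcc.2 (Or.inl ⟨by linarith [Real.pi_pos], by linarith⟩)) ?_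
    rw [sub_add_cancel_left, Real.cos_neg, Real.cos_pi]

/-! ### Cylindrical coordinates on the branched cover -/

/-- The points of the cover on the ray from the axis at height `ζ` and angle `θ` that approach the
one at distance `|r|` from the axis. -/
def approach (r ζ θ : ℝ) (n : ℕ) : Cover :=
  ⟨⟨(|r| + 1 / ((n : ℝ) + 1), ζ, θ), by positivity⟩⟩

instance : Nonempty BranchedCover := ⟨((approach 0 0 0 0 : Cover) : BranchedCover)⟩

/-- The point of the branched cover with cylindrical coordinates `(r, ζ, θ)`, for `r ≥ 0`. -/
def pt (r ζ θ : ℝ) : BranchedCover :=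
  limUnder atTop fun n => ((approach r ζ θ n : Cover) : BranchedCover)

theorem tendsto_radius_approach {r : ℝ} (hr : 0 ≤ r) :
    Tendsto (fun n : ℕ => |r| + 1 / ((n : ℝ) + 1)) atTop (𝓝 r) := by
  have := (tendsto_one_div_add_atTop_nhds_zero_nat (𝕜 := ℝ)).const_add r
  rw [abs_of_nonneg hr]
  rwa [add_zero] at this

theorem dist_mk_radial {r r' : ℝ} (hr : 0 < r) (hr' : 0 < r') (ζ θ : ℝ) :
    dist (⟨⟨(r, ζ, θ), hr⟩⟩ : Cover) ⟨⟨(r', ζ, θ), hr'⟩⟩ = |r - r'| := by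
  rw [dist_eq_dist_dev (by simp [Real.pi_pos])]
  exact H3.dist_cyl_radial r ζ θ r'

theorem tendsto_pt (r ζ θ : ℝ) :
    Tendsto (fun n => ((approach r ζ θ n : Cover) : BranchedCover)) atTop (𝓝 (pt r ζ θ)) := by
  have hc : CauchySeq fun n => ((approach r ζ θ n : Cover) : BranchedCover) := by
    have h := (tendsto_radius_approach (abs_nonneg r)).cauchySeq
    rw [Metric.cauchySeq_iff] at h ⊢
    intro ε hε
    obtain ⟨N, hN⟩ := h ε hε
    refine ⟨N, fun m hm n hn => ?_⟩
    rw [Completion.dist_eq]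
    unfold approach
    rw [dist_mk_radial, ← Real.dist_eq]
    simpa using hN m hm n hn
  exact CauchySeq.tendsto_limUnder hc

theorem tendsto_dev_approach {r : ℝ} (hr : 0 ≤ r) (ζ θ : ℝ) :
    Tendsto (fun n => dev (approach r ζ θ n).coords) atTop (𝓝 (H3.cyl r ζ θ)) :=
  (H3.continuous_cyl.tendsto (r, ζ, θ)).comp
    ((tendsto_radius_approach hr).prodMk_nhds tendsto_const_nhds)

theorem dist_cyl_le_dist_pt {r r' : ℝ} (hr : 0 ≤ r) (hr' : 0 ≤ r') (ζ θ ζ' θ' : ℝ) :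
    dist (H3.cyl r ζ θ) (H3.cyl r' ζ' θ') ≤ dist (pt r ζ θ) (pt r' ζ' θ') := by
  refine le_of_tendsto_of_tendsto
    ((tendsto_dev_approach hr ζ θ).dist (tendsto_dev_approach hr' ζ' θ'))
    ((tendsto_pt r ζ θ).dist (tendsto_pt r' ζ' θ')) (Eventually.of_forall fun n => ?_)
  beta_reduce
  rw [Completion.dist_eq]
  exact dist_dev_le _ _

theorem dist_pt_of_lt {r r' : ℝ} (hr : 0 ≤ r) (hr' : 0 ≤ r') {ζ θ ζ' θ' : ℝ}
    (hθ : |θ - θ'| < Real.pi) :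
    dist (pt r ζ θ) (pt r' ζ' θ') = dist (H3.cyl r ζ θ) (H3.cyl r' ζ' θ') := by
  refine tendsto_nhds_unique ((tendsto_pt r ζ θ).dist (tendsto_pt r' ζ' θ')) ?_
  refine ((tendsto_dev_approach hr ζ θ).dist (tendsto_dev_approach hr' ζ' θ')).congr fun n => ?_
  rw [Completion.dist_eq]
  exact (dist_eq_dist_dev hθ).symm

/-- The distance of the branched cover, for angles that differ by at most `π`. -/
theorem dist_pt {r r' : ℝ} (hr : 0 ≤ r) (hr' : 0 ≤ r') {ζ θ ζ' θ' : ℝ}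
    (hθ : |θ - θ'| ≤ Real.pi) :
    dist (pt r ζ θ) (pt r' ζ' θ') = dist (H3.cyl r ζ θ) (H3.cyl r' ζ' θ') := by
  refine le_antisymm ?_ (dist_cyl_le_dist_pt hr hr' _ _ _ _)
  -- The case of gap exactly `π` is a limit: go through the point whose angle falls short of `θ'` by
  -- the fraction `s` of the gap, which leaves two gaps below `π`, and let `s → 0`.
  have hcont : Continuous fun s : ℝ => H3.cyl r' ζ' (θ + (1 - s) * (θ' - θ)) :=
    H3.continuous_cyl.comp (by fun_prop :
      Continuous fun s : ℝ => (r', ζ', θ + (1 - s) * (θ' - θ)))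
  have h0 : H3.cyl r' ζ' (θ + (1 - 0) * (θ' - θ)) = H3.cyl r' ζ' θ' := by
    congr 1
    ring
  have h1 : Tendsto (fun s : ℝ => dist (H3.cyl r ζ θ) (H3.cyl r' ζ' (θ + (1 - s) * (θ' - θ))) +
      dist (H3.cyl r' ζ' (θ + (1 - s) * (θ' - θ))) (H3.cyl r' ζ' θ')) (𝓝[>] 0)
      (𝓝 (dist (H3.cyl r ζ θ) (H3.cyl r' ζ' θ') + 0)) := by
    have h2 := (hcont.tendsto 0).mono_left (nhdsWithin_le_nhds (s := Ioi 0))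
    rw [h0] at h2
    have h3 := h2.dist (tendsto_const_nhds (x := H3.cyl r' ζ' θ'))
    rw [dist_self] at h3
    exact (tendsto_const_nhds.dist h2).add h3
  rw [add_zero] at h1
  refine ge_of_tendsto h1 ?_
  filter_upwards [Ioo_mem_nhdsGT (zero_lt_one' ℝ)] with s hs
  have hpi := Real.pi_pos
  rw [← dist_pt_of_lt hr hr', ← dist_pt_of_lt hr' hr']
  · exact dist_triangle _ _ _
  · have e : θ + (1 - s) * (θ' - θ) - θ' = s * (θ - θ') := by ring
    rw [e, abs_mul, abs_of_pos hs.1]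
    nlinarith [hs.1, hs.2, abs_nonneg (θ - θ')]
  · have e : θ - (θ + (1 - s) * (θ' - θ)) = (1 - s) * (θ - θ') := by ring
    rw [e, abs_mul, abs_of_pos (by linarith [hs.2] : 0 < 1 - s)]
    nlinarith [hs.1, hs.2, abs_nonneg (θ - θ')]

theorem dist_pt_radial {r r' : ℝ} (hr : 0 ≤ r) (hr' : 0 ≤ r') (ζ θ : ℝ) :
    dist (pt r ζ θ) (pt r' ζ θ) = |r - r'| := by
  rw [dist_pt hr hr' (by simp [Real.pi_pos.le]), H3.dist_cyl_radial]

theorem pt_of_pos {r : ℝ} (hr : 0 < r) (ζ θ : ℝ) :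
    pt r ζ θ = ((⟨⟨(r, ζ, θ), hr⟩⟩ : Cover) : BranchedCover) := by
  refine tendsto_nhds_unique (tendsto_pt r ζ θ) ?_
  rw [tendsto_iff_dist_tendsto_zero]
  have h := ((tendsto_radius_approach hr.le).sub_const r).abs
  rw [sub_self, abs_zero] at h
  refine h.congr fun n => ?_
  rw [Completion.dist_eq]
  exact (dist_mk_radial _ _ _ _).symm

theorem coe_eq_pt (u : Cover) :
    (u : BranchedCover) = pt u.coords.1.1 u.coords.1.2.1 u.coords.1.2.2 :=
  (pt_of_pos u.coords.2 _ _).symm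

theorem vadd_pt (z : ℂ) (r ζ θ : ℝ) : z +ᵥ pt r ζ θ = pt r (z.re + ζ) (z.im + θ) := by
  refine tendsto_nhds_unique
    (((isometry_vadd BranchedCover z).continuous.tendsto _).comp (tendsto_pt r ζ θ))
    ((tendsto_pt r _ _).congr fun n => ?_)
  exact Completion.coe_vadd z (approach r ζ θ n)

/-- The distance formula covers only angles at most `π` apart, so the point is first seen to be
locally constant in the angle; connectedness of `ℝ` does the rest. -/
theorem pt_zero (ζ θ θ' : ℝ) : pt 0 ζ θ = pt 0 ζ θ' := by
  have h : IsLocallyConstant fun θ => pt 0 ζ θ := by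
    rw [IsLocallyConstant.iff_eventually_eq]
    intro θ
    filter_upwards [Metric.ball_mem_nhds θ Real.pi_pos] with θ' hθ'
    refine dist_eq_zero.1 ?_
    rw [dist_pt le_rfl le_rfl (by rw [← Real.dist_eq]; exact (mem_ball.1 hθ').le)]
    refine H3.eq_of_cosh_eq dist_nonneg le_rfl ?_
    rw [H3.cosh_dist_cyl']
    simp
  exact h.apply_eq_of_preconnectedSpace θ θ'

/-- Once the radii exceed `c = r / 2`, the angular term of `cosh_dist_cyl'` is at least `sinh² c *
(2 / π²)` times the squared angle difference. -/
theorem cauchySeq_angle {u : ℕ → Cover} (hu : CauchySeq u) {r : ℝ} (hr : 0 < r)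
    (hur : Tendsto (fun n => (u n).coords.1.1) atTop (𝓝 r)) :
    CauchySeq fun n => (u n).coords.1.2.2 := by
  rw [Metric.cauchySeq_iff] at hu ⊢
  intro ε hε
  set c := r / 2 with hc
  have hc0 : 0 < c := by positivity
  have hsc := Real.sinh_pos_iff.2 hc0
  have hpi := Real.pi_pos
  have hcosh : ∀ᶠ d in 𝓝 (0 : ℝ), cosh d < 1 + sinh c ^ 2 * (2 / Real.pi ^ 2 * ε ^ 2) := by
    refine (Real.continuous_cosh.tendsto 0).eventually_lt_const ?_
    rw [Real.cosh_zero]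
    have : 0 < sinh c ^ 2 * (2 / Real.pi ^ 2 * ε ^ 2) := by positivity
    linarith
  obtain ⟨δ, hδ, hδ'⟩ := Metric.eventually_nhds_iff.1 hcosh
  obtain ⟨N, hN⟩ := hu (min δ c) (by positivity)
  obtain ⟨N', hN'⟩ := eventually_atTop.1 (hur.eventually_const_lt (by linarith : c < r))
  refine ⟨max N N', fun m hm n hn => ?_⟩
  have hd := hN m (le_of_max_le_left hm) n (le_of_max_le_left hn)
  have hrm := hN' m (le_of_max_le_right hm)
  have hrn := hN' n (le_of_max_le_right hn)
  have hθ := abs_angle_sub_lt_of_dist_lt ((hd.trans_le (min_le_right _ _)).trans hrm)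
  have h1 := @hδ' (dist (u m) (u n)) (by
    rw [Real.dist_eq, sub_zero, abs_of_nonneg dist_nonneg]
    exact hd.trans_le (min_le_left _ _))
  rw [dist_eq_dist_dev (by linarith)] at h1
  change cosh (dist (H3.cyl _ _ _) (H3.cyl _ _ _)) < _ at h1
  rw [H3.cosh_dist_cyl'] at h1
  rw [Real.dist_eq]
  have hq := Real.cos_le_one_sub_mul_cos_sq (x := (u m).coords.1.2.2 - (u n).coords.1.2.2)
    (by linarith)
  generalize (u m).coords.1.2.2 - (u n).coords.1.2.2 = x at *
  have e1 := Real.one_le_cosh ((u m).coords.1.1 - (u n).coords.1.1)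
  have e2 : 0 ≤ cosh (u m).coords.1.1 * cosh (u n).coords.1.1 *
      (cosh ((u m).coords.1.2.1 - (u n).coords.1.2.1) - 1) := by
    have := Real.cosh_pos (u m).coords.1.1
    have := Real.cosh_pos (u n).coords.1.1
    have : 0 ≤ cosh ((u m).coords.1.2.1 - (u n).coords.1.2.1) - 1 :=
      sub_nonneg.2 (Real.one_le_cosh _)
    positivity
  have e3 : sinh c * sinh c * (2 / Real.pi ^ 2 * x ^ 2) ≤
      sinh (u m).coords.1.1 * sinh (u n).coords.1.1 * (1 - Real.cos x) := by
    have g1 := Real.sinh_le_sinh.2 hrm.le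
    have g2 := Real.sinh_le_sinh.2 hrn.le
    have g3 : 2 / Real.pi ^ 2 * x ^ 2 ≤ 1 - Real.cos x := by linarith
    have g4 := hsc.le.trans g1
    have g4' := hsc.le.trans g2
    have g5 : 0 ≤ 2 / Real.pi ^ 2 * x ^ 2 := by positivity
    gcongr
  have e4 : sinh c ^ 2 * (2 / Real.pi ^ 2 * x ^ 2) < sinh c ^ 2 * (2 / Real.pi ^ 2 * ε ^ 2) := by
    nlinarith
  have e5 := lt_of_mul_lt_mul_left e4 (by positivity)
  have e6 := lt_of_mul_lt_mul_left e5 (by positivity)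
  exact abs_lt_of_sq_lt_sq e6 hε.le

/-- Every point of the branched cover has cylindrical coordinates. -/
theorem exists_eq_pt (x : BranchedCover) : ∃ r ζ θ, 0 ≤ r ∧ x = pt r ζ θ := by
  have hx : x ∈ closure (range ((↑) : Cover → BranchedCover)) := Completion.denseRange_coe x
  obtain ⟨y, hy, hyx⟩ := mem_closure_iff_seq_limit.1 hx
  choose u hu using hy
  obtain rfl : (fun n => (u n : BranchedCover)) = y := funext hu
  have hc : CauchySeq u := by
    have h := hyx.cauchySeq
    rw [Metric.cauchySeq_iff] at h ⊢
    simpa only [Completion.dist_eq] using h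
  obtain ⟨r, hr⟩ := cauchySeq_tendsto_of_complete
    (lipschitzWith_radius.cauchySeq_comp hc)
  obtain ⟨ζ, hζ⟩ := cauchySeq_tendsto_of_complete
    (lipschitzWith_height.cauchySeq_comp hc)
  have hr0 : 0 ≤ r := ge_of_tendsto' hr fun n => (u n).coords.2.le
  rcases hr0.eq_or_lt with rfl | hr0
  · refine ⟨0, ζ, 0, le_rfl, tendsto_nhds_unique hyx ?_⟩
    rw [tendsto_iff_dist_tendsto_zero]
    have h := (H3.continuous_cyl.tendsto (0, ζ, 0)).comp
      (hr.prodMk_nhds (hζ.prodMk_nhds (tendsto_const_nhds (x := (0 : ℝ)))))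
    rw [tendsto_iff_dist_tendsto_zero] at h
    refine h.congr fun n => ?_
    -- The angles of `u n` need not converge here, but on the axis the limit may be written with the
    -- angle of `u n`.
    rw [pt_zero ζ 0 (u n).coords.1.2.2, coe_eq_pt, dist_pt (u n).coords.2.le le_rfl
      (by simp [Real.pi_pos.le])]
    refine H3.eq_of_cosh_eq dist_nonneg dist_nonneg ?_
    simp only [Function.comp]
    rw [H3.cosh_dist_cyl, H3.cosh_dist_cyl]
    simp
  · obtain ⟨θ, hθ⟩ := cauchySeq_tendsto_of_complete (cauchySeq_angle hc hr0 hr)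
    refine ⟨r, ζ, θ, hr0.le, tendsto_nhds_unique hyx ?_⟩
    rw [tendsto_iff_dist_tendsto_zero]
    have h := (H3.continuous_cyl.tendsto (r, ζ, θ)).comp
      (hr.prodMk_nhds (hζ.prodMk_nhds hθ))
    rw [tendsto_iff_dist_tendsto_zero] at h
    refine h.congr' ?_
    filter_upwards [Metric.tendsto_nhds.1 hθ _ Real.pi_pos] with n hn
    rw [coe_eq_pt, dist_pt (u n).coords.2.le hr0.le (by rw [← Real.dist_eq]; exact hn.le)]
    rfl

theorem radius_eq_of_pt_eq {r r' ζ θ ζ' θ' : ℝ} (hr : 0 ≤ r) (hr' : 0 ≤ r')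
    (h : pt r ζ θ = pt r' ζ' θ') : r = r' := by
  have h1 := dist_cyl_le_dist_pt hr hr' ζ θ ζ' θ'
  rw [h, dist_self] at h1
  exact (H3.cyl_inj hr hr' (dist_le_zero.1 h1)).1

theorem pt_mem_axis_iff {r ζ θ : ℝ} (hr : 0 ≤ r) : pt r ζ θ ∈ axis ↔ r = 0 := by
  refine ⟨fun h => ?_, ?_⟩
  · by_contra hr0
    exact h ⟨_, (pt_of_pos (hr.lt_of_ne' hr0) ζ θ).symm⟩
  · rintro rfl ⟨u, hu⟩
    rw [coe_eq_pt] at hu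
    exact u.coords.2.ne' (radius_eq_of_pt_eq u.coords.2.le le_rfl hu)

/-- Displacements increase with the distance from the axis. -/
theorem dist_pt_mono {r r' : ℝ} (hr : 0 < r) (hrr' : r ≤ r') (ζ θ ζ' θ' : ℝ) :
    dist (pt r ζ θ) (pt r ζ' θ') ≤ dist (pt r' ζ θ) (pt r' ζ' θ') := by
  have hr' := hr.trans_le hrr'
  have h := dist_scale_le (div_pos hr hr') ((div_le_one hr').2 hrr')
    ⟨⟨(r', ζ, θ), hr'⟩⟩ ⟨⟨(r', ζ', θ'), hr'⟩⟩
  rw [pt_of_pos hr, pt_of_pos hr, pt_of_pos hr', pt_of_pos hr', Completion.dist_eq,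
    Completion.dist_eq]
  simpa only [scale, div_mul_cancel₀ _ hr'.ne'] using h

/-! ### Hyperbolic balls in a quotient and displacements of the group. -/

/-- A curve that is locally contracting at each of its points is contracting. -/
theorem dist_le_sub_of_locally {Y : Type*} [PseudoMetricSpace Y] {h : ℝ → Y} {a b : ℝ}
    (hab : a ≤ b) (hloc : ∀ s ∈ Icc a b, ∃ δ > 0, ∀ t ∈ Icc a b, |t - s| < δ →
      dist (h t) (h s) ≤ |t - s|) : dist (h a) (h b) ≤ b - a := by
  have hc : ContinuousOn h (Icc a b) := by
    rw [Metric.continuousOn_iff]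
    intro s hs ε hε
    obtain ⟨δ, hδ, hδ'⟩ := hloc s hs
    refine ⟨min δ ε, lt_min hδ hε, fun t ht hts => ?_⟩
    rw [Real.dist_eq] at hts
    exact (hδ' t ht (hts.trans_le (min_le_left _ _))).trans_lt (hts.trans_le (min_le_right _ _))
  have hcl : IsClosed ({t | dist (h a) (h t) ≤ t - a} ∩ Icc a b) := by
    have := isClosed_Icc.isClosed_le (by fun_prop : ContinuousOn
      (fun t => dist (h a) (h t)) (Icc a b)) (g := fun t => t - a) (by fun_prop)
    convert this using 1
    ext t
    exact and_comm
  -- Continuous induction: the set of good parameters is closed and can always be extended to the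
  -- right.
  have hsub := hcl.Icc_subset_of_forall_exists_gt (by simp) ?_
  · exact hsub (right_mem_Icc.2 hab)
  · rintro s ⟨hs, hsa, hsb⟩ y hy
    obtain ⟨δ, hδ, hδ'⟩ := hloc s ⟨hsa, hsb.le⟩
    have hy' : s < y := hy
    set t := min (min y b) (s + δ / 2) with ht
    have hst : s < t := lt_min (lt_min hy' hsb) (by linarith)
    have hty : t ≤ y := (min_le_left _ _).trans (min_le_left _ _)
    have htb : t ≤ b := (min_le_left _ _).trans (min_le_right _ _)
    have htδ : t ≤ s + δ / 2 := min_le_right _ _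
    refine ⟨t, ?_, hst, hty⟩
    have h1 := hδ' t ⟨hsa.trans hst.le, htb⟩ (by rw [abs_of_pos (by linarith)]; linarith)
    rw [abs_of_pos (by linarith), dist_comm] at h1
    have h2 := dist_triangle (h a) (h s) (h t)
    simp only [mem_ofPred_eq] at hs ⊢
    linarith

variable {α lam τ : ℝ}

/-- A map onto a model solid torus that identifies it, as a metric space, with the quotient of `X`
by the group `Γ`. -/
structure IsOrbitMap {X : Type*} [MetricSpace X] [AddAction ℂ X] (Γ : AddSubgroup ℂ)
    (E : X → SolidTorus α lam τ) : Prop where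
  surjective : Function.Surjective E
  map_vadd : ∀ g ∈ Γ, ∀ x, E (g +ᵥ x) = E x
  dist_le : ∀ x y, dist (E x) (E y) ≤ dist x y
  exists_dist_lt : ∀ x y, ∀ η > 0, ∃ g ∈ Γ, dist x (g +ᵥ y) < dist (E x) (E y) + η

instance : Nonempty H3 := ⟨H3.base⟩

namespace SolidTorus

/-- Since `f` carries a small ball onto a full ball, a point near `y` has a preimage near that of
`y`. The radius is cut down so that this preimage stays in the `ρ`-ball, where `f` is injective. -/
theorem exists_dist_invFunOn_eq {x : SolidTorus α lam τ} {ρ : ℝ} {f : H3 → SolidTorus α lam τ}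
    (hbij : BijOn f (ball H3.base ρ) (ball x ρ))
    (hloc : ∀ p ∈ ball H3.base ρ, ∃ δ > 0,
        (∀ u ∈ ball p δ, ∀ v ∈ ball p δ, dist (f u) (f v) = dist u v) ∧
          f '' ball p δ = ball (f p) δ) {y : SolidTorus α lam τ} (hy : y ∈ ball x ρ) :
    ∃ δ > 0, ∀ y' ∈ ball x ρ, dist y' y < δ →
      dist (Function.invFunOn f (ball H3.base ρ) y') (Function.invFunOn f (ball H3.base ρ) y) =
        dist y' y := by
  have hinv := hbij.invOn_invFunOn
  set F := Function.invFunOn f (ball H3.base ρ)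
  have hFy : F y ∈ ball H3.base ρ := hbij.surjOn.mapsTo_invFunOn hy
  have hfy : f (F y) = y := hinv.2 hy
  obtain ⟨δ, hδ, hiso, him⟩ := hloc _ hFy
  refine ⟨min δ (ρ - dist (F y) H3.base), lt_min hδ (sub_pos.2 hFy), fun y' hy' hlt => ?_⟩
  have h1 : y' ∈ f '' ball (F y) δ := by
    rw [him, hfy]
    exact hlt.trans_le (min_le_left _ _)
  obtain ⟨p, hp, rfl⟩ := h1
  have h2 := hiso p hp (F y) (mem_ball_self hδ)
  rw [hfy] at h2
  have h3 : p ∈ ball H3.base ρ := by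
    have := hlt.trans_le (min_le_right _ _)
    rw [h2] at this
    have := dist_triangle p (F y) H3.base
    rw [mem_ball]
    linarith
  rw [hinv.1 h3, h2]

end SolidTorus

namespace IsOrbitMap

variable {X : Type*} [MetricSpace X] [AddAction ℂ X] [IsIsometricVAdd ℂ X] {Γ : AddSubgroup ℂ}
  {E : X → SolidTorus α lam τ}

/-- A hyperbolic ball contains no half of a shortest geodesic loop: the geodesic from `x` to its
nearest translate `g +ᵥ x` would run back on itself. -/
theorem vadd_midpoint_eq (hE : IsOrbitMap Γ E) {x : X} {ρ : ℝ}
    (hball : SolidTorus.IsHyperbolicBall (E x) ρ) {g : ℂ} (hg : g ∈ Γ) {D : ℝ} (hD0 : 0 < D)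
    (hDρ : D < 2 * ρ) (hmin : ∀ h ∈ Γ, h ≠ 0 → D ≤ dist x (h +ᵥ x)) {c : ℝ → X} (hc0 : c 0 = x)
    (hcD : c D = g +ᵥ x)
    (hc : ∀ s ∈ Icc 0 D, ∀ t ∈ Icc 0 D, dist (c s) (c t) = |s - t|) :
    g +ᵥ c (D / 2) = c (D / 2) := by
  obtain ⟨f, hf0, hbij, hloc⟩ := hball
  set k := D / 2 with hk
  have hk0 : 0 < k := by positivity
  have hkρ : k < ρ := by linarith
  have hkD : k ∈ Icc 0 D := ⟨hk0.le, by linarith⟩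
  have h0D : (0 : ℝ) ∈ Icc 0 D := ⟨le_rfl, hD0.le⟩
  have hDD : D ∈ Icc 0 D := ⟨hD0.le, le_rfl⟩
  have hx {s : ℝ} (hs : s ∈ Icc 0 D) : dist x (c s) = s := by
    rw [← hc0, hc 0 h0D s hs, zero_sub, abs_neg, abs_of_nonneg hs.1]
  have hgx {s : ℝ} (hs : s ∈ Icc 0 D) : dist (g +ᵥ x) (c s) = D - s := by
    rw [← hcD, hc D hDD s hs, abs_of_nonneg (by linarith [hs.2])]
  have hvadd (h : ℂ) (y z : X) : dist (h +ᵥ y) (h +ᵥ z) = dist y z :=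
    (isometry_vadd X h).dist_eq y z
  set y := E (c k) with hy
  -- the midpoint is as far from `x` in the quotient as it is along the geodesic
  have hxy : k ≤ dist (E x) y := by
    refine le_of_forall_pos_le_add fun η hη => ?_
    obtain ⟨h, hh, hlt⟩ := hE.exists_dist_lt x (c k) η hη
    by_cases h0 : h = 0
    · rw [h0, zero_vadd, hx hkD] at hlt
      exact hlt.le
    · have h1 := hmin h hh h0
      have h2 := dist_triangle x (h +ᵥ c k) (h +ᵥ x)
      rw [hvadd, dist_comm (c k), hx hkD] at h2
      linarith
  have hinv := hbij.invOn_invFunOn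
  set F := Function.invFunOn f (ball H3.base ρ) with hF
  have hxball : E x ∈ ball (E x) ρ := mem_ball_self (by linarith)
  have hF0 : F (E x) = H3.base := by
    rw [← hf0]
    exact hinv.1 (mem_ball_self (by linarith))
  -- the inverse of `f` contracts curves
  have hlift (γ : ℝ → SolidTorus α lam τ)
      (hγ : ∀ s ∈ Icc 0 k, γ s ∈ ball (E x) ρ)
      (hγ' : ∀ s ∈ Icc 0 k, ∀ t ∈ Icc 0 k, dist (γ s) (γ t) ≤ |s - t|)
      {a b : ℝ} (ha : 0 ≤ a) (hab : a ≤ b) (hb : b ≤ k) :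
      dist (F (γ a)) (F (γ b)) ≤ b - a := by
    have hsub : Icc a b ⊆ Icc 0 k := Icc_subset_Icc ha hb
    refine dist_le_sub_of_locally (h := fun s => F (γ s)) hab fun s hs => ?_
    obtain ⟨δ, hδ, hδ'⟩ := SolidTorus.exists_dist_invFunOn_eq hbij hloc (hγ s (hsub hs))
    refine ⟨δ, hδ, fun t ht hts => ?_⟩
    have h1 := hγ' t (hsub ht) s (hsub hs)
    rw [hδ' _ (hγ t (hsub ht)) (h1.trans_lt hts)]
    exact h1
  -- The local isometry `f` also contracts curves: it maps the geodesic from the basepoint to `F y`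
  -- to a curve from `E x` to `y`.
  have hq : k ≤ dist H3.base (F y) := by
    have hyb : y ∈ ball (E x) ρ := by
      rw [mem_ball, dist_comm]
      exact ((hE.dist_le _ _).trans_eq (hx hkD)).trans_lt hkρ
    have hFy : F y ∈ ball H3.base ρ := hbij.surjOn.mapsTo_invFunOn hyb
    refine hxy.trans ?_
    obtain ⟨c', hc'0, hc'1, hc'⟩ := H3.exists_geodesic H3.base (F y)
    set L := dist H3.base (F y) with hL
    have h0L : (0 : ℝ) ∈ Icc 0 L := ⟨le_rfl, dist_nonneg⟩
    have := dist_le_sub_of_locally (h := fun s => f (c' s)) (a := 0) (b := L) dist_nonneg ?_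
    · beta_reduce at this
      rwa [hc'0, hc'1, hf0, hinv.2 hyb, sub_zero] at this
    · intro s hs
      have h1 : c' s ∈ ball H3.base ρ := by
        rw [mem_ball, ← hc'0, hc' s hs 0 h0L, sub_zero, abs_of_nonneg hs.1]
        rw [mem_ball, dist_comm] at hFy
        exact hs.2.trans_lt hFy
      obtain ⟨δ, hδ, hiso, -⟩ := hloc _ h1
      refine ⟨δ, hδ, fun t ht hts => ?_⟩
      have h2 := hc' t ht s hs
      rw [hiso _ (by rw [mem_ball, h2]; exact hts) _ (mem_ball_self hδ), h2]
  -- the two halves of the geodesic have the same image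
  have hhalf {s : ℝ} (hs : s ∈ Ico 0 k) : E (c s) = E (c (D - s)) := by
    have hm {t : ℝ} (ht : t ∈ Icc 0 k) : t ∈ Icc 0 D := ⟨ht.1, ht.2.trans hkD.2⟩
    have hm' {t : ℝ} (ht : t ∈ Icc 0 k) : D - t ∈ Icc 0 D :=
      ⟨by linarith [(hm ht).2], by linarith [ht.1]⟩
    have hb1 : ∀ t ∈ Icc 0 k, E (c t) ∈ ball (E x) ρ := fun t ht => by
      rw [mem_ball, dist_comm]
      exact ((hE.dist_le _ _).trans_eq (hx (hm ht))).trans_lt (ht.2.trans_lt hkρ)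
    have hb2 : ∀ t ∈ Icc 0 k, E (c (D - t)) ∈ ball (E x) ρ := fun t ht => by
      rw [mem_ball, dist_comm, ← hE.map_vadd g hg x]
      refine ((hE.dist_le _ _).trans_eq (hgx (hm' ht))).trans_lt ?_
      linarith [ht.2]
    have hl1 : ∀ s ∈ Icc 0 k, ∀ t ∈ Icc 0 k, dist (E (c s)) (E (c t)) ≤ |s - t| :=
      fun s hs t ht => (hE.dist_le _ _).trans_eq (hc s (hm hs) t (hm ht))
    have hl2 : ∀ s ∈ Icc 0 k, ∀ t ∈ Icc 0 k, dist (E (c (D - s))) (E (c (D - t))) ≤ |s - t| :=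
      fun s hs t ht => by
        refine (hE.dist_le _ _).trans_eq ?_
        rw [hc _ (hm' hs) _ (hm' ht), abs_sub_comm]
        ring_nf
    have p1 := hlift (fun t => E (c t)) hb1 hl1 le_rfl hs.1 hs.2.le
    have p2 := hlift (fun t => E (c t)) hb1 hl1 hs.1 hs.2.le le_rfl
    have p3 := hlift (fun t => E (c (D - t))) hb2 hl2 le_rfl hs.1 hs.2.le
    have p4 := hlift (fun t => E (c (D - t))) hb2 hl2 hs.1 hs.2.le le_rfl
    have hDk : D - k = k := by rw [hk]; ring
    beta_reduce at p1 p2 p3 p4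
    rw [hc0, hF0, sub_zero] at p1
    rw [sub_zero, hcD, hE.map_vadd g hg x, hF0, sub_zero] at p3
    rw [hDk] at p4
    have hs' : s ∈ Icc 0 k := ⟨hs.1, hs.2.le⟩
    -- Both lifted points are within `s` of the basepoint and `k - s` of `F y`, while these two are
    -- at least `k` apart.
    have h1 := H3.eq_of_dist_le_of_dist_le hq p1 p2 p3 p4
    rw [← hinv.2 (hb1 s hs'), ← hinv.2 (hb2 s hs'), h1]
  -- hence `g` takes the first half of the geodesic to the second half, reversed
  have hsym {s : ℝ} (hs : s ∈ Ico 0 k) : dist (c (D - s)) (g +ᵥ c s) = 0 := by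
    have hsD : s ∈ Icc 0 D := ⟨hs.1, hs.2.le.trans hkD.2⟩
    have hsD' : D - s ∈ Icc 0 D := ⟨by linarith [hsD.2], by linarith [hs.1]⟩
    refine le_antisymm (le_of_forall_pos_le_add fun η hη => ?_) dist_nonneg
    have h2s : 0 < D - 2 * s := by linarith [hs.2]
    -- If `h ≠ g`, the route from `g +ᵥ x` to `h +ᵥ x` through `c (D - s)` and `h +ᵥ c s` is shorter
    -- than `s + (D - 2 * s) + s = D`, against the minimality of `D`. The margin closes at the
    -- midpoint, which is therefore reached by continuity.
    obtain ⟨h, hh, hlt⟩ := hE.exists_dist_lt (c (D - s)) (c s) (min η (D - 2 * s))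
      (lt_min hη h2s)
    rw [← hhalf hs, dist_self, zero_add] at hlt
    have hgh : h = g := by
      by_contra hne
      have h1 := hmin (-g + h) (Γ.add_mem (Γ.neg_mem hg) hh) fun h0 => hne (by
        rw [neg_add_eq_zero] at h0
        exact h0.symm)
      rw [← hvadd g, ← add_vadd, add_neg_cancel_left] at h1
      have h2 := dist_triangle4 (g +ᵥ x) (c (D - s)) (h +ᵥ c s) (h +ᵥ x)
      rw [hgx hsD', hvadd, dist_comm (c s), hx hsD] at h2
      linarith [min_le_right η (D - 2 * s)]
    rw [zero_add, ← hgh]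
    exact (hlt.trans_le (min_le_left _ _)).le
  rw [← dist_eq_zero]
  refine le_antisymm (le_of_forall_pos_le_add fun η hη => ?_) dist_nonneg
  set s := max 0 (k - η / 2) with hs
  have hsk : s ∈ Ico 0 k := ⟨le_max_left _ _, max_lt hk0 (by linarith)⟩
  have hsη : k - s ≤ η / 2 := by linarith [le_max_right 0 (k - η / 2)]
  have hsD : s ∈ Icc 0 D := ⟨hsk.1, hsk.2.le.trans hkD.2⟩
  have hsD' : D - s ∈ Icc 0 D := ⟨by linarith [hsD.2], by linarith [hsk.1]⟩
  have h1 := dist_triangle4 (g +ᵥ c k) (g +ᵥ c s) (c (D - s)) (c k)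
  rw [hvadd, dist_comm (g +ᵥ c s), hsym hsk, hc k hkD s hsD, hc _ hsD' k hkD,
    abs_of_pos (by linarith [hsk.2]), abs_of_pos (by linarith [hsk.2])] at h1
  linarith

/-- A ball that is isometric to a hyperbolic ball and is small compared with all displacements
projects to a hyperbolic ball of the quotient. -/
theorem isHyperbolicBall (hE : IsOrbitMap Γ E) {x : X} {ρ : ℝ}
    (hsep : ∀ h ∈ Γ, h ≠ 0 → 2 * ρ ≤ dist x (h +ᵥ x)) {φ : H3 → X} (hφ0 : φ H3.base = x)
    (hφ : ∀ u ∈ ball H3.base ρ, ∀ v ∈ ball H3.base ρ, dist (φ u) (φ v) = dist u v)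
    (hsurj : ball x ρ ⊆ φ '' ball H3.base ρ) : SolidTorus.IsHyperbolicBall (E x) ρ := by
  have hvadd (h : ℂ) (y z : X) : dist (h +ᵥ y) (h +ᵥ z) = dist y z :=
    (isometry_vadd X h).dist_eq y z
  have key (u v : X) (h : ℂ) (hh : h ∈ Γ) (h0 : h ≠ 0) :
      2 * ρ - dist x u - dist x v ≤ dist u (h +ᵥ v) := by
    have h1 := dist_triangle4 x u (h +ᵥ v) (h +ᵥ x)
    rw [hvadd, dist_comm v] at h1
    linarith [hsep h hh h0]
  -- Pairs of small perimeter with `x` cannot be brought closer by a group element; distant pairs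
  -- can, so the projection is isometric only locally.
  have hdist {u v : X} (huv : dist x u + dist x v + dist u v ≤ 2 * ρ) :
      dist (E u) (E v) = dist u v := by
    refine le_antisymm (hE.dist_le u v) (le_of_forall_pos_le_add fun η hη => ?_)
    obtain ⟨h, hh, hlt⟩ := hE.exists_dist_lt u v η hη
    by_cases h0 : h = 0
    · rw [h0, zero_vadd] at hlt
      exact hlt.le
    · linarith [key u v h hh h0]
  have hx {u : H3} (hu : u ∈ ball H3.base ρ) : dist x (φ u) = dist u H3.base := by
    have hρ : 0 < ρ := pos_of_mem_ball hu
    rw [← hφ0, dist_comm, hφ u hu _ (mem_ball_self hρ)]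
  refine ⟨fun u => E (φ u), congrArg E hφ0, ⟨?_, ?_, ?_⟩, ?_⟩
  · intro u hu
    rw [mem_ball, dist_comm]
    exact (hE.dist_le _ _).trans_lt ((hx hu).trans_lt hu)
  · intro u hu v hv huv
    have hu' := (hx hu).trans_lt hu
    have hv' := (hx hv).trans_lt hv
    rw [← dist_eq_zero, ← hφ u hu v hv]
    refine le_antisymm (le_of_forall_pos_le_add fun η hη => ?_) dist_nonneg
    obtain ⟨h, hh, hlt⟩ := hE.exists_dist_lt (φ u) (φ v)
      (min η (2 * ρ - dist x (φ u) - dist x (φ v))) (lt_min hη (by linarith))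
    beta_reduce at huv
    rw [huv, dist_self, zero_add] at hlt
    by_cases h0 : h = 0
    · rw [h0, zero_vadd] at hlt
      rw [zero_add]
      exact (hlt.trans_le (min_le_left _ _)).le
    · linarith [key (φ u) (φ v) h hh h0,
        min_le_right η (2 * ρ - dist x (φ u) - dist x (φ v))]
  · intro y hy
    obtain ⟨w, rfl⟩ := hE.surjective y
    rw [mem_ball, dist_comm] at hy
    obtain ⟨h, hh, hlt⟩ := hE.exists_dist_lt x w _ (sub_pos.2 hy)
    obtain ⟨u, hu, huw⟩ := hsurj (show h +ᵥ w ∈ ball x ρ by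
      rw [mem_ball, dist_comm]
      linarith)
    refine ⟨u, hu, ?_⟩
    beta_reduce
    rw [huw, hE.map_vadd h hh]
  · intro p hp
    have hp' : dist p H3.base < ρ := hp
    -- With this `δ`, two points of the `δ`-ball satisfy the perimeter condition: `2 * (dist p
    -- H3.base + δ) + 2 * δ = 2 * ρ`.
    set δ := (ρ - dist p H3.base) / 2 with hδ
    have hδ0 : 0 < δ := by rw [hδ]; linarith
    have hsub {u : H3} (hu : u ∈ ball p δ) : dist u H3.base < dist p H3.base + δ := by
      have := dist_triangle u p H3.base
      rw [mem_ball] at hu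
      linarith
    have hsub' {u : H3} (hu : u ∈ ball p δ) : u ∈ ball H3.base ρ := by
      rw [mem_ball]
      linarith [hsub hu]
    have hiso : ∀ u ∈ ball p δ, ∀ v ∈ ball p δ, dist (E (φ u)) (E (φ v)) = dist u v := by
      intro u hu v hv
      have h1 := hφ u (hsub' hu) v (hsub' hv)
      rw [hdist, h1]
      rw [hx (hsub' hu), hx (hsub' hv), h1]
      have := dist_triangle_right u v p
      rw [mem_ball] at hu hv
      linarith [hsub hu, hsub hv]
    refine ⟨δ, hδ0, hiso, Subset.antisymm ?_ ?_⟩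
    · rintro _ ⟨u, hu, rfl⟩
      rw [mem_ball, hiso u hu p (mem_ball_self hδ0)]
      exact hu
    · intro y hy
      obtain ⟨w, rfl⟩ := hE.surjective y
      rw [mem_ball, dist_comm] at hy
      obtain ⟨h, hh, hlt⟩ := hE.exists_dist_lt (φ p) w _ (sub_pos.2 hy)
      have hlt' : dist (φ p) (h +ᵥ w) < δ := by linarith
      obtain ⟨u, hu, huw⟩ := hsurj (show h +ᵥ w ∈ ball x ρ by
        rw [mem_ball, dist_comm]
        have := dist_triangle x (φ p) (h +ᵥ w)
        rw [hx hp] at this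
        linarith)
      refine ⟨u, ?_, ?_⟩
      · rw [mem_ball, dist_comm, ← hφ p hp u hu, huw]
        exact hlt'
      · beta_reduce
        rw [huw, hE.map_vadd h hh]

end IsOrbitMap

/-! ### The deck group and the radius function on the solid torus. -/

theorem mem_deck_iff {g : ℂ} :
    g ∈ deck α lam τ ↔ ∃ m n : ℤ, g.re = n * lam ∧ g.im = m * α + n * τ := by
  rw [deck, AddSubgroup.mem_closure_pair]
  refine exists_congr fun m => exists_congr fun n => ?_
  rw [Complex.ext_iff]
  simp only [zsmul_eq_mul, Complex.add_re, Complex.add_im, Complex.mul_re, Complex.mul_im,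
    Complex.intCast_re, Complex.intCast_im, Complex.ofReal_re, Complex.ofReal_im, Complex.I_re,
    Complex.I_im]
  ring_nf
  exact ⟨fun h => ⟨h.1.symm, h.2.symm⟩, fun h => ⟨h.1.symm, h.2.symm⟩⟩

theorem mul_I_mem_deck (m : ℤ) : ((m * α : ℝ) : ℂ) * Complex.I ∈ deck α lam τ :=
  mem_deck_iff.2 ⟨m, 0, by simp, by simp⟩

/-- Discreteness of the lattice; it provides a deck element of least displacement. -/
theorem finite_deck_inter (hα : 0 < α) (hlam : 0 < lam) (K : ℝ) :
    {g ∈ deck α lam τ | |g.re| ≤ K ∧ |g.im| ≤ K}.Finite := by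
  set N : ℤ := ⌈K / lam⌉ with hN
  set M : ℤ := ⌈(K + N * |τ|) / α⌉ with hM
  refine (((finite_Icc (-M) M).prod (finite_Icc (-N) N)).image fun x : ℤ × ℤ =>
    (⟨x.2 * lam, x.1 * α + x.2 * τ⟩ : ℂ)).subset ?_
  rintro g ⟨hg, hre, him⟩
  obtain ⟨m, n, h1, h2⟩ := mem_deck_iff.1 hg
  have hn : |(n : ℝ)| ≤ N := by
    refine le_trans ?_ (Int.le_ceil _)
    rw [le_div_iff₀ hlam, ← abs_of_pos hlam, ← abs_mul, ← h1]
    exact hre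
  have hm : |(m : ℝ)| ≤ M := by
    refine le_trans ?_ (Int.le_ceil _)
    rw [le_div_iff₀ hα, ← abs_of_pos hα, ← abs_mul]
    have e : (m : ℝ) * α = g.im - n * τ := by rw [h2]; ring
    rw [e]
    refine (abs_sub _ _).trans ?_
    rw [abs_mul]
    gcongr
  refine ⟨(m, n), ⟨?_, ?_⟩, Complex.ext h1.symm h2.symm⟩
  · rw [mem_Icc, ← abs_le]
    exact_mod_cast hm
  · rw [mem_Icc, ← abs_le]
    exact_mod_cast hn

namespace SolidTorus

theorem mk_vadd {g : ℂ} (hg : g ∈ deck α lam τ) (x : BranchedCover) :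
    mk α lam τ (g +ᵥ x) = mk α lam τ x :=
  mk_eq_mk.2 ⟨⟨g, hg⟩, rfl⟩

theorem isOrbitMap_mk : IsOrbitMap (deck α lam τ) (mk α lam τ) where
  surjective := mk_surjective
  map_vadd _ hg x := mk_vadd hg x
  dist_le x y := by
    rw [dist_mk]
    refine (ciInf_le (bddBelow_dist x y) 0).trans_eq ?_
    rw [zero_vadd]
  exists_dist_lt x y η hη := by
    rw [dist_mk]
    obtain ⟨g, hg⟩ := exists_lt_of_ciInf_lt
      (lt_add_of_pos_right (⨅ g : deck α lam τ, dist x (g +ᵥ y)) hη)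
    exact ⟨g, g.2, hg⟩

theorem exists_eq_mk_pt (x : SolidTorus α lam τ) :
    ∃ r ζ θ, 0 ≤ r ∧ x = mk α lam τ (pt r ζ θ) := by
  obtain ⟨y, rfl⟩ := mk_surjective x
  obtain ⟨r, ζ, θ, hr, rfl⟩ := exists_eq_pt y
  exact ⟨r, ζ, θ, hr, rfl⟩

theorem exists_eq_mk_pt_zero {y : SolidTorus α lam τ} (hy : y ∈ core α lam τ) :
    ∃ ζ θ, y = mk α lam τ (pt 0 ζ θ) := by
  obtain ⟨a, ha, rfl⟩ := hy
  obtain ⟨r, ζ, θ, hr, rfl⟩ := exists_eq_pt a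
  rw [pt_mem_axis_iff hr] at ha
  exact ⟨ζ, θ, by rw [ha]⟩

theorem mk_pt_zero_mem_core (ζ θ : ℝ) : mk α lam τ (pt 0 ζ θ) ∈ core α lam τ :=
  mem_image_of_mem _ ((pt_mem_axis_iff le_rfl).2 rfl)

theorem radius_le_dist_mk {r r' : ℝ} (hr : 0 ≤ r) (hr' : 0 ≤ r') (ζ θ ζ' θ' : ℝ) :
    |r - r'| ≤ dist (mk α lam τ (pt r ζ θ)) (mk α lam τ (pt r' ζ' θ')) := by
  rw [dist_mk]
  refine le_ciInf fun g => ?_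
  change _ ≤ dist _ ((g : ℂ) +ᵥ pt r' ζ' θ')
  rw [vadd_pt]
  exact (H3.abs_sub_radius_le hr hr').trans (dist_cyl_le_dist_pt hr hr' _ _ _ _)

theorem dist_mk_radial {r r' : ℝ} (hr : 0 ≤ r) (hr' : 0 ≤ r') (ζ θ : ℝ) :
    dist (mk α lam τ (pt r ζ θ)) (mk α lam τ (pt r' ζ θ)) = |r - r'| :=
  le_antisymm ((isOrbitMap_mk.dist_le _ _).trans_eq (dist_pt_radial hr hr' ζ θ))
    (radius_le_dist_mk hr hr' _ _ _ _)

theorem infDist_mk_pt {r : ℝ} (hr : 0 ≤ r) (ζ θ : ℝ) :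
    infDist (mk α lam τ (pt r ζ θ)) (core α lam τ) = r := by
  refine le_antisymm ?_ ?_
  · refine (infDist_le_dist_of_mem (mk_pt_zero_mem_core ζ θ)).trans_eq ?_
    rw [dist_mk_radial hr le_rfl, sub_zero, abs_of_nonneg hr]
  · refine (le_infDist ⟨_, mk_pt_zero_mem_core 0 0⟩).2 fun y hy => ?_
    obtain ⟨ζ', θ', rfl⟩ := exists_eq_mk_pt_zero hy
    have := radius_le_dist_mk (α := α) (lam := lam) (τ := τ) hr le_rfl ζ θ ζ' θ'
    rwa [sub_zero, abs_of_nonneg hr] at this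

theorem mk_pt_mem_core_iff {r : ℝ} (hr : 0 ≤ r) (ζ θ : ℝ) :
    mk α lam τ (pt r ζ θ) ∈ core α lam τ ↔ r = 0 := by
  refine ⟨fun h => ?_, ?_⟩
  · rw [← infDist_mk_pt (α := α) (lam := lam) (τ := τ) hr ζ θ, infDist_zero_of_mem h]
  · rintro rfl
    exact mk_pt_zero_mem_core ζ θ

theorem mk_pt_rotate (r ζ θ : ℝ) (k : ℤ) :
    mk α lam τ (pt r ζ (θ + k * α)) = mk α lam τ (pt r ζ θ) := by
  rw [← mk_vadd (mul_I_mem_deck k) (pt r ζ θ), vadd_pt]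
  simp [add_comm]

/-! ### Hyperbolic balls for cone angle below `2π`. -/

/-- A hyperbolic ball does not contain cone points. -/
theorem IsHyperbolicBall.le_radius (hα : 0 < α) (hα' : α < 2 * Real.pi) {r ζ θ ρ : ℝ}
    (hr : 0 ≤ r) (h : IsHyperbolicBall (mk α lam τ (pt r ζ θ)) ρ) : ρ ≤ r := by
  by_contra! hlt
  obtain ⟨f, -, hbij, hloc⟩ := h
  obtain ⟨p, hp, hfp⟩ := hbij.surjOn (show mk α lam τ (pt 0 ζ θ) ∈ ball _ ρ by
    rw [mem_ball, dist_mk_radial le_rfl hr, zero_sub, abs_neg, abs_of_nonneg hr]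
    exact hlt)
  obtain ⟨δ, hδ, hiso, him⟩ := hloc p hp
  set s := δ / 2 with hs
  have hs0 : 0 < s := by positivity
  have hsδ : s < δ := by linarith
  have hu1 : dist (mk α lam τ (pt s ζ θ)) (f p) = s := by
    rw [hfp, dist_mk_radial hs0.le le_rfl, sub_zero, abs_of_pos hs0]
  obtain ⟨u, hu, hfu⟩ : mk α lam τ (pt s ζ θ) ∈ f '' ball p δ := by
    rw [him, mem_ball, hu1]
    exact hsδ
  have hup : dist u p = s := by
    rw [← hiso u hu p (mem_ball_self hδ), hfu, hu1]
  -- In `H3` the point `u` has an antipode about `p`. In the cone every point can be rotated to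
  -- within angle `α / 2 < π` of `f u`, so no point at distance `s` from the apex is at distance `2
  -- * s` from `f u`.
  obtain ⟨v, hv1, hv2⟩ := H3.exists_antipode p u
  rw [dist_comm p u, hup] at hv1 hv2
  have hv : v ∈ ball p δ := by
    rw [mem_ball, dist_comm, hv1]
    exact hsδ
  have hd1 := hiso p (mem_ball_self hδ) v hv
  have hd2 := hiso u hu v hv
  obtain ⟨r', ζ', θ', hr', hfv⟩ := exists_eq_mk_pt (f v)
  rw [hv1, hfp, hfv] at hd1
  rw [hv2, hfu, hfv] at hd2
  -- `κ < 1` bounds `-cos` of the rotated angle; it is kept nonnegative so that the bound is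
  -- monotone in `sinh r'`. In the limit `cosh (2 * s) ≤ cosh² s + κ * sinh² s`, which is absurd.
  set κ := max (-Real.cos (α / 2)) 0 with hκ
  have hκ1 : κ < 1 := by
    refine max_lt ?_ one_pos
    have := Real.cos_lt_cos_of_nonneg_of_le_pi (x := α / 2) (y := Real.pi) (by positivity) le_rfl
      (by linarith)
    rw [Real.cos_pi] at this
    linarith
  have hκ0 : 0 ≤ κ := le_max_right _ _
  have key : ∀ η > 0, cosh (2 * s) ≤ cosh s * cosh (s + η) + κ * (sinh s * sinh (s + η)) := by
    intro η hη
    obtain ⟨g, hg, hlt⟩ := isOrbitMap_mk.exists_dist_lt (pt 0 ζ θ) (pt r' ζ' θ') η hη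
    rw [hd1, vadd_pt] at hlt
    rw [← mk_vadd hg (pt r' ζ' θ'), vadd_pt] at hd2
    generalize g.re + ζ' = ζ₁ at *
    generalize g.im + θ' = θ₁ at *
    have hr's : r' ≤ s + η := by
      have := (H3.abs_sub_radius_le le_rfl hr').trans
        ((dist_cyl_le_dist_pt le_rfl hr' ζ θ ζ₁ θ₁).trans hlt.le)
      rwa [zero_sub, abs_neg, abs_of_nonneg hr'] at this
    have hX : cosh r' * cosh (ζ - ζ₁) ≤ cosh (s + η) := by
      have h1 := H3.cosh_le_of_le dist_nonneg
        ((dist_cyl_le_dist_pt le_rfl hr' ζ θ ζ₁ θ₁).trans hlt.le)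
      rw [H3.cosh_dist_cyl] at h1
      simpa using h1
    set k : ℤ := round ((θ - θ₁) / α) with hk
    have hang : |θ - (θ₁ + k * α)| ≤ α / 2 := by
      have h1 := abs_sub_round ((θ - θ₁) / α)
      have e : θ - (θ₁ + k * α) = ((θ - θ₁) / α - k) * α := by
        field_simp
        ring
      rw [e, abs_mul, abs_of_pos hα]
      nlinarith
    rw [← mk_pt_rotate r' ζ₁ θ₁ k] at hd2
    have h2 := isOrbitMap_mk.dist_le (α := α) (lam := lam) (τ := τ) (pt s ζ θ)
      (pt r' ζ₁ (θ₁ + k * α))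
    rw [hd2, dist_pt hs0.le hr' (by linarith)] at h2
    have h3 := H3.cosh_le_of_le (by positivity) h2
    rw [H3.cosh_dist_cyl] at h3
    have hcos : -Real.cos (θ - (θ₁ + k * α)) ≤ κ := by
      refine le_trans ?_ (le_max_left _ _)
      rw [neg_le_neg_iff, ← Real.cos_abs (θ - _)]
      exact Real.cos_le_cos_of_nonneg_of_le_pi (abs_nonneg _) (by linarith) hang
    have hsinh : sinh r' ≤ sinh (s + η) := Real.sinh_le_sinh.2 hr's
    have s1 := Real.sinh_nonneg_iff.2 hr'
    have s2 := Real.sinh_nonneg_iff.2 hs0.le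
    have c1 := Real.cosh_pos s
    have h4 : cosh s * (cosh r' * cosh (ζ - ζ₁)) ≤ cosh s * cosh (s + η) := by gcongr
    have h5 : sinh s * sinh r' * -Real.cos (θ - (θ₁ + k * α)) ≤ sinh s * sinh (s + η) * κ := by
      calc sinh s * sinh r' * -Real.cos (θ - (θ₁ + k * α)) ≤ sinh s * sinh r' * κ := by gcongr
        _ ≤ _ := by gcongr
    linarith
  have hlim : Tendsto (fun η : ℝ => cosh s * cosh (s + η) + κ * (sinh s * sinh (s + η)))
      (𝓝[>] 0) (𝓝 (cosh s * cosh (s + 0) + κ * (sinh s * sinh (s + 0)))) := by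
    have : Continuous fun η : ℝ => cosh s * cosh (s + η) + κ * (sinh s * sinh (s + η)) := by
      fun_prop
    exact (this.tendsto 0).mono_left nhdsWithin_le_nhds
  have hfin := ge_of_tendsto hlim (eventually_nhdsWithin_of_forall key)
  rw [add_zero, Real.cosh_two_mul] at hfin
  have hsin := Real.sinh_pos_iff.2 hs0
  nlinarith [mul_pos hsin hsin]

end SolidTorus

/-- The group `ℂ` is commutative and moves `(r, 0, 0)` to `(r, ζ, θ)`. -/
theorem dist_pt_vadd (g : ℂ) (r ζ θ : ℝ) :
    dist (pt r ζ θ) (g +ᵥ pt r ζ θ) = dist (pt r 0 0) (g +ᵥ pt r 0 0) := by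
  have h : pt r ζ θ = (⟨ζ, θ⟩ : ℂ) +ᵥ pt r 0 0 := by rw [vadd_pt]; simp
  rw [h, ← add_vadd, add_comm, add_vadd]
  exact (isometry_vadd BranchedCover _).dist_eq _ _

/-- The ball of radius at most `r` about a point at distance `r` from the axis is isometric to a
ball of hyperbolic space. -/
theorem exists_chart {r ρ : ℝ} (hr : 0 < r) (hρ : ρ ≤ r) (ζ θ : ℝ) :
    ∃ φ : H3 → BranchedCover, φ H3.base = pt r ζ θ ∧
      (∀ u ∈ ball H3.base ρ, ∀ v ∈ ball H3.base ρ, dist (φ u) (φ v) = dist u v) ∧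
      ball (pt r ζ θ) ρ ⊆ φ '' ball H3.base ρ := by
  choose R Z hR hcyl using H3.exists_eq_cyl
  have hang {q : H3} (hq : dist q (H3.cyl r 0 0) < r) : |q.z.arg| < Real.pi / 2 := by
    have h1 := hcyl q
    by_contra! hge
    have hcos : Real.cos q.z.arg ≤ 0 := by
      rw [← Real.cos_abs]
      have := Complex.abs_arg_le_pi q.z
      exact Real.cos_nonpos_of_pi_div_two_le_of_le hge (by linarith [Real.pi_pos])
    refine absurd hq (not_lt.2 (H3.le_of_cosh_le dist_nonneg ?_))
    rw [h1, H3.cosh_dist_cyl, sub_zero, sub_zero]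
    have s1 := Real.sinh_nonneg_iff.2 (hR q)
    have s2 := Real.sinh_nonneg_iff.2 hr.le
    have c1 := Real.one_le_cosh (R q)
    have c2 := Real.one_le_cosh r
    have c3 := Real.one_le_cosh (Z q)
    have l1 : cosh r ≤ cosh (R q) * cosh r := le_mul_of_one_le_left (by positivity) c1
    have l2 : cosh (R q) * cosh r ≤ cosh (R q) * cosh r * cosh (Z q) :=
      le_mul_of_one_le_right (by positivity) c3
    have l3 : sinh (R q) * sinh r * Real.cos q.z.arg ≤ 0 :=
      mul_nonpos_of_nonneg_of_nonpos (by positivity) hcos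
    linarith
  set A := H3.fromBase (H3.cyl r 0 0) with hA
  have hA0 : A H3.base = H3.cyl r 0 0 := H3.fromBase_base _
  -- A section of the projection, by the principal argument. On the ball of radius `r` arguments
  -- stay below `π / 2` in absolute value, so all gaps are below `π`. The chart is `ψ` after moving
  -- the basepoint to `cyl r 0 0`, followed by the translation by `ζ` and `θ`.
  set ψ : H3 → BranchedCover := fun q => pt (R q) (Z q) q.z.arg with hψ
  have hψd {q q' : H3} (hq : dist q (H3.cyl r 0 0) < r) (hq' : dist q' (H3.cyl r 0 0) < r) :
      dist (ψ q) (ψ q') = dist q q' := by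
    have h1 := hang hq
    have h2 := hang hq'
    simp only [hψ]
    rw [dist_pt (hR q) (hR q') (by linarith [abs_sub q.z.arg q'.z.arg]), ← hcyl, ← hcyl]
  have hψpt {r' ζ' θ' : ℝ} (hr' : 0 ≤ r') (hθ' : |θ'| < Real.pi / 2)
      (hd : dist (H3.cyl r' ζ' θ') (H3.cyl r 0 0) < r) :
      ψ (H3.cyl r' ζ' θ') = pt r' ζ' θ' := by
    have h1 := hang hd
    rw [← dist_eq_zero]
    simp only [hψ]
    rw [dist_pt (hR _) hr' (by linarith [abs_sub (H3.cyl r' ζ' θ').z.arg θ']), ← hcyl, dist_self]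
  set z : ℂ := ⟨ζ, θ⟩ with hz
  have hzpt : z +ᵥ pt r 0 0 = pt r ζ θ := by rw [vadd_pt]; simp [hz]
  have hball {u : H3} (hu : u ∈ ball H3.base ρ) : dist (A u) (H3.cyl r 0 0) < r := by
    rw [← hA0, A.dist_eq]
    exact (mem_ball.1 hu).trans_le hρ
  have hvadd (y y' : BranchedCover) : dist (z +ᵥ y) (z +ᵥ y') = dist y y' :=
    (isometry_vadd BranchedCover z).dist_eq y y'
  refine ⟨fun p => z +ᵥ ψ (A p), ?_, ?_, ?_⟩
  · beta_reduce
    rw [hA0, hψpt hr.le (by simp [Real.pi_pos]) (by simpa using hr), hzpt]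
  · intro u hu v hv
    rw [hvadd, hψd (hball hu) (hball hv), A.dist_eq]
  · intro w hw
    obtain ⟨w', rfl⟩ : ∃ w', z +ᵥ w' = w := ⟨-z +ᵥ w, vadd_neg_vadd z w⟩
    rw [mem_ball, ← hzpt, hvadd] at hw
    obtain ⟨r', ζ', θ', hr', rfl⟩ := exists_eq_pt w'
    have hwr := hw.trans_le hρ
    have hr'0 : 0 < r' := by
      refine hr'.lt_of_ne' fun h0 => ?_
      have h1 := (H3.abs_sub_radius_le hr' hr.le).trans
        (dist_cyl_le_dist_pt hr' hr.le ζ' θ' 0 0)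
      rw [h0, zero_sub, abs_neg, abs_of_pos hr] at h1
      rw [h0] at hwr
      linarith
    have hθ' : |θ'| < Real.pi / 2 := by
      rw [pt_of_pos hr'0, pt_of_pos hr, Completion.dist_eq, dist_comm] at hwr
      have h1 := abs_angle_sub_lt_of_dist_lt (u := ⟨⟨(r, 0, 0), hr⟩⟩)
        (v := ⟨⟨(r', ζ', θ'), hr'0⟩⟩) hwr
      simpa using h1
    have hd := (dist_cyl_le_dist_pt hr' hr.le ζ' θ' 0 0).trans_lt hw
    refine ⟨A.symm (H3.cyl r' ζ' θ'), ?_, ?_⟩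
    · rw [mem_ball, ← A.dist_eq, IsometryEquiv.apply_symm_apply, hA0]
      exact hd
    · beta_reduce
      rw [IsometryEquiv.apply_symm_apply, hψpt hr' hθ' (hd.trans_le hρ)]

namespace SolidTorus

/-- Hyperbolic balls about a nonsingular point, away from cone angle `2π`. -/
theorem isHyperbolicBall_iff_of_lt (hα : 0 < α) (hα' : α < 2 * Real.pi) (hlam : 0 < lam)
    {r ρ : ℝ} (hr : 0 < r) (ζ θ : ℝ) :
    IsHyperbolicBall (mk α lam τ (pt r ζ θ)) ρ ↔
      ρ ≤ r ∧ ∀ g ∈ deck α lam τ, g ≠ 0 → 2 * ρ ≤ dist (pt r 0 0) (g +ᵥ pt r 0 0) := by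
  refine ⟨fun h => ?_, fun h => ?_⟩
  · have hρr := h.le_radius hα hα' hr.le
    refine ⟨hρr, ?_⟩
    by_contra! hex
    set S := {g ∈ deck α lam τ | g ≠ 0 ∧ dist (pt r 0 0) (g +ᵥ pt r 0 0) < 2 * ρ} with hS
    -- A turn through at least `π` costs at least `2 * r ≥ 2 * ρ`.
    have him {g : ℂ} (hg : g ∈ S) : |g.im| < Real.pi := by
      by_contra! hge
      have h1 := hg.2.2
      rw [vadd_pt, pt_of_pos hr, pt_of_pos hr, Completion.dist_eq] at h1
      have h2 := radius_add_radius_le_dist (u := ⟨⟨(r, 0, 0), hr⟩⟩)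
        (v := ⟨⟨(r, g.re + 0, g.im + 0), hr⟩⟩) (by simpa using hge)
      simp only at h2
      linarith
    have hre {g : ℂ} (hg : g ∈ S) : |g.re| ≤ 2 * ρ := by
      have h1 := hg.2.2
      rw [vadd_pt] at h1
      have h2 := (H3.abs_sub_height_le hr.le hr.le).trans
        (dist_cyl_le_dist_pt hr.le hr.le 0 0 (g.re + 0) (g.im + 0))
      rw [add_zero, zero_sub, abs_neg] at h2
      rw [add_zero] at h1
      linarith
    have hfin : S.Finite := (finite_deck_inter hα hlam (max (2 * ρ) Real.pi)).subset fun g hg =>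
      ⟨hg.1, (hre hg).trans (le_max_left _ _), (him hg).le.trans (le_max_right _ _)⟩
    obtain ⟨g, hg, hgmin⟩ := exists_min_image S (fun g => dist (pt r 0 0) (g +ᵥ pt r 0 0)) hfin
      (by obtain ⟨g, h1, h2, h3⟩ := hex; exact ⟨g, h1, h2, h3⟩)
    set u : Cover := ⟨⟨(r, ζ, θ), hr⟩⟩ with hu
    set v : Cover := ⟨⟨(r, g.re + ζ, g.im + θ), hr⟩⟩ with hv
    have huv : |u.coords.1.2.2 - v.coords.1.2.2| < Real.pi := by
      simpa [hu, hv] using him hg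
    obtain ⟨c, hc0, hc1, hc⟩ := exists_cover_geodesic huv
    have hcu : (u : BranchedCover) = pt r ζ θ := (pt_of_pos hr _ _).symm
    have hcv : (v : BranchedCover) = g +ᵥ pt r ζ θ := by rw [vadd_pt, pt_of_pos hr]
    have hD : dist u v = dist (pt r 0 0) (g +ᵥ pt r 0 0) := by
      rw [← dist_pt_vadd g r ζ θ, ← hcu, hcu, ← hcv, ← hcu, Completion.dist_eq]
    have hD0 : 0 < dist u v := by
      refine dist_nonneg.lt_of_ne' fun h0 => hg.2.1 ?_
      rw [dist_eq_dist_dev huv] at h0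
      have h1 := coords_eq_of_dev_eq (dist_eq_zero.1 h0) (by linarith [Real.pi_pos])
      simp only [hu, hv, Subtype.mk.injEq, Prod.mk.injEq] at h1
      exact Complex.ext (by simpa using h1.2.1) (by simpa using h1.2.2)
    have hfix := isOrbitMap_mk.vadd_midpoint_eq h hg.1 (D := dist u v) hD0 (by
        rw [hD]; exact hg.2.2)
      (fun k hk hk0 => by
        rw [hD, dist_pt_vadd k r ζ θ]
        by_cases hkS : k ∈ S
        · exact hgmin k hkS
        · have : ¬ dist (pt r 0 0) (k +ᵥ pt r 0 0) < 2 * ρ := fun h => hkS ⟨hk, hk0, h⟩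
          exact hg.2.2.le.trans (not_lt.1 this))
      (c := fun s => (c s : BranchedCover)) (by rw [hc0, hcu]) (by rw [hc1, hcv])
      (fun s hs t ht => by rw [Completion.dist_eq]; exact hc s hs t ht)
    -- The midpoint lies in the cover, hence off the axis, where a nonzero `g` that turns by less
    -- than `π` fixes nothing.
    generalize c (dist u v / 2) = w at hfix
    rw [coe_eq_pt, vadd_pt, ← dist_eq_zero] at hfix
    rw [dist_pt w.coords.2.le w.coords.2.le (by simpa using (him hg).le)] at hfix
    obtain ⟨-, h2, h3⟩ := H3.cyl_inj w.coords.2.le w.coords.2.le (dist_eq_zero.1 hfix)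
    refine hg.2.1 (Complex.ext (by simpa using h2) ?_)
    rcases h3 with h3 | h3
    · exact absurd h3 w.coords.2.ne'
    · rw [add_sub_cancel_right] at h3
      have := abs_lt.1 (him hg)
      rw [Real.cos_eq_one_iff_of_lt_of_lt (by linarith) (by linarith)] at h3
      exact h3
  · obtain ⟨φ, h0, h1, h2⟩ := exists_chart hr h.1 ζ θ
    exact isOrbitMap_mk.isHyperbolicBall (fun g hg hg0 => by
      rw [dist_pt_vadd]; exact h.2 g hg hg0) h0 h1 h2

end SolidTorus

/-! ### Hyperbolic balls for cone angle `2π`. -/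

/-- The loxodromic generator of the deck group. -/
def lox (lam τ : ℝ) : ℂ := lam + τ * Complex.I

theorem mem_zmultiples_lox {g : ℂ} :
    g ∈ AddSubgroup.zmultiples (lox lam τ) ↔ ∃ n : ℤ, g.re = n * lam ∧ g.im = n * τ := by
  rw [AddSubgroup.mem_zmultiples_iff]
  refine exists_congr fun n => ?_
  rw [Complex.ext_iff]
  simp [lox, eq_comm]

namespace SolidTorus

/-- With cone angle `2π`, the model solid torus is the quotient of hyperbolic space by a cyclic
loxodromic group. -/
theorem exists_isOrbitMap_two_pi (lam τ : ℝ) : ∃ E : H3 → SolidTorus (2 * Real.pi) lam τ,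
    IsOrbitMap (AddSubgroup.zmultiples (lox lam τ)) E ∧
      ∀ r ζ θ, 0 ≤ r → E (H3.cyl r ζ θ) = mk (2 * Real.pi) lam τ (pt r ζ θ) := by
  choose R Z hR hcyl using H3.exists_eq_cyl
  set E : H3 → SolidTorus (2 * Real.pi) lam τ := fun p => mk _ _ _ (pt (R p) (Z p) p.z.arg) with hE
  have hEcyl (r ζ θ : ℝ) (hr : 0 ≤ r) :
      E (H3.cyl r ζ θ) = mk (2 * Real.pi) lam τ (pt r ζ θ) := by
    obtain ⟨h1, h2, h3⟩ := H3.cyl_inj hr (hR _) (hcyl (H3.cyl r ζ θ))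
    simp only [hE]
    rw [← h1, ← h2]
    rcases h3 with h3 | h3
    · rw [h3, pt_zero]
    · obtain ⟨n, hn⟩ := (Real.cos_eq_one_iff _).1 h3
      rw [← mk_pt_rotate r ζ _ n]
      congr 2
      linarith
  refine ⟨E, ⟨?_, ?_, ?_, ?_⟩, hEcyl⟩
  · intro y
    obtain ⟨r, ζ, θ, hr, rfl⟩ := exists_eq_mk_pt y
    exact ⟨H3.cyl r ζ θ, hEcyl r ζ θ hr⟩
  · intro g hg p
    obtain ⟨n, h1, h2⟩ := mem_zmultiples_lox.1 hg
    rw [hcyl p, H3.vadd_cyl, hEcyl _ _ _ (hR p), hEcyl _ _ _ (hR p), ← vadd_pt]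
    exact mk_vadd (mem_deck_iff.2 ⟨0, n, h1, by simpa using h2⟩) _
  · intro p q
    -- Full turns about the axis are deck transformations; they bring the angles within `π`, where
    -- the distance of the branched cover is the hyperbolic one.
    set k : ℤ := round ((p.z.arg - q.z.arg) / (2 * Real.pi)) with hk
    have hpi := Real.pi_pos
    have hang : |p.z.arg - (q.z.arg + k * (2 * Real.pi))| ≤ Real.pi := by
      have h1 := abs_sub_round ((p.z.arg - q.z.arg) / (2 * Real.pi))
      have e : p.z.arg - (q.z.arg + k * (2 * Real.pi)) =
          ((p.z.arg - q.z.arg) / (2 * Real.pi) - k) * (2 * Real.pi) := by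
        field_simp
        ring
      rw [e, abs_mul, abs_of_pos (by positivity : 0 < 2 * Real.pi)]
      nlinarith
    conv_rhs => rw [hcyl p, hcyl q, ← H3.cyl_add_two_pi (R q) (Z q) q.z.arg k]
    rw [← dist_pt (hR p) (hR q) hang]
    simp only [hE]
    rw [← mk_pt_rotate (R q) (Z q) q.z.arg k]
    exact isOrbitMap_mk.dist_le _ _
  · intro p q η hη
    obtain ⟨g, hg, hlt⟩ := isOrbitMap_mk.exists_dist_lt (α := 2 * Real.pi) (lam := lam) (τ := τ)
      (pt (R p) (Z p) p.z.arg) (pt (R q) (Z q) q.z.arg) η hη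
    obtain ⟨m, n, h1, h2⟩ := mem_deck_iff.1 hg
    -- The `m` full turns in `g` act trivially on `H3` and are dropped; projection to `H3` does not
    -- increase distances.
    refine ⟨⟨n * lam, n * τ⟩, mem_zmultiples_lox.2 ⟨n, rfl, rfl⟩, lt_of_le_of_lt ?_ hlt⟩
    rw [vadd_pt]
    refine le_trans (le_of_eq ?_) (dist_cyl_le_dist_pt (hR p) (hR q) _ _ _ _)
    conv_lhs => rw [hcyl p, hcyl q, H3.vadd_cyl]
    rw [← H3.cyl_add_two_pi (R q) _ _ m, h1, h2]
    congr 2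
    ring

end SolidTorus

theorem H3.dist_cyl_vadd (g : ℂ) (r ζ θ : ℝ) :
    dist (cyl r ζ θ) (g +ᵥ cyl r ζ θ) = dist (cyl r 0 0) (g +ᵥ cyl r 0 0) := by
  have h : cyl r ζ θ = (⟨ζ, θ⟩ : ℂ) +ᵥ cyl r 0 0 := by rw [vadd_cyl]; simp
  rw [h, ← add_vadd, add_comm, add_vadd]
  exact (isometry_vadd H3 _).dist_eq _ _

theorem H3.abs_re_le_dist_vadd (g : ℂ) (p : H3) : |g.re| ≤ dist p (g +ᵥ p) := by
  obtain ⟨r, ζ, hr, hp⟩ := exists_eq_cyl p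
  generalize p.z.arg = θ at hp
  subst hp
  rw [vadd_cyl]
  have := abs_sub_height_le (ζ := ζ) (ζ' := g.re + ζ) (θ := θ) (θ' := g.im + θ) hr hr
  rwa [sub_add_cancel_right, abs_neg] at this

theorem re_ne_zero_of_mem_zmultiples {g : ℂ}
    (hg : g ∈ AddSubgroup.zmultiples (lox lam τ)) (hg0 : g ≠ 0) : g.re ≠ 0 ∨ lam = 0 := by
  obtain ⟨n, h1, h2⟩ := mem_zmultiples_lox.1 hg
  by_contra! h
  rw [h1] at h
  rcases mul_eq_zero.1 h.1 with hn | hl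
  · exact hg0 (Complex.ext (by rw [h1, hn]; simp) (by rw [h2, hn]; simp))
  · exact h.2 hl

namespace SolidTorus

/-- Hyperbolic balls in the nonsingular model solid tori. -/
theorem isHyperbolicBall_iff_two_pi (hlam : 0 < lam) {r ρ : ℝ} (hr : 0 ≤ r) (ζ θ : ℝ) :
    IsHyperbolicBall (mk (2 * Real.pi) lam τ (pt r ζ θ)) ρ ↔
      ∀ g ∈ AddSubgroup.zmultiples (lox lam τ), g ≠ 0 →
        2 * ρ ≤ dist (H3.cyl r 0 0) (g +ᵥ H3.cyl r 0 0) := by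
  obtain ⟨E, hE, hEcyl⟩ := exists_isOrbitMap_two_pi lam τ
  rw [← hEcyl r ζ θ hr]
  refine ⟨fun h => ?_, fun h => ?_⟩
  · by_contra! hex
    set Γ := AddSubgroup.zmultiples (lox lam τ) with hΓ
    set S := {g ∈ Γ | g ≠ 0 ∧ dist (H3.cyl r 0 0) (g +ᵥ H3.cyl r 0 0) < 2 * ρ} with hS
    have hfin : S.Finite := by
      set N : ℤ := ⌈2 * ρ / lam⌉ with hN
      refine ((finite_Icc (-N) N).image fun n : ℤ => (⟨n * lam, n * τ⟩ : ℂ)).subset ?_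
      rintro g ⟨hg, -, hd⟩
      obtain ⟨n, h1, h2⟩ := mem_zmultiples_lox.1 hg
      refine ⟨n, ?_, Complex.ext h1.symm h2.symm⟩
      have hn : |(n : ℝ)| ≤ N := by
        refine le_trans ?_ (Int.le_ceil _)
        rw [le_div_iff₀ hlam, ← abs_of_pos hlam, ← abs_mul, ← h1]
        exact (H3.abs_re_le_dist_vadd g _).trans hd.le
      rw [mem_Icc, ← abs_le]
      exact_mod_cast hn
    obtain ⟨g, hg, hgmin⟩ := exists_min_image S
      (fun g => dist (H3.cyl r 0 0) (g +ᵥ H3.cyl r 0 0)) hfin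
      (by obtain ⟨g, h1, h2, h3⟩ := hex; exact ⟨g, h1, h2, h3⟩)
    have hre := (re_ne_zero_of_mem_zmultiples hg.1 hg.2.1).resolve_right hlam.ne'
    obtain ⟨c, hc0, hc1, hc⟩ := H3.exists_geodesic (H3.cyl r ζ θ) (g +ᵥ H3.cyl r ζ θ)
    rw [H3.dist_cyl_vadd] at hc1 hc
    have hfix := hE.vadd_midpoint_eq h hg.1
      ((abs_pos.2 hre).trans_le (H3.abs_re_le_dist_vadd g _)) hg.2.2
      (fun k hk hk0 => by
        rw [H3.dist_cyl_vadd k]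
        by_cases hkS : k ∈ S
        · exact hgmin k hkS
        · have : ¬ dist (H3.cyl r 0 0) (k +ᵥ H3.cyl r 0 0) < 2 * ρ := fun h => hkS ⟨hk, hk0, h⟩
          exact hg.2.2.le.trans (not_lt.1 this)) hc0 hc1 hc
    -- A loxodromic moves every point by at least its translation length, so it cannot fix the
    -- midpoint.
    have := H3.abs_re_le_dist_vadd g (c (dist (H3.cyl r 0 0) (g +ᵥ H3.cyl r 0 0) / 2))
    rw [hfix, dist_self] at this
    exact hre (abs_nonpos_iff.1 this)
  · refine hE.isHyperbolicBall (φ := H3.fromBase (H3.cyl r ζ θ)) (fun g hg hg0 => ?_)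
      (H3.fromBase_base _) (fun u _ v _ => IsometryEquiv.dist_eq _ u v) ?_
    · rw [H3.dist_cyl_vadd]
      exact h g hg hg0
    · rw [IsometryEquiv.image_ball, H3.fromBase_base]

end SolidTorus

/-! ### Estimates of displacements -/

theorem mul_sinh_le_sinh_mul {C x : ℝ} (hC : 1 ≤ C) (hx : 0 ≤ x) : C * sinh x ≤ sinh (C * x) := by
  have hmono : MonotoneOn (fun x => sinh (C * x) - C * sinh x) (Ici 0) := by
    have hd (x : ℝ) : HasDerivAt (fun x => sinh (C * x) - C * sinh x)
        (cosh (C * x) * C - C * cosh x) x := by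
      have h1 : HasDerivAt (fun x : ℝ => C * x) C x := by
        simpa using (hasDerivAt_id x).const_mul C
      exact ((Real.hasDerivAt_sinh (C * x)).comp x h1).sub ((Real.hasDerivAt_sinh x).const_mul C)
    refine monotoneOn_of_deriv_nonneg (convex_Ici 0) (by fun_prop)
      (fun x _ => (hd x).differentiableAt.differentiableWithinAt) fun x hx => ?_
    rw [interior_Ici, mem_Ioi] at hx
    rw [(hd x).deriv]
    have : cosh x ≤ cosh (C * x) := H3.cosh_le_of_le hx.le (le_mul_of_one_le_left hx.le hC)
    nlinarith
  have := hmono self_mem_Ici hx hx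
  simp only [mul_zero, Real.sinh_zero, sub_zero] at this
  linarith

theorem cosh_sub_one (x : ℝ) : cosh x - 1 = 2 * sinh (x / 2) ^ 2 := by
  have h : x = 2 * (x / 2) := by ring
  conv_lhs => rw [h, Real.cosh_two_mul, Real.cosh_sq]
  ring

/-- With `N = ‖g‖` and `a = |g.re|` the left side is `g.im ^ 2 / 2`, which dominates `1 - cos g.im`.
-/
theorem half_sq_sub_le_cosh_sub {a N : ℝ} (ha : 0 ≤ a) (haN : a ≤ N) :
    (N ^ 2 - a ^ 2) / 2 ≤ cosh N - cosh a := by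
  have e : cosh N - cosh a = 2 * sinh ((N + a) / 2) * sinh ((N - a) / 2) := by
    have h1 : N = (N + a) / 2 + (N - a) / 2 := by ring
    have h2 : a = (N + a) / 2 - (N - a) / 2 := by ring
    have h3 : cosh N = cosh ((N + a) / 2 + (N - a) / 2) := by rw [← h1]
    have h4 : cosh a = cosh ((N + a) / 2 - (N - a) / 2) := by rw [← h2]
    rw [h3, h4, Real.cosh_add, Real.cosh_sub]
    ring
  have h1 := Real.self_le_sinh_iff.2 (by linarith : 0 ≤ (N + a) / 2)
  have h2 := Real.self_le_sinh_iff.2 (by linarith : 0 ≤ (N - a) / 2)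
  have h3 : 0 ≤ (N - a) / 2 := by linarith
  have h4 : 0 ≤ (N + a) / 2 := by linarith
  have := mul_le_mul h1 h2 h3 (h4.trans h1)
  rw [e]
  nlinarith

/-- A chord is at most the arc on the equidistant surface. Analytically, `cosh dist - 1` is bounded
by `cosh² r * (cosh ‖g‖ - 1)`, and then by `cosh (cosh r * ‖g‖) - 1` because `C * sinh x ≤ sinh (C *
x)`. -/
theorem H3.dist_cyl_vadd_le (g : ℂ) (r : ℝ) :
    dist (cyl r 0 0) (g +ᵥ cyl r 0 0) ≤ cosh r * ‖g‖ := by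
  have hC := Real.one_le_cosh r
  have hN := norm_nonneg g
  refine le_of_cosh_le (by positivity) ?_
  rw [vadd_cyl, cosh_dist_cyl', sub_self, Real.cosh_zero, add_zero, add_zero, zero_sub, zero_sub,
    Real.cosh_neg, Real.cos_neg]
  have h1 := mul_sinh_le_sinh_mul hC (by positivity : 0 ≤ ‖g‖ / 2)
  have h2 : cosh r ^ 2 * (cosh ‖g‖ - 1) ≤ cosh (cosh r * ‖g‖) - 1 := by
    rw [cosh_sub_one, cosh_sub_one, mul_div_assoc]
    have h3 : 0 ≤ cosh r * sinh (‖g‖ / 2) :=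
      mul_nonneg (by positivity) (Real.sinh_nonneg_iff.2 (by positivity))
    nlinarith [mul_self_le_mul_self h3 h1]
  have h4 := half_sq_sub_le_cosh_sub (abs_nonneg g.re) (Complex.abs_re_le_norm g)
  rw [Complex.sq_norm, Complex.normSq_apply, sq_abs, Real.cosh_abs] at h4
  have h5 := Real.one_sub_sq_div_two_le_cos (x := g.im)
  have h6 : sinh r ^ 2 * (1 - Real.cos g.im) ≤ cosh r ^ 2 * (1 - Real.cos g.im) := by
    have h7 : 0 ≤ 1 - Real.cos g.im := sub_nonneg.2 (Real.cos_le_one _)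
    have h8 := Real.cosh_sq r
    nlinarith
  have h9 : cosh r ^ 2 * (cosh g.re - 1 + (1 - Real.cos g.im)) ≤
      cosh r ^ 2 * (cosh ‖g‖ - 1) := by
    have : cosh g.re - 1 + (1 - Real.cos g.im) ≤ cosh ‖g‖ - 1 := by nlinarith
    gcongr
  nlinarith

theorem dist_nsmul_vadd_le (n : ℕ) (h : ℂ) (x : BranchedCover) :
    dist x ((n • h) +ᵥ x) ≤ n * dist x (h +ᵥ x) := by
  induction n with
  | zero => simp
  | succ n ih =>
    have h1 := dist_triangle x ((n • h) +ᵥ x) (((n + 1) • h) +ᵥ x)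
    rw [add_smul, one_smul, add_vadd, (isometry_vadd BranchedCover (n • h)).dist_eq] at h1
    rw [add_smul, one_smul, add_vadd]
    push_cast
    linarith

/-- A translation along the equidistant torus moves points by at most the length of the arc. -/
theorem dist_pt_vadd_le (g : ℂ) {r : ℝ} (hr : 0 ≤ r) :
    dist (pt r 0 0) (g +ᵥ pt r 0 0) ≤ cosh r * ‖g‖ := by
  -- Cut `g` into `n + 1` equal steps, each turning by at most `π`, so that the hyperbolic bound
  -- applies to each step.
  obtain ⟨n, hn⟩ := exists_nat_ge (|g.im| / Real.pi)
  have hn1 : (0 : ℝ) < (n + 1 : ℕ) := by positivity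
  set h : ℂ := g / (n + 1 : ℕ) with hh
  have hg : g = (n + 1) • h := by
    rw [hh, nsmul_eq_mul, mul_div_cancel₀]
    exact_mod_cast hn1.ne'
  have h1 : dist (pt r 0 0) (h +ᵥ pt r 0 0) ≤ cosh r * ‖h‖ := by
    refine le_trans (le_of_eq ?_) (H3.dist_cyl_vadd_le h r)
    rw [vadd_pt, H3.vadd_cyl, dist_pt hr hr]
    rw [add_zero, zero_sub, abs_neg, hh, Complex.div_natCast_im, abs_div, abs_of_pos hn1,
      div_le_iff₀ hn1]
    rw [div_le_iff₀ Real.pi_pos] at hn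
    push_cast
    nlinarith [Real.pi_pos]
  conv_lhs => rw [hg]
  refine (dist_nsmul_vadd_le _ h _).trans ?_
  have h2 : ‖h‖ = ‖g‖ / (n + 1 : ℕ) := by rw [hh, norm_div, Complex.norm_natCast]
  rw [h2] at h1
  calc ((n + 1 : ℕ) : ℝ) * dist (pt r 0 0) (h +ᵥ pt r 0 0)
      ≤ ((n + 1 : ℕ) : ℝ) * (cosh r * (‖g‖ / (n + 1 : ℕ))) := by gcongr
    _ = cosh r * ‖g‖ := by field_simp

/-- A lattice in the plane has a nonzero vector of square length at most `2 / √3` times its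
covolume. -/
theorem exists_short_vector (hα : 0 < α) (hlam : 0 < lam) (τ : ℝ) :
    ∃ m n : ℤ, (m ≠ 0 ∨ n ≠ 0) ∧
      (n * lam) ^ 2 + (m * α + n * τ) ^ 2 ≤ 2 / √3 * (α * lam) := by
  -- Multiplication by `i / α` takes `lam + iτ` to `z` and `iα` to `-1`, so the lattice becomes that
  -- of the vectors `cz + d`. Moving `z` to the modular fundamental domain gives `Im z / |cz + d|² ≥
  -- √3 / 2`.
  set z : UpperHalfPlane := ⟨⟨-τ / α, lam / α⟩, by simp only; positivity⟩ with hz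
  obtain ⟨g, hg⟩ := ModularGroup.exists_smul_mem_fd z
  have h3 := ModularGroup.three_le_four_mul_im_sq_of_mem_fd hg
  have him := (g • z).im_pos
  have hre : z.re = -τ / α := rfl
  have him' : z.im = lam / α := rfl
  rw [ModularGroup.im_smul_eq_div_normSq, ModularGroup.denom_apply] at h3 him
  set c := g 1 0 with hc
  set d := g 1 1 with hd
  have hN : Complex.normSq ((c : ℂ) * z + d) = (c * (-τ / α) + d) ^ 2 + (c * (lam / α)) ^ 2 := by
    rw [Complex.normSq_apply]
    simp only [Complex.add_re, Complex.mul_re, Complex.intCast_re, Complex.intCast_im,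
      Complex.add_im, Complex.mul_im, UpperHalfPlane.coe_re, UpperHalfPlane.coe_im, hre, him']
    ring
  rw [hN] at h3 him
  have hzim : 0 < z.im := z.im_pos
  set Q := (c * (-τ / α) + d) ^ 2 + (c * (lam / α)) ^ 2 with hQ
  have hQ0 : 0 < Q := by
    rcases (div_pos_iff.1 him) with h | h
    · exact h.2
    · exact absurd h.1 (by linarith)
  refine ⟨-d, c, ?_, ?_⟩
  · by_contra! h
    have hd0 : d = 0 := neg_eq_zero.1 h.1
    rw [hQ, hd0, h.2] at hQ0
    simp at hQ0
  · have h4 : √3 * Q ≤ 2 * (lam / α) := by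
      rw [him'] at h3 him
      have h5 : √3 ^ 2 ≤ (2 * (lam / α / Q)) ^ 2 := by
        rw [Real.sq_sqrt (by norm_num)]
        nlinarith
      have h6 := abs_le_of_sq_le_sq' h5 (by positivity)
      have h7 := h6.2
      rw [← mul_div_assoc, le_div_iff₀ hQ0] at h7
      exact h7
    have h8 : (c * lam) ^ 2 + (((-d : ℤ) : ℝ) * α + c * τ) ^ 2 = α ^ 2 * Q := by
      rw [hQ]
      push_cast
      field_simp
      ring
    rw [h8]
    have h9 : 0 < √3 := by positivity
    have h10 : Q ≤ 2 * (lam / α) / √3 := by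
      rw [le_div_iff₀ h9]
      linarith
    calc α ^ 2 * Q ≤ α ^ 2 * (2 * (lam / α) / √3) := by gcongr
      _ = 2 / √3 * (α * lam) := by field_simp

theorem H3.dist_cyl_mono {r r' : ℝ} (hr : 0 ≤ r) (hrr' : r ≤ r') (ζ θ ζ' θ' : ℝ) :
    dist (cyl r ζ θ) (cyl r ζ' θ') ≤ dist (cyl r' ζ θ) (cyl r' ζ' θ') := by
  refine le_of_cosh_le dist_nonneg ?_
  rw [cosh_dist_cyl', cosh_dist_cyl', sub_self, sub_self]
  have h1 : cosh r ≤ cosh r' := cosh_le_of_le hr hrr'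
  have h2 : sinh r ≤ sinh r' := Real.sinh_le_sinh.2 hrr'
  have h3 := Real.sinh_nonneg_iff.2 hr
  have h4 := Real.cosh_pos r
  have h3' := h3.trans h2
  have h5 : 0 ≤ cosh (ζ - ζ') - 1 := sub_nonneg.2 (Real.one_le_cosh _)
  have h6 : 0 ≤ 1 - Real.cos (θ - θ') := sub_nonneg.2 (Real.cos_le_one _)
  gcongr

/-! ### Size of hyperbolic balls as a function of the distance from the core. -/

namespace SolidTorus

theorem isHyperbolicBall_mono_radius (hα : 0 < α) (hα' : α ≤ 2 * Real.pi) (hlam : 0 < lam)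
    {r r' ρ : ℝ} (hr : 0 ≤ r) (hr0 : 0 < r ∨ α = 2 * Real.pi) (hrr' : r ≤ r') {ζ θ : ℝ}
    (h : IsHyperbolicBall (mk α lam τ (pt r ζ θ)) ρ) (ζ' θ' : ℝ) :
    IsHyperbolicBall (mk α lam τ (pt r' ζ' θ')) ρ := by
  rcases hα'.lt_or_eq with hα' | rfl
  · have hr := hr0.resolve_right hα'.ne
    rw [isHyperbolicBall_iff_of_lt hα hα' hlam hr] at h
    rw [isHyperbolicBall_iff_of_lt hα hα' hlam (hr.trans_le hrr')]
    refine ⟨h.1.trans hrr', fun g hg hg0 => (h.2 g hg hg0).trans ?_⟩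
    rw [vadd_pt, vadd_pt]
    exact dist_pt_mono hr hrr' _ _ _ _
  · rw [isHyperbolicBall_iff_two_pi hlam hr] at h
    rw [isHyperbolicBall_iff_two_pi hlam (hr.trans hrr')]
    refine fun g hg hg0 => (h g hg hg0).trans ?_
    rw [H3.vadd_cyl, H3.vadd_cyl]
    exact H3.dist_cyl_mono hr hrr' _ _ _ _

end SolidTorus

theorem le_abs_intCast_mul {n : ℤ} (hn : n ≠ 0) {c : ℝ} (hc : 0 < c) : c ≤ |n * c| := by
  rw [abs_mul, abs_of_pos hc]
  have : (1 : ℝ) ≤ |(n : ℝ)| := by exact_mod_cast Int.one_le_abs hn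
  nlinarith

theorem H3.cosh_mul_le_cosh_dist_vadd {g : ℂ} {r : ℝ} (hlam : 0 ≤ lam) (hg : lam ≤ |g.re|) :
    cosh r * (cosh lam - 1) ≤ cosh (dist (cyl r 0 0) (g +ᵥ cyl r 0 0)) := by
  rw [vadd_cyl, cosh_dist_cyl', sub_self, Real.cosh_zero, add_zero, add_zero, zero_sub, zero_sub,
    Real.cosh_neg, Real.cos_neg]
  have h1 : cosh lam ≤ cosh g.re := by
    rw [← Real.cosh_abs g.re]
    exact cosh_le_of_le hlam hg
  have h2 := Real.one_le_cosh r
  have h3 : cosh r * (cosh lam - 1) ≤ cosh r * cosh r * (cosh g.re - 1) := by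
    have := Real.one_le_cosh lam
    have h4 : cosh r ≤ cosh r * cosh r := by nlinarith
    exact mul_le_mul h4 (by linarith) (by linarith) (by positivity)
  nlinarith [sq_nonneg (sinh r), mul_nonneg (mul_self_nonneg (sinh r))
    (sub_nonneg.2 (Real.cos_le_one g.im))]

theorem exists_radius_le_mul_cosh {κ : ℝ} (hκ : 0 < κ) (K : ℝ) :
    ∃ R, 0 < R ∧ K ≤ R ∧ cosh K ≤ cosh R * κ := by
  refine ⟨max (max K 1) (cosh K / κ), ?_, ?_, ?_⟩
  · exact zero_lt_one.trans_le ((le_max_right _ _).trans (le_max_left _ _))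
  · exact (le_max_left _ _).trans (le_max_left _ _)
  · set R := max (max K 1) (cosh K / κ)
    have h1 : cosh K / κ ≤ R := le_max_right _ _
    have h2 : R ≤ cosh R := by
      have h3 : R ≤ sinh R := Real.self_le_sinh_iff.2
        (zero_le_one.trans ((le_max_right _ _).trans (le_max_left _ _)))
      exact h3.trans (Real.sinh_lt_cosh R).le
    rw [← div_le_iff₀ hκ]
    exact h1.trans h2

namespace SolidTorus

/-- Far from the core there are large hyperbolic balls. -/
theorem exists_isHyperbolicBall (hα : 0 < α) (hα' : α ≤ 2 * Real.pi) (hlam : 0 < lam) (τ : ℝ)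
    {ρ : ℝ} (hρ : 0 < ρ) :
    ∃ R, 0 < R ∧ ∀ ζ θ, IsHyperbolicBall (mk α lam τ (pt R ζ θ)) ρ := by
  -- A nontrivial pure rotation in the deck group turns by at least `α`; the angular bound is
  -- available only up to `π / 2`.
  set β := min α (Real.pi / 2) with hβ
  have hβ0 : 0 < β := lt_min hα (by positivity)
  have hβ1 : β ≤ Real.pi / 2 := min_le_right _ _
  have hcos : Real.cos β < 1 := by
    rw [← Real.cos_zero]
    exact Real.cos_lt_cos_of_nonneg_of_le_pi_div_two le_rfl hβ1 hβ0
  have hcosh : 1 < cosh lam := Real.one_lt_cosh.2 hlam.ne'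
  obtain ⟨R, hR0, hKR, hR⟩ := exists_radius_le_mul_cosh
    (lt_min (sub_pos.2 hcosh) (sub_pos.2 hcos)) (2 * ρ)
  have hRre : cosh (2 * ρ) ≤ cosh R * (cosh lam - 1) :=
    hR.trans (mul_le_mul_of_nonneg_left (min_le_left _ _) (Real.cosh_pos _).le)
  have hRim : cosh (2 * ρ) ≤ cosh R * (1 - Real.cos β) :=
    hR.trans (mul_le_mul_of_nonneg_left (min_le_right _ _) (Real.cosh_pos _).le)
  refine ⟨R, hR0, fun ζ θ => ?_⟩
  have hre {g : ℂ} (hg : lam ≤ |g.re|) :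
      2 * ρ ≤ dist (H3.cyl R 0 0) (g +ᵥ H3.cyl R 0 0) :=
    H3.le_of_cosh_le dist_nonneg (hRre.trans (H3.cosh_mul_le_cosh_dist_vadd hlam.le hg))
  rcases hα'.lt_or_eq with hα' | rfl
  · rw [isHyperbolicBall_iff_of_lt hα hα' hlam hR0]
    refine ⟨by linarith, fun g hg hg0 => ?_⟩
    obtain ⟨m, n, h1, h2⟩ := mem_deck_iff.1 hg
    by_cases hn : n = 0
    · have hm : m ≠ 0 := by
        rintro rfl
        exact hg0 (Complex.ext (by simp [h1, hn]) (by simp [h2, hn]))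
      refine H3.le_of_cosh_le dist_nonneg (hRim.trans ?_)
      rw [vadd_pt, pt_of_pos hR0, pt_of_pos hR0, Completion.dist_eq]
      refine cosh_radius_mul_le_cosh_dist (u := ⟨⟨(R, 0, 0), hR0⟩⟩) hβ0.le hβ1 ?_
      simp only [add_zero, zero_sub, abs_neg, h2, hn, Int.cast_zero, zero_mul]
      exact (min_le_left _ _).trans (le_abs_intCast_mul hm hα)
    · have h := hre (g := g) (by rw [h1]; exact le_abs_intCast_mul hn hlam)
      rw [H3.vadd_cyl] at h
      rw [vadd_pt]
      exact h.trans (dist_cyl_le_dist_pt hR0.le hR0.le _ _ _ _)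
  · rw [isHyperbolicBall_iff_two_pi hlam hR0.le]
    intro g hg hg0
    obtain ⟨n, h1, h2⟩ := mem_zmultiples_lox.1 hg
    refine hre ?_
    rw [h1]
    refine le_abs_intCast_mul ?_ hlam
    rintro rfl
    exact hg0 (Complex.ext (by simp [h1]) (by simp [h2]))

/-- A hyperbolic ball about a point at distance `r` from the core has diameter at most the length
of a shortest closed curve on the equidistant torus. -/
theorem two_mul_le_of_isHyperbolicBall (hα : 0 < α) (hα' : α ≤ 2 * Real.pi) (hlam : 0 < lam)
    (hlam' : lam ≤ 2.97) {r ρ ζ θ : ℝ} (hr : 0 < r)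
    (h : IsHyperbolicBall (mk α lam τ (pt r ζ θ)) ρ) :
    2 * ρ ≤ cosh r * √(4 * Real.pi / √3 * lam) := by
  obtain ⟨m, n, hmn, hle⟩ := exists_short_vector hα hlam τ
  set g : ℂ := ⟨n * lam, m * α + n * τ⟩ with hg
  have h3 : 0 < √3 := by positivity
  have hle' : (n * lam) ^ 2 + (m * α + n * τ) ^ 2 ≤ 4 * Real.pi / √3 * lam := by
    refine hle.trans ?_
    calc 2 / √3 * (α * lam) ≤ 2 / √3 * (2 * Real.pi * lam) := by gcongr
      _ = 4 * Real.pi / √3 * lam := by ring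
  have hnorm : cosh r * ‖g‖ ≤ cosh r * √(4 * Real.pi / √3 * lam) := by
    refine mul_le_mul_of_nonneg_left (Real.le_sqrt_of_sq_le ?_) (Real.cosh_pos _).le
    rw [Complex.sq_norm, Complex.normSq_apply]
    simpa only [sq, hg] using hle'
  refine le_trans ?_ hnorm
  rcases hα'.lt_or_eq with hα' | rfl
  · rw [isHyperbolicBall_iff_of_lt hα hα' hlam hr] at h
    refine (h.2 g (mem_deck_iff.2 ⟨m, n, rfl, rfl⟩) fun hg0 => ?_).trans (dist_pt_vadd_le g hr.le)
    have hre : (n : ℝ) * lam = 0 := congrArg Complex.re hg0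
    have him : (m : ℝ) * α + n * τ = 0 := congrArg Complex.im hg0
    have hn : (n : ℝ) = 0 := (mul_eq_zero.1 hre).resolve_right hlam.ne'
    rw [hn, zero_mul, add_zero] at him
    have hm : (m : ℝ) = 0 := (mul_eq_zero.1 him).resolve_right hα.ne'
    rcases hmn with hmn | hmn
    · exact hmn (by exact_mod_cast hm)
    · exact hmn (by exact_mod_cast hn)
  · rw [isHyperbolicBall_iff_two_pi hlam hr.le] at h
    -- At cone angle `2π` pure rotations act trivially on `H3`, so the short vector must translate.
    -- Otherwise its length would be at least `2π`, which forces `lam ≥ π * √3 > 2.97`.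
    have hn : n ≠ 0 := by
      rintro rfl
      have hm : m ≠ 0 := hmn.resolve_right (by simp)
      have h1 : 2 * Real.pi ≤ |m * (2 * Real.pi)| := le_abs_intCast_mul hm hα
      simp only [Int.cast_zero, zero_mul, add_zero] at hle'
      have h4 : (2 * Real.pi) ^ 2 ≤ (m * (2 * Real.pi)) ^ 2 := by
        rw [← sq_abs (m * (2 * Real.pi))]
        gcongr
      have h5 : Real.pi * √3 ≤ lam := by
        have h6 : (2 * Real.pi) ^ 2 ≤ 4 * Real.pi / √3 * lam := by linarith
        rw [div_mul_eq_mul_div, le_div_iff₀ h3] at h6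
        have h7 : 4 * Real.pi * (Real.pi * √3) ≤ 4 * Real.pi * lam := by linarith
        exact le_of_mul_le_mul_left h7 (by positivity)
      have h8 : (1 : ℝ) ≤ √3 := Real.one_le_sqrt.2 (by norm_num)
      nlinarith [Real.pi_gt_three]
    have h1 := h ⟨n * lam, n * τ⟩ (mem_zmultiples_lox.2 ⟨n, rfl, rfl⟩) fun hg0 => by
      have hre : (n : ℝ) * lam = 0 := congrArg Complex.re hg0
      exact hn (by exact_mod_cast (mul_eq_zero.1 hre).resolve_right hlam.ne')
    refine h1.trans (le_trans (le_of_eq ?_) (H3.dist_cyl_vadd_le g r))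
    rw [H3.vadd_cyl, H3.vadd_cyl, ← H3.cyl_add_two_pi r (n * lam + 0) (n * τ + 0) m]
    simp only [hg, add_zero]
    rw [add_comm (n * τ)]

/-! ### The thin part as a tube about the core. -/

theorem notMem_thin_iff {ε : ℝ} (hε : 0 < ε) {x : SolidTorus α lam τ}
    (hx : α = 2 * Real.pi ∨ x ∉ core α lam τ) :
    x ∉ thin α lam τ ε ↔ ∃ ρ, ε / 2 < ρ ∧ IsHyperbolicBall x ρ := by
  have hx' : ¬ (α ≠ 2 * Real.pi ∧ x ∈ core α lam τ) := by tauto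
  have hε2 : 0 ≤ ε / 2 := by positivity
  simp only [thin, injrad, if_neg hx', mem_ofPred_eq, iSup_le_iff,
    ENNReal.ofReal_le_ofReal_iff hε2, not_forall, not_le]
  refine exists_congr fun ρ => ⟨fun ⟨h1, h2⟩ => ⟨h2, h1.2⟩, fun h => ⟨⟨?_, h.2⟩, h.1⟩⟩
  linarith [h.1]

theorem mem_thin_of_mem_core (hα : α ≠ 2 * Real.pi) (ε : ℝ) {x : SolidTorus α lam τ}
    (hx : x ∈ core α lam τ) : x ∈ thin α lam τ ε := by
  simp [thin, injrad, hα, hx]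

/-- The thin part is a union of equidistant tori, closed under passing to smaller radii. -/
theorem mem_thin_of_radius_le (hα : 0 < α) (hα' : α ≤ 2 * Real.pi) (hlam : 0 < lam) {ε : ℝ}
    (hε : 0 < ε) {r r' ζ' θ' : ℝ} (hr : 0 ≤ r) (hrr' : r ≤ r')
    (h : mk α lam τ (pt r' ζ' θ') ∈ thin α lam τ ε) (ζ θ : ℝ) :
    mk α lam τ (pt r ζ θ) ∈ thin α lam τ ε := by
  by_contra hx
  have hr0 : 0 < r ∨ α = 2 * Real.pi := by
    by_contra! hr0
    exact hx (mem_thin_of_mem_core hr0.2 _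
      ((mk_pt_mem_core_iff hr ζ θ).2 (le_antisymm hr0.1 hr)))
  have hcore {s ζ θ : ℝ} (hs : r ≤ s) : α = 2 * Real.pi ∨ mk α lam τ (pt s ζ θ) ∉ core α lam τ := by
    rcases hr0 with hr0 | hr0
    · right
      rw [mk_pt_mem_core_iff (hr.trans hs)]
      linarith
    · exact Or.inl hr0
  obtain ⟨ρ, hρ, hball⟩ := (notMem_thin_iff hε (hcore le_rfl)).1 hx
  exact (notMem_thin_iff hε (hcore hrr')).2
    ⟨ρ, hρ, isHyperbolicBall_mono_radius hα hα' hlam hr hr0 hrr' hball ζ' θ'⟩ h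

theorem le_of_notMem_thin (hα : 0 < α) (hα' : α ≤ 2 * Real.pi) (hlam : 0 < lam)
    (hlam' : lam ≤ 2.97) {ε : ℝ} (hε : 0 < ε) {r ζ θ : ℝ} (hr : 0 < r)
    (h : mk α lam τ (pt r ζ θ) ∉ thin α lam τ ε) :
    ε ≤ cosh r * √(4 * Real.pi / √3 * lam) := by
  obtain ⟨ρ, hρ, hball⟩ := (notMem_thin_iff hε
    (Or.inr fun hc => hr.ne' ((mk_pt_mem_core_iff hr.le ζ θ).1 hc))).1 h
  linarith [two_mul_le_of_isHyperbolicBall hα hα' hlam hlam' hr hball]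

/-- The boundary of a tube about the core is an equidistant torus. -/
theorem frontier_eq_equidistantTorus {T : Set (SolidTorus α lam τ)} {r₀ : ℝ} (hr₀ : 0 ≤ r₀)
    (hlt : ∀ r ζ θ, 0 ≤ r → r < r₀ → mk α lam τ (pt r ζ θ) ∈ T)
    (hgt : ∀ r ζ θ, r₀ < r → mk α lam τ (pt r ζ θ) ∉ T)
    (hcore : r₀ = 0 → core α lam τ ⊆ T) : frontier T = equidistantTorus α lam τ r₀ := by
  ext x
  obtain ⟨r, ζ, θ, hr, rfl⟩ := exists_eq_mk_pt x
  have hcont := continuous_infDist_pt (core α lam τ)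
  rw [equidistantTorus, mem_ofPred_eq, infDist_mk_pt hr, frontier_eq_closure_inter_closure]
  constructor
  · rintro ⟨h1, h2⟩
    by_contra hne
    rcases lt_or_gt_of_ne hne with h | h
    · refine mem_closure_iff.1 h2 _ (isOpen_lt hcont (continuous_const (y := r₀))) ?_ |>.elim ?_
      · rwa [mem_ofPred_eq, infDist_mk_pt hr]
      · rintro y ⟨hy, hyT⟩
        obtain ⟨s, ζ', θ', hs, rfl⟩ := exists_eq_mk_pt y
        rw [mem_ofPred_eq, infDist_mk_pt hs] at hy
        exact hyT (hlt s ζ' θ' hs hy)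
    · refine mem_closure_iff.1 h1 _ (isOpen_lt (continuous_const (y := r₀)) hcont) ?_ |>.elim ?_
      · rwa [mem_ofPred_eq, infDist_mk_pt hr]
      · rintro y ⟨hy, hyT⟩
        obtain ⟨s, ζ', θ', hs, rfl⟩ := exists_eq_mk_pt y
        rw [mem_ofPred_eq, infDist_mk_pt hs] at hy
        exact hgt s ζ' θ' hy hyT
  · rintro rfl
    refine ⟨?_, Metric.mem_closure_iff.2 fun η hη => ?_⟩
    -- At radius `0` there are no smaller radii to approximate from, which is why `hcore` is
    -- required.
    · rcases hr.eq_or_lt with h0 | h0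
      · exact subset_closure (hcore h0.symm ((mk_pt_mem_core_iff hr ζ θ).2 h0.symm))
      · refine Metric.mem_closure_iff.2 fun η hη => ?_
        have hs : 0 ≤ max 0 (r - η / 2) := le_max_left _ _
        have hs' : max 0 (r - η / 2) < r := max_lt h0 (by linarith)
        refine ⟨_, hlt _ ζ θ hs hs', ?_⟩
        rw [SolidTorus.dist_mk_radial hr hs, abs_of_pos (by linarith)]
        linarith [le_max_right 0 (r - η / 2)]
    · refine ⟨_, hgt (r + η / 2) ζ θ (by linarith), ?_⟩
      rw [SolidTorus.dist_mk_radial hr (by linarith), abs_sub_comm, abs_of_pos (by linarith)]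
      linarith

/-- The thin part, if nonempty, is a tube about the core. -/
theorem exists_isTubeRadius (hα : 0 < α) (hα' : α ≤ 2 * Real.pi) (hlam : 0 < lam) {ε : ℝ}
    (hε : 0 < ε) (hne : (thin α lam τ ε).Nonempty) :
    ∃ r₀, 0 ≤ r₀ ∧ IsTubeRadius α lam τ ε r₀ ∧
      ∀ r ζ θ, r₀ < r → mk α lam τ (pt r ζ θ) ∉ thin α lam τ ε := by
  set J := {r | 0 ≤ r ∧ mk α lam τ (pt r 0 0) ∈ thin α lam τ ε} with hJ
  obtain ⟨x, hx⟩ := hne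
  obtain ⟨s, ζs, θs, hs, rfl⟩ := exists_eq_mk_pt x
  have hJ0 : (0 : ℝ) ∈ J := ⟨le_rfl, mem_thin_of_radius_le hα hα' hlam hε le_rfl hs hx 0 0⟩
  -- Any radius above `ε / 2` would do: points at distance `R` are then outside the thin part, so
  -- the radii in `J` are bounded.
  obtain ⟨R, hR0, hR⟩ := exists_isHyperbolicBall hα hα' hlam τ (ρ := ε / 2 + 1) (by positivity)
  have hJR : R ∈ upperBounds J := by
    rintro r ⟨hr, hrT⟩
    by_contra! hlt
    refine (notMem_thin_iff hε (Or.inr fun hc => ?_)).2 ⟨_, by linarith, hR 0 0⟩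
      (mem_thin_of_radius_le hα hα' hlam hε hR0.le hlt.le hrT 0 0)
    exact hR0.ne' ((mk_pt_mem_core_iff hR0.le 0 0).1 hc)
  have h0 : 0 ≤ sSup J := le_csSup ⟨R, hJR⟩ hJ0
  have hgt : ∀ r ζ θ, sSup J < r → mk α lam τ (pt r ζ θ) ∉ thin α lam τ ε := by
    intro r ζ θ hr hT
    have hr0 : 0 ≤ r := h0.trans hr.le
    exact hr.not_ge (le_csSup ⟨R, hJR⟩
      ⟨hr0, mem_thin_of_radius_le hα hα' hlam hε hr0 le_rfl hT 0 0⟩)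
  refine ⟨sSup J, h0, frontier_eq_equidistantTorus h0 ?_ hgt ?_, hgt⟩
  · intro r ζ θ hr hlt
    obtain ⟨r', ⟨-, hT⟩, hrr'⟩ := exists_lt_of_lt_csSup ⟨0, hJ0⟩ hlt
    exact mem_thin_of_radius_le hα hα' hlam hε hr hrr'.le hT ζ θ
  · intro _ y hy
    obtain ⟨r, ζ, θ, hr, rfl⟩ := exists_eq_mk_pt y
    obtain rfl := (mk_pt_mem_core_iff hr ζ θ).1 hy
    exact mem_thin_of_radius_le hα hα' hlam hε le_rfl le_rfl hJ0.2 ζ θ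

/-- For `r ≥ 0` the equidistant torus is nonempty, and the radius can be read off from any of its
points; this also excludes negative `r'`. -/
theorem IsTubeRadius.eq {ε r r' : ℝ} (h : IsTubeRadius α lam τ ε r)
    (h' : IsTubeRadius α lam τ ε r') (hr : 0 ≤ r) : r' = r := by
  have h1 : mk α lam τ (pt r 0 0) ∈ equidistantTorus α lam τ r := infDist_mk_pt hr 0 0
  rw [← show frontier _ = _ from h, show frontier _ = _ from h'] at h1
  rw [← infDist_mk_pt (α := α) (lam := lam) (τ := τ) hr 0 0]
  exact Eq.symm h1

end SolidTorus

theorem four_pi_div_sqrt_three_le : 4 * Real.pi / √3 ≤ 7.256 := by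
  have h3 : (1.732 : ℝ) ≤ √3 := Real.le_sqrt_of_sq_le (by norm_num)
  rw [div_le_iff₀ (by positivity)]
  linarith [Real.pi_lt_d4]

end TubeModel
end

theorem proposition7p1 (α lam τ ε : ℝ) (hα : 0 < α) (hα' : α ≤ 2 * Real.pi)
    (hlam : 0 < lam) (hlam' : lam ≤ 2.97) (hε : 0 < ε)
    (hne : (TubeModel.SolidTorus.thin α lam τ ε).Nonempty) :
    (∃! r : ℝ, TubeModel.SolidTorus.IsTubeRadius α lam τ ε r) ∧
      ∀ r : ℝ, TubeModel.SolidTorus.IsTubeRadius α lam τ ε r →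
        Real.cosh r ≥ ε / √(4 * Real.pi / √3 * lam) ∧
          ε / √(4 * Real.pi / √3 * lam) ≥ ε / √(7.256 * lam) := by
  obtain ⟨r₀, hr₀, htube, hgt⟩ :=
    TubeModel.SolidTorus.exists_isTubeRadius hα hα' hlam hε hne
  have huniq (r : ℝ) (hr : TubeModel.SolidTorus.IsTubeRadius α lam τ ε r) : r = r₀ :=
    htube.eq hr hr₀
  have hpos : 0 < 4 * Real.pi / √3 * lam := by positivity
  refine ⟨⟨r₀, htube, huniq⟩, fun r hr => ⟨?_, ?_⟩⟩
  · obtain rfl := huniq r hr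
    rw [ge_iff_le, div_le_iff₀ (Real.sqrt_pos.2 hpos)]
    -- Points at the tube radius may themselves be thin, so the estimate is made at every `s > r`
    -- and passed to the limit.
    have hlim : Filter.Tendsto (fun s => Real.cosh s * √(4 * Real.pi / √3 * lam))
        (nhdsWithin r (Ioi r)) (nhds (Real.cosh r * √(4 * Real.pi / √3 * lam))) :=
      ((Real.continuous_cosh.tendsto r).mul_const _).mono_left nhdsWithin_le_nhds
    refine ge_of_tendsto hlim (eventually_nhdsWithin_of_forall fun s hs => ?_)
    exact TubeModel.SolidTorus.le_of_notMem_thin hα hα' hlam hlam' hε (hr₀.trans_lt hs)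
      (hgt s 0 0 hs)
  · refine div_le_div_of_nonneg_left hε.le (Real.sqrt_pos.2 hpos) (Real.sqrt_le_sqrt ?_)
    exact mul_le_mul_of_nonneg_right TubeModel.four_pi_div_sqrt_three_le hlam.le
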